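/- **Setting.** A composition of $k\ge 0$ is a finite list $\alpha=(\alpha_1,\dots,\alpha_\ell)$ of positive integers with sum $|\alpha|=k$ (written $\alpha\vDash k$); $\ell(\alpha)=\ell$, and $\mathrm{set}(\alpha)=\{\alpha_1,\alpha_1+\alpha_2,\dots,\alpha_1+\cdots+\alpha_{\ell-1}\}$. Its diagram has $\alpha_i$ left-justified boxes $(i,1),\dots,(i,\alpha_i)$ in row $i$, rows being numbered from top to bottom. Write $\alpha\succcurlyeq\beta$ if $\alpha$ arises from $\beta$ by adding together adjacent parts. Let $\mathbf{NSym}=\mathbb{Q}\langle \mathbf h_1,\mathbf h_2,\dots\rangle$ be the free associative algebra, $\mathbf h_\alpha=\mathbf h_{\alpha_1}\cdots\mathbf h_{\alpha_\ell}$, and $$\mathbf r_\beta=\sum_{\alpha\succcurlyeq\beta}(-1)^{\ell(\beta)-\ell(\alpha)}\mathbf h_\alpha,\qquad \Psi_n=\sum_{k=0}^{n-1}(-1)^k\,\mathbf r_{(1^k,\,n-k)}\quad(n\ge 1).$$ A standard reverse composition tableau (SRCT) of shape $\alpha\vDash k$ is a filling $\tau$ of the boxes of $\alpha$ using each of $1,\dots,k$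 exactly once such that rows decrease from left to right, the first column increases from top to bottom, and, whenever $i<j$, $(j,c+1)\in\alpha$ and $(i,c)\in\alpha$ with $\tau(i,c)\ge\tau(j,c+1)$, one has $(i,c+1)\in\alpha$ and $\tau(i,c+1)>\tau(j,c+1)$. Its descent set consists of the $v\in\{1,\dots,k-1\}$ such that $v+1$ lies in a column weakly to the right of that of $v$. Let $d_{\alpha,\beta}$ be the number of SRCTs of shape $\alpha$ whose descent set is $\mathrm{set}(\beta)$. The noncommutative Schur functions $\mathbf s_\alpha$ of Bessenrodt, Luoto and van Willigenburg are defined by solving, for each $k\ge 0$, the linear system $$\mathbf r_\beta=\sum_{\alpha\vDash k}d_{\alpha,\beta}\,\mathbf s_\alpha\qquad(\beta\vDash k).\tag{1}$$ Let $<_c$ be the transitive closure of the relation $\lessdot_c$ on compositions in which $\beta\lessdot_c\alpha$ iff $\alpha=(1,\beta_1,\dots,\beta_\ell)$, or $\alpha=(\beta_1,\dots,\beta_k+1,\dots,\beta_\ell)$ for some $k$ with $\beta_i\ne\beta_k$ for all $i<k$. For $\alpha<_c\beta$ let $\beta/\!\!/\alpha$ be the set of boxes of $\beta$ not in $\alpha$,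 where the diagram of $\alpha$ is placed in the bottom left corner of that of $\beta$ (i.e. row $i$ of $\alpha$ lies in row $i+\ell(\beta)-\ell(\alpha)$ of $\beta$). It is an *nc border strip* if * the set of columns containing boxes of $\beta/\!\!/\alpha$ is an interval of integers; * whenever $(i,1),(i,2)\in\beta/\!\!/\alpha$, the box $(i,1)$ is the bottommost box of $\beta/\!\!/\alpha$ in column $1$; * whenever $j\ge2$ and $(i,j),(i,j+1)\in\beta/\!\!/\alpha$, the box $(i,j)$ is the topmost box of $\beta/\!\!/\alpha$ in column $j$. Its height $ht(\beta/\!\!/\alpha)$ is one less than the number of rows containing boxes of $\beta/\!\!/\alpha$. Column $j+1$ is *north-east* of column $j$ in $\beta/\!\!/\alpha$ if both columns contain boxes of $\beta/\!\!/\alpha$ and $i_1<i_2$ for all boxes $(i_1,j+1),(i_2,j)\in\beta/\!\!/\alpha$. Let $P_{\alpha,n}$ be the set of compositions $\beta>_c\alpha$ of $|\alpha|+n$ such that $\beta/\!\!/\alpha$ is an nc border strip (of size $n$) in which no column $j+1$ is north-east of column $j$. **Theorem (noncommutative Murnaghan–Nakayama rule).** The relations (1) can be solved, so that the elements $\mathbf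 s_\alpha$ are well defined and satisfy (1); and for every composition $\alpha$ and every integer $n\ge1$, $$\Psi_n\cdot\mathbf s_\alpha=\sum_{\beta\in P_{\alpha,n}}(-1)^{ht(\beta/\!\!/\alpha)}\,\mathbf s_\beta .$$ -/

import Mathlib

namespace NCSchur

open Finset

/-! ### The algebra of noncommutative symmetric functions -/

/-- `NSym`, the free associative `ℚ`-algebra on generators `h_1, h_2, …`. -/
abbrev NSym : Type := FreeAlgebra ℚ ℕ+

/-- The generator `h_k` for `k ≥ 1`, with the usual convention `h_0 = 1`. -/
noncomputable def completeH (k : ℕ) : NSym :=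
  if hk : 0 < k then FreeAlgebra.ι ℚ (⟨k, hk⟩ : ℕ+) else 1

/-- `h_α = h_{α_1} h_{α_2} ⋯ h_{α_k}`. -/
noncomputable def completeHComp {n : ℕ} (α : Composition n) : NSym :=
  (α.blocks.map completeH).prod

/-- `α ≽ β`: the parts of `α` are obtained, in order, by adding together adjacent parts of `β`,
that is, by cutting the list of parts of `β` into consecutive segments and summing each one. -/
def IsCoarsening {n : ℕ} (α β : Composition n) : Prop :=
  ∃ L : List (List ℕ), L.flatten = β.blocks ∧ L.map List.sum = α.blocks

open Classical in
/-- The noncommutative ribbon Schur function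
`r_β = ∑_{α ≽ β} (-1)^{ℓ(β) - ℓ(α)} h_α` (a coarsening has at most as many parts). -/
noncomputable def ribbon {n : ℕ} (β : Composition n) : NSym :=
  ∑ α : Composition n with IsCoarsening α β,
    (-1 : ℚ) ^ (β.length - α.length) • completeHComp α

/-- The hook composition `(1^k, n - k)` of `n`, for `0 ≤ k ≤ n - 1`. -/
def hook (n : ℕ) (k : Fin n) : Composition n where
  blocks := List.replicate k 1 ++ [n - k]
  blocks_pos := by
    intro i hi
    have hk := k.isLt
    simp only [List.mem_append, List.mem_replicate, List.mem_singleton] at hi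
    omega
  blocks_sum := by
    have hk := k.isLt
    simp only [List.sum_append, List.sum_replicate, List.sum_singleton, smul_eq_mul]
    omega

/-- The noncommutative power sum of the first kind
`Ψ_n = ∑_{k=0}^{n-1} (-1)^k r_{(1^k, n-k)}`. -/
noncomputable def powerSum (n : ℕ) : NSym :=
  ∑ k : Fin n, (-1 : ℚ) ^ (k : ℕ) • ribbon (hook n k)

/-! ### Standard reverse composition tableaux

Rows and columns are numbered from `0`: the box `(i, j)` is the one in the `(i+1)`-st row from the
top and the `(j+1)`-st column from the left. -/

/-- `(i, j)` is a box of the reverse composition diagram with row lengths `α` (top to bottom). -/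
def IsBox (α : List ℕ) (i j : ℕ) : Prop := j < α.getD i 0

/-- `τ` is a semistandard reverse composition tableau of (straight) shape `α`; positions outside the
diagram carry the value `0`. -/
structure IsSSRCT (α : List ℕ) (τ : ℕ → ℕ → ℕ) : Prop where
  pos : ∀ i j, IsBox α i j → 0 < τ i j
  zero : ∀ i j, ¬ IsBox α i j → τ i j = 0
  row_weak : ∀ i j, IsBox α i (j + 1) → τ i (j + 1) ≤ τ i j
  col_strict : ∀ i j, i < j → IsBox α i 0 → IsBox α j 0 → τ i 0 < τ j 0
  triple : ∀ i j k, i < j → IsBox α j (k + 1) → τ j (k + 1) ≤ τ i k →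
    IsBox α i (k + 1) ∧ τ j (k + 1) < τ i (k + 1)

/-- `τ` is a standard reverse composition tableau of shape `α ⊨ n`: semistandard, and every element
of `{1, …, n}` occurs in exactly one box (hence, by counting, nothing else occurs). -/
structure IsSRCT {n : ℕ} (α : Composition n) (τ : ℕ → ℕ → ℕ) : Prop where
  ssrct : IsSSRCT α.blocks τ
  standard : ∀ v, 1 ≤ v → v ≤ n → ∃! c : ℕ × ℕ, IsBox α.blocks c.1 c.2 ∧ τ c.1 c.2 = v

/-- The descent set of a tableau of size `n`: all `1 ≤ v ≤ n - 1` such that `v + 1` lies weakly to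
the right of `v`. -/
def descentSet {n : ℕ} (α : Composition n) (τ : ℕ → ℕ → ℕ) : Set ℕ :=
  {v | 1 ≤ v ∧ v < n ∧ ∃ i j i' j', IsBox α.blocks i j ∧ τ i j = v ∧
    IsBox α.blocks i' j' ∧ τ i' j' = v + 1 ∧ j ≤ j'}

/-- `set(β) = {β_1, β_1 + β_2, …, β_1 + ⋯ + β_{ℓ-1}}`. -/
def partialSums {n : ℕ} (β : Composition n) : Set ℕ :=
  {v | ∃ i, 0 < i ∧ i < β.length ∧ v = β.sizeUpTo i}

/-- `d_{α,β}`: the number of standard reverse composition tableaux of shape `α` with descent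
composition `β`, i.e. with descent set `set(β)`. -/
noncomputable def numSRCT {n : ℕ} (α β : Composition n) : ℕ :=
  Set.ncard {τ : ℕ → ℕ → ℕ | IsSRCT α τ ∧ descentSet α τ = partialSums β}

/-! ### Noncommutative Schur functions -/

/-- The matrix of the linear system `r_β = ∑_α d_{α,β} s_α`; row `β`, column `α`. -/
noncomputable def descentMatrix (n : ℕ) : Matrix (Composition n) (Composition n) ℚ :=
  Matrix.of fun β α => (numSRCT α β : ℚ)

/-- The noncommutative Schur functions: the solution of `r_β = ∑_α d_{α,β} s_α` for the `s_α`. -/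
noncomputable def ncSchur {n : ℕ} (α : Composition n) : NSym :=
  ∑ β : Composition n, (descentMatrix n)⁻¹ α β • ribbon β

/-! ### The reverse composition poset and skew shapes -/

/-- The cover relation of the reverse composition poset: prepend a part `1`, or increase by one
the leftmost part of some given size `a`. -/
inductive Covers : List ℕ → List ℕ → Prop
  | cons (β : List ℕ) : Covers β (1 :: β)
  | incr (l r : List ℕ) (a : ℕ) (h : a ∉ l) : Covers (l ++ a :: r) (l ++ (a + 1) :: r)

/-- The strict order of the reverse composition poset. -/
def CompLT {m n : ℕ} (α : Composition m) (β : Composition n) : Prop :=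
  Relation.TransGen Covers α.blocks β.blocks

/-- The boxes of the skew reverse composition shape `β // α`. As new rows are added on top, the
inner shape `α` sits in the bottom left corner of `β`: its list of parts is padded on the left with
zeros. -/
def skewShape {m n : ℕ} (α : Composition m) (β : Composition n) : Finset (ℕ × ℕ) :=
  (range β.length ×ˢ range n).filter fun c =>
    (List.replicate (β.length - α.length) 0 ++ α.blocks).getD c.1 0 ≤ c.2 ∧
      c.2 < β.blocks.getD c.1 0

/-- The support (set of occupied columns) is an interval. -/
def IsIntervalShape (S : Finset (ℕ × ℕ)) : Prop :=
  (S.image Prod.snd : Set ℕ).OrdConnected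

/-- nc border strips. Columns are numbered from `0`. -/
structure IsNCBorderStrip (S : Finset (ℕ × ℕ)) : Prop where
  interval : IsIntervalShape S
  first : ∀ i, (i, 0) ∈ S → (i, 1) ∈ S → ∀ i', (i', 0) ∈ S → i' ≤ i
  other : ∀ i j, 1 ≤ j → (i, j) ∈ S → (i, j + 1) ∈ S → ∀ i', (i', j) ∈ S → i ≤ i'

/-- The number of rows occupied, minus one. -/
def height (S : Finset (ℕ × ℕ)) : ℕ := (S.image Prod.fst).card - 1

/-- Column `j + 1` is north-east of column `j`: both columns are occupied, and every box of column
`j + 1` is in a strictly higher row than every box of column `j`. -/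
def IsNorthEast (S : Finset (ℕ × ℕ)) (j : ℕ) : Prop :=
  (∃ i, (i, j) ∈ S) ∧ (∃ i, (i, j + 1) ∈ S) ∧
    ∀ i₁ i₂, (i₁, j + 1) ∈ S → (i₂, j) ∈ S → i₁ < i₂

open Classical in
/-- `P_{α,n}`: the compositions `β >_c α` such that `β // α` is an nc border strip of size `n` none
of whose columns is north-east of the preceding one. -/
noncomputable def stripSet {m : ℕ} (α : Composition m) (n : ℕ) : Finset (Composition (m + n)) :=
  univ.filter fun β => CompLT α β ∧ IsNCBorderStrip (skewShape α β) ∧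
    ∀ j, ¬ IsNorthEast (skewShape α β) j

end NCSchur

/-!
Let `t_c` be the partial operation on reverse composition diagrams that adds a box in column `c`
along a cover of the reverse composition poset: `t_0` puts a new row of length `1` on top, and `t_c`
lengthens the topmost row of length `c`. On the vector space of diagrams these are linear operators,
and the free algebra `NSym` acts by letting `h_k` be the sum of the products `t_{c_k} ⋯ t_{c_1}` with
`c_1 < ⋯ < c_k` (`boxRep`; only the columns `c < N`, for a large bound `N`, are used, which keeps
all sums finite and changes nothing on small diagrams).

*The defining relations.* By inclusion-exclusion (`ribbonOf_eq_wordSum`), `r_β` acts as the sum of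
the words in the `t_c` with descent composition `β`. Reading the columns of the entries `1, 2, …` of
a standard tableau gives a bijection from the standard tableaux of shape `α` to the words that build
`α` from the empty diagram (`numSRCT_eq`), so `r_β` sends the empty diagram to `∑_α d_{α,β} α`
(`onEmpty_ribbon`). Every diagram `α` arises from the empty one by a combination of ribbons: `h_a`
applied to the diagram without its top row, of length `a`, gives `α` plus diagrams with fewer rows
or a shorter top row (`single_mem_map_ribbonSpan`). Hence the matrix `d` is invertible, `s_α` sends
the empty diagram to `α`, and an element of `NSym` of degree `k` is determined by its image of the
empty diagram. The theorem is thereby reduced to the action of `Ψ_n` on the diagram `α`.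

*The action of the power sums.* Newton's identity `∑_i h_i Ψ_{n-i} = n h_n` (`newton_hookSum`)
determines the `Ψ_n` from the `h_k`. Since `t_a` and `t_b` commute for `|a - b| ≥ 2`, splitting off
the factor `1 + t_a z` of least index from the generating function of the `h_k` shows that
`Ψ_n = ∑_a Z_{n,a}`, where `Z_{1,a} = t_a` and
`Z_{n+1,a} = -t_a Z_{n,a} + Z_{n,a+1} t_a - t_a Z_{n,a+1}`
(`leastLetterSum`, `hookSum_coeff_decreasingSeries`).

By induction on `n`, `Z_{n,a}` sends `α` to the signed sum of the `β` for which `β // α` is a strip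
of size `n` with leftmost column `a` (`leastLetterSum_apply_eq_skewCoeff`). A strip with several
boxes in column `a` arises from the first term of the recursion, by adding the bottommost one last.
If there is just one box in column `a` and its row extends further to the right, the strip arises
from the second term; if the row does not extend further, it arises from the third, with one more
row and hence the opposite sign. In the third term, column `a + 1` is north-east of column `a` when
all its boxes are above the new box; then the new box may as well be added first, and the terms
cancel against the remaining ones of the second.

A strip is described here by row lengths, with the order of compositions replaced by a necessary
condition, `IsStrip.left`. That the order does hold is read off from the non-vanishing of the
coefficient (`transGen_of_skewStrip`).
-/

namespace NCSchur

open Finset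

/-! ### Ribbons and Newton's identity in a ring -/

section Ribbon

variable {R : Type*} [Ring R]

/-- The ribbon element attached to a sequence `h` in a ring and the composition with first part `a`
and remaining parts `l`, by the recursion `r_{a,b,…} = h_a r_{b,…} - r_{a+b,…}`. -/
def ribbonOf (h : ℕ → R) : ℕ → List ℕ → R
  | a, [] => h a
  | a, b :: l => h a * ribbonOf h b l - ribbonOf h (a + b) l

theorem mul_ribbonOf (h : ℕ → R) (a b : ℕ) (l : List ℕ) :
    h a * ribbonOf h b l = ribbonOf h a (b :: l) + ribbonOf h (a + b) l := by
  simp [ribbonOf]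

theorem map_ribbonOf {S : Type*} [Ring S] (f : R →+* S) (h : ℕ → R) (a : ℕ) (l : List ℕ) :
    f (ribbonOf h a l) = ribbonOf (fun k => f (h k)) a l := by
  induction l generalizing a with
  | nil => simp [ribbonOf]
  | cons b l ih => simp [ribbonOf, ih]

/-- The alternating sum of the ribbons `(a, 1^k, m - k)`. -/
def nearHookSum (h : ℕ → R) (a m : ℕ) : R :=
  ∑ k ∈ range m, (-1 : R) ^ k * ribbonOf h a (List.replicate k 1 ++ [m - k])

/-- The alternating sum of the hook ribbons `(1^k, n - k)`. -/
def hookSum (h : ℕ → R) : ℕ → R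
  | 0 => 0
  | m + 1 => h (m + 1) - nearHookSum h 1 m

theorem mul_hookSum (h : ℕ → R) (a m : ℕ) :
    h a * hookSum h (m + 1) =
      nearHookSum h a (m + 1) - nearHookSum h (a + 1) m + h (a + (m + 1)) := by
  have h2 : h a * nearHookSum h 1 m =
      ∑ k ∈ range m, (-1 : R) ^ k * ribbonOf h a (1 :: (List.replicate k 1 ++ [m - k])) +
        nearHookSum h (a + 1) m := by
    rw [nearHookSum, nearHookSum, mul_sum, ← sum_add_distrib]
    refine sum_congr rfl fun k _ => ?_
    rw [← mul_add, ← mul_ribbonOf, ← mul_assoc, ← mul_assoc,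
      ((Commute.neg_one_left (h a)).pow_left k).eq]
  have h3 : nearHookSum h a (m + 1) = ribbonOf h a [m + 1] -
      ∑ k ∈ range m, (-1 : R) ^ k * ribbonOf h a (1 :: (List.replicate k 1 ++ [m - k])) := by
    rw [nearHookSum, sum_range_succ', sub_eq_add_neg, ← sum_neg_distrib, add_comm]
    simp [List.replicate_succ, pow_succ]
  rw [hookSum, mul_sub, h2, h3]
  simp only [ribbonOf]
  abel

/-- Newton's identity. -/
theorem newton_hookSum (h : ℕ → R) (h0 : h 0 = 1) (n : ℕ) :
    ∑ p ∈ antidiagonal n, h p.1 * hookSum h p.2 = (n : R) * h n := by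
  rw [Nat.sum_antidiagonal_eq_sum_range_succ_mk]
  cases n with
  | zero => simp [hookSum]
  | succ n =>
    have key : ∀ k ≤ n, ∑ a ∈ range k, h (a + 1) * hookSum h (n + 1 - (a + 1)) =
        nearHookSum h 1 n - nearHookSum h (k + 1) (n - k) + k * h (n + 1) := by
      intro k hk
      induction k with
      | zero => simp
      | succ k ih =>
        rw [sum_range_succ, ih (by omega)]
        obtain ⟨m, rfl⟩ : ∃ m, n = k + m + 1 := ⟨n - k - 1, by omega⟩
        rw [show k + m + 1 + 1 - (k + 1) = m + 1 by omega, show k + m + 1 - k = m + 1 by omega,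
          show k + m + 1 - (k + 1) = m by omega, mul_hookSum,
          show k + 1 + (m + 1) = k + m + 1 + 1 by omega]
        push_cast
        noncomm_ring
    rw [sum_range_succ', sum_range_succ]
    dsimp only
    rw [key n le_rfl]
    simp only [nearHookSum, hookSum, Nat.sub_self, h0, Nat.sub_zero, range_zero, sum_empty]
    push_cast
    noncomm_ring

/-- Newton's identity determines the power sums. -/
theorem eq_of_newton (h p q : ℕ → R) (h0 : h 0 = 1)
    (hpq : ∀ n, ∑ x ∈ antidiagonal n, h x.1 * p x.2 = ∑ x ∈ antidiagonal n, h x.1 * q x.2)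
    (n : ℕ) : p n = q n := by
  induction n using Nat.strong_induction_on with
  | _ n ih =>
    have := hpq n
    cases n with
    | zero => simpa [h0] using this
    | succ n =>
      rw [Nat.antidiagonal_succ, sum_cons, sum_cons] at this
      rw [sum_congr rfl (g := fun x => h x.1 * q x.2)] at this
      · simpa [h0] using this
      · intro x hx
        simp only [mem_map, HasAntidiagonal.mem_antidiagonal, Function.Embedding.prodMap,
          Function.Embedding.coeFn_mk, Prod.exists] at hx
        obtain ⟨i, j, hij, rfl⟩ := hx
        simp only [Prod.map, Function.Embedding.refl_apply]
        rw [ih _ (by omega)]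

end Ribbon

/-! ### Power sums in partially commuting letters -/

section Letters

open PowerSeries

variable {R : Type*} [Ring R]

/-- The generating function `(1 + t_{a+d-1} z) ⋯ (1 + t_{a+1} z) (1 + t_a z)`. -/
noncomputable def decreasingSeries (t : ℕ → R) : ℕ → ℕ → R⟦X⟧
  | 0, _ => 1
  | d + 1, a => decreasingSeries t d (a + 1) * (1 + C (t a) * X)

theorem decreasingSeries_succ (t : ℕ → R) (d a : ℕ) :
    decreasingSeries t (d + 1) a = (1 + C (t (a + d)) * X) * decreasingSeries t d a := by
  induction d generalizing a with
  | zero => simp [decreasingSeries]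
  | succ d ih =>
    rw [decreasingSeries, ih, decreasingSeries, mul_assoc, show a + 1 + d = a + (d + 1) by omega]

theorem coeff_zero_decreasingSeries (t : ℕ → R) (d a : ℕ) :
    coeff 0 (decreasingSeries t d a) = 1 := by
  induction d generalizing a with
  | zero => simp [decreasingSeries]
  | succ d ih =>
    simp only [coeff_zero_eq_constantCoeff, decreasingSeries, map_mul] at ih ⊢
    simp [ih]

theorem coeff_succ_decreasingSeries (t : ℕ → R) (d a n : ℕ) :
    coeff (n + 1) (decreasingSeries t (d + 1) a) =
      coeff (n + 1) (decreasingSeries t d (a + 1)) +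
        coeff n (decreasingSeries t d (a + 1)) * t a := by
  rw [decreasingSeries, mul_add, mul_one, ← mul_assoc, map_add, coeff_succ_mul_X,
    coeff_mul_C]

/-- `z d/dz`. -/
noncomputable def eulerOp (f : R⟦X⟧) : R⟦X⟧ := PowerSeries.mk fun n => (n : R) * coeff n f

theorem eulerOp_mul (f g : R⟦X⟧) : eulerOp (f * g) = eulerOp f * g + f * eulerOp g := by
  ext n
  simp only [eulerOp, coeff_mk, map_add, coeff_mul, mul_sum, ← sum_add_distrib]
  refine sum_congr rfl fun x hx => ?_
  rw [← mem_antidiagonal.1 hx]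
  push_cast
  rw [← mul_assoc (coeff x.1 f), ← (Nat.cast_commute x.2 (coeff x.1 f)).eq]
  noncomm_ring

theorem eulerOp_linear (r : R) : eulerOp (1 + C r * X) = C r * X := by
  ext n
  simp only [eulerOp, coeff_mk, map_add, coeff_one, coeff_C_mul, coeff_X]
  rcases n with _ | _ | n <;> simp

/-- The part of the degree-`n` power sum in which `a` is the least letter that occurs. -/
def leastLetterSum (t : ℕ → R) : ℕ → ℕ → R
  | 0, _ => 0
  | 1, a => t a
  | n + 2, a => -(t a * leastLetterSum t (n + 1) a) +
      (leastLetterSum t (n + 1) (a + 1) * t a - t a * leastLetterSum t (n + 1) (a + 1))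

theorem leastLetterSum_eq_zero {t : ℕ → R} {N : ℕ} (ht : ∀ a, N ≤ a → t a = 0) (n : ℕ) {a : ℕ}
    (ha : N ≤ a) : leastLetterSum t n a = 0 := by
  rcases n with _ | _ | n <;> simp [leastLetterSum, ht a ha]

theorem commute_leastLetterSum {t : ℕ → R} (hc : ∀ a b, a + 2 ≤ b → Commute (t a) (t b))
    (n : ℕ) {a b : ℕ} (hab : a + 2 ≤ b) : Commute (t a) (leastLetterSum t n b) := by
  induction n generalizing b with
  | zero => simp [leastLetterSum]
  | succ n ih =>
    cases n with
    | zero => exact hc a b hab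
    | succ n =>
      have h1 := hc a b hab
      have h2 := ih hab
      have h3 := ih (b := b + 1) (by omega)
      exact ((h1.mul_right h2).neg_right).add_right ((h3.mul_right h1).sub_right (h1.mul_right h3))

/-- The generating function of the power sums in the letters `t_a, …, t_{a+d-1}`. -/
noncomputable def powerSumSeries (t : ℕ → R) (d a : ℕ) : R⟦X⟧ :=
  PowerSeries.mk fun n => ∑ b ∈ range d, leastLetterSum t n (a + b)

theorem linear_mul_powerSumSeries {t : ℕ → R} (hc : ∀ a b, a + 2 ≤ b → Commute (t a) (t b))
    {d a : ℕ} (ht : ∀ c, a + d + 1 ≤ c → t c = 0) :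
    (1 + C (t a) * X) * powerSumSeries t (d + 1) a =
      powerSumSeries t d (a + 1) * (1 + C (t a) * X) + C (t a) * X := by
  ext n
  rw [add_mul, mul_add, mul_assoc, ← mul_assoc (powerSumSeries t d (a + 1))]
  simp only [one_mul, mul_one, map_add, coeff_C_mul]
  have hS : ∀ n, ∑ b ∈ range (d + 1), leastLetterSum t n (a + b) =
      ∑ b ∈ range d, leastLetterSum t n (a + 1 + b) + leastLetterSum t n a := fun n => by
    rw [sum_range_succ']
    simp only [add_zero, Nat.add_comm, Nat.add_left_comm]
  rcases n with _ | _ | n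
  · simp [powerSumSeries, leastLetterSum]
  · simp [powerSumSeries, coeff_succ_mul_X, coeff_succ_X_mul, hS, leastLetterSum]
  · -- only the letter `a + 1` fails to commute with `a`
    have hcomm : (∑ b ∈ range d, leastLetterSum t (n + 1) (a + 1 + b)) * t a -
        t a * ∑ b ∈ range d, leastLetterSum t (n + 1) (a + 1 + b) =
        leastLetterSum t (n + 1) (a + 1) * t a - t a * leastLetterSum t (n + 1) (a + 1) := by
      rcases d with _ | d
      · rw [leastLetterSum_eq_zero ht (n + 1) (a := a + 1) (by omega)]
        simp
      · rw [sum_range_succ', add_mul, mul_add]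
        have : Commute (t a) (∑ b ∈ range d, leastLetterSum t (n + 1) (a + 1 + (b + 1))) :=
          Commute.sum_right _ _ _ fun b _ => commute_leastLetterSum hc _ (by omega)
        rw [this.eq, add_zero]
        abel
    simp only [powerSumSeries, coeff_mk, coeff_succ_mul_X, coeff_succ_X_mul, coeff_X, hS,
      coeff_mul_C]
    rw [leastLetterSum, ← hcomm]
    simp
    noncomm_ring

theorem decreasingSeries_mul_powerSumSeries {t : ℕ → R}
    (hc : ∀ a b, a + 2 ≤ b → Commute (t a) (t b)) {d a : ℕ} (ht : ∀ c, a + d ≤ c → t c = 0) :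
    decreasingSeries t d a * powerSumSeries t d a = eulerOp (decreasingSeries t d a) := by
  induction d generalizing a with
  | zero =>
    ext n
    rcases n with _ | n <;> simp [decreasingSeries, powerSumSeries, eulerOp, coeff_one]
  | succ d ih =>
    rw [decreasingSeries, mul_assoc, linear_mul_powerSumSeries hc fun c hc => ht c (by omega),
      mul_add, ← mul_assoc, ih fun c hc => ht c (by omega), eulerOp_mul, eulerOp_linear]

/-- In letters `t_0, …, t_{N-1}` of which non-adjacent ones commute, the alternating hook sum is the
sum of the contributions of the possible least letters. -/
theorem hookSum_coeff_decreasingSeries {t : ℕ → R}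
    (hc : ∀ a b, a + 2 ≤ b → Commute (t a) (t b)) {N : ℕ} (ht : ∀ c, N ≤ c → t c = 0) (n : ℕ) :
    hookSum (fun k => coeff k (decreasingSeries t N 0)) n =
      ∑ a ∈ range N, leastLetterSum t n a := by
  have h0 := coeff_zero_decreasingSeries t N 0
  refine eq_of_newton (fun k => coeff k (decreasingSeries t N 0)) _
    (fun n => ∑ a ∈ range N, leastLetterSum t n a) h0 (fun n => ?_) n
  rw [newton_hookSum (fun k => coeff k (decreasingSeries t N 0)) h0]
  have := congrArg (coeff n) (decreasingSeries_mul_powerSumSeries hc (d := N) (a := 0)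
    (by simpa using ht))
  rw [coeff_mul] at this
  simpa [powerSumSeries, eulerOp] using this.symm

end Letters

/-! ### Ribbon Schur functions by recursion -/

/-- The ribbon element `ribbonOf` with its composition given as a list; it is `1` for the empty
composition. -/
def ribbonList {R : Type*} [Ring R] (h : ℕ → R) : List ℕ → R
  | [] => 1
  | a :: l => ribbonOf h a l

/-- The coarsenings of the list `a :: l`. -/
def coarsenings : ℕ → List ℕ → Finset (List ℕ)
  | a, [] => {[a]}
  | a, b :: l => (coarsenings b l).image (List.cons a) ∪ coarsenings (a + b) l

theorem mem_coarsenings {a : ℕ} {l α : List ℕ} :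
    α ∈ coarsenings a l ↔ ∃ L : List (List ℕ), [] ∉ L ∧ L.flatten = a :: l ∧ L.map List.sum = α := by
  induction l generalizing a α with
  | nil =>
    simp only [coarsenings, mem_singleton]
    constructor
    · rintro rfl
      exact ⟨[[a]], by simp⟩
    · rintro ⟨L, h0, h1, rfl⟩
      rcases L with _ | ⟨_ | ⟨x, M⟩, L⟩
      · simp at h1
      · simp at h0
      · simp only [List.flatten_cons, List.cons_append, List.cons.injEq, List.append_eq_nil_iff]
          at h1
        obtain ⟨rfl, rfl, hL⟩ := h1
        rcases L with _ | ⟨_ | ⟨y, M⟩, L⟩ <;> simp at h0 hL ⊢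
  | cons b l ih =>
    simp only [coarsenings, mem_union, mem_image, ih]
    constructor
    · rintro (⟨α, ⟨L, h0, h1, rfl⟩, rfl⟩ | ⟨L, h0, h1, rfl⟩)
      · exact ⟨[a] :: L, by simp [h0], by simp [h1], by simp⟩
      · rcases L with _ | ⟨_ | ⟨x, M⟩, L⟩
        · simp at h1
        · simp at h0
        · simp only [List.flatten_cons, List.cons_append, List.cons.injEq] at h1
          obtain ⟨rfl, h1⟩ := h1
          refine ⟨(a :: b :: M) :: L, ?_, by simp [h1], by simp [add_assoc]⟩
          simpa using h0
    · rintro ⟨L, h0, h1, rfl⟩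
      rcases L with _ | ⟨_ | ⟨x, _ | ⟨y, M⟩⟩, L⟩
      · simp at h1
      · simp at h0
      · simp only [List.flatten_cons, List.cons_append, List.cons.injEq, List.nil_append] at h1
        obtain ⟨rfl, h1⟩ := h1
        exact Or.inl ⟨L.map List.sum, ⟨L, by simpa using h0, h1, rfl⟩, by simp⟩
      · simp only [List.flatten_cons, List.cons_append, List.cons.injEq] at h1
        obtain ⟨rfl, rfl, h1⟩ := h1
        exact Or.inr ⟨((x + y) :: M) :: L, by simpa using h0, by simp [h1], by simp [add_assoc]⟩

theorem length_le_of_mem_coarsenings {a : ℕ} {l α : List ℕ} (h : α ∈ coarsenings a l) :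
    α.length ≤ l.length + 1 := by
  induction l generalizing a α with
  | nil => simp [coarsenings] at h; simp [h]
  | cons b l ih =>
    simp only [coarsenings, mem_union, mem_image] at h
    rcases h with ⟨γ, hγ, rfl⟩ | h
    · simpa using ih hγ
    · exact (ih h).trans (by simp)

theorem le_head_of_mem_coarsenings {a : ℕ} {l α : List ℕ} (h : α ∈ coarsenings a l) :
    ∃ b γ, α = b :: γ ∧ a ≤ b := by
  induction l generalizing a α with
  | nil => simp [coarsenings] at h; exact ⟨a, [], h, le_rfl⟩
  | cons b l ih =>
    simp only [coarsenings, mem_union, mem_image] at h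
    rcases h with ⟨γ, hγ, rfl⟩ | h
    · exact ⟨a, γ, rfl, le_rfl⟩
    · obtain ⟨c, γ, rfl, hc⟩ := ih h
      exact ⟨c, γ, rfl, by omega⟩

theorem sum_coarsenings {R : Type*} [Ring R] (h : ℕ → R) (a : ℕ) (l : List ℕ)
    (hl : ∀ b ∈ l, 0 < b) :
    ∑ α ∈ coarsenings a l, (-1 : R) ^ (l.length + 1 - α.length) * (α.map h).prod =
      ribbonOf h a l := by
  induction l generalizing a with
  | nil => simp [coarsenings, ribbonOf]
  | cons b l ih =>
    have hb : 0 < b := hl b (by simp)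
    have hl' : ∀ b ∈ l, 0 < b := fun c hc => hl c (by simp [hc])
    rw [coarsenings, sum_union, sum_image, ribbonOf, ← ih b hl', ← ih (a + b) hl', mul_sum,
      sub_eq_add_neg, ← sum_neg_distrib]
    · congr 1
      · refine sum_congr rfl fun α _ => ?_
        simp only [List.length_cons, Nat.add_sub_add_right, List.map_cons, List.prod_cons]
        rw [← mul_assoc, ← mul_assoc, ((Commute.neg_one_left (h a)).pow_left _).eq]
      · refine sum_congr rfl fun α hα => ?_
        have := length_le_of_mem_coarsenings hα
        rw [List.length_cons, show l.length + 1 + 1 - α.length = (l.length + 1 - α.length) + 1 by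
          omega, pow_succ]
        simp
    · exact fun x _ y _ hxy => (List.cons.inj hxy).2
    · rw [disjoint_left]
      intro α h1 h2
      simp only [mem_image] at h1
      obtain ⟨γ, _, rfl⟩ := h1
      obtain ⟨c, γ', h3, hc⟩ := le_head_of_mem_coarsenings h2
      simp only [List.cons.injEq] at h3
      omega

theorem isCoarsening_iff {n : ℕ} (α β : Composition n) {a : ℕ} {l : List ℕ}
    (hβ : β.blocks = a :: l) : IsCoarsening α β ↔ α.blocks ∈ coarsenings a l := by
  rw [mem_coarsenings]
  constructor
  · rintro ⟨L, h1, h2⟩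
    refine ⟨L, fun h0 => ?_, by rw [h1, hβ], h2⟩
    have : 0 ∈ α.blocks := by
      rw [← h2, List.mem_map]
      exact ⟨[], h0, rfl⟩
    exact (α.blocks_pos this).ne' rfl
  · rintro ⟨L, _, h1, h2⟩
    exact ⟨L, by rw [h1, hβ], h2⟩

theorem exists_blocks_eq {l : List ℕ} (hl : ∀ b ∈ l, 0 < b) {n : ℕ} (hn : l.sum = n) :
    ∃ α : Composition n, α.blocks = l :=
  ⟨⟨l, fun {i} hi => hl i hi, hn⟩, rfl⟩

theorem ribbon_eq {n : ℕ} (β : Composition n) : ribbon β = ribbonList completeH β.blocks := by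
  classical
  rcases hβ : β.blocks with _ | ⟨a, l⟩
  · obtain rfl : n = 0 := by rw [← β.blocks_sum, hβ]; rfl
    have hsub : ∀ γ : Composition 0, γ = β := fun γ =>
      (Fintype.card_le_one_iff_subsingleton.1 (composition_card 0).le).elim γ β
    have hC : ∀ γ : Composition 0, IsCoarsening γ β := fun γ => by
      rw [hsub γ]
      exact ⟨[], by simp [hβ]⟩
    have : (univ : Finset (Composition 0)) = {β} := by
      ext γ; simp [hsub γ]
    simp only [ribbon, hC, filter_true, this, sum_singleton, completeHComp, ribbonList]
    simp [hβ]
  · have hpos : ∀ b ∈ l, 0 < b := fun b hb => β.blocks_pos (by rw [hβ]; simp [hb])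
    rw [ribbon, ribbonList, ← sum_coarsenings completeH a l hpos]
    refine sum_bij (fun α _ => α.blocks) ?_ ?_ ?_ ?_
    · intro α hα
      exact (isCoarsening_iff α β hβ).1 (by simpa using hα)
    · exact fun α _ γ _ h => Composition.ext h
    · intro α hα
      have hα' := hα
      rw [mem_coarsenings] at hα'
      obtain ⟨L, h0, h1, rfl⟩ := hα'
      have hpos' : ∀ c ∈ L.map List.sum, 0 < c := by
        intro c hc
        simp only [List.mem_map] at hc
        obtain ⟨M, hM, rfl⟩ := hc
        rcases M with _ | ⟨x, M⟩
        · exact absurd hM h0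
        · have hx : x ∈ L.flatten := List.mem_flatten.2 ⟨_, hM, by simp⟩
          have := β.blocks_pos (i := x) (by rw [hβ, ← h1]; exact hx)
          simp only [List.sum_cons]
          omega
      have hsum : (L.map List.sum).sum = n := by
        rw [← List.sum_flatten, h1, ← hβ, β.blocks_sum]
      obtain ⟨γ, hγ⟩ := exists_blocks_eq hpos' hsum
      refine ⟨γ, ?_, hγ⟩
      rw [mem_filter, isCoarsening_iff γ β hβ, hγ]
      exact ⟨mem_univ γ, hα⟩
    · intro α _
      have h1 : β.length = l.length + 1 := by rw [← Composition.blocks_length, hβ]; simp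
      rw [h1, ← Composition.blocks_length, Algebra.smul_def]
      simp [completeHComp]

theorem powerSum_eq (n : ℕ) : powerSum n = hookSum completeH n := by
  have h1 : powerSum n = ∑ k ∈ range n, (-1 : ℚ) ^ k •
      ribbonList completeH (List.replicate k 1 ++ [n - k]) := by
    rw [powerSum, ← Fin.sum_univ_eq_sum_range (fun k => (-1 : ℚ) ^ k •
      ribbonList completeH (List.replicate k 1 ++ [n - k]))]
    exact sum_congr rfl fun k _ => by rw [ribbon_eq]; rfl
  rw [h1]
  cases n with
  | zero => simp [hookSum]
  | succ m =>
    rw [sum_range_succ', hookSum, nearHookSum, sub_eq_add_neg, ← sum_neg_distrib, add_comm]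
    congr 1
    · simp [ribbonList, ribbonOf]
    · refine sum_congr rfl fun k _ => ?_
      rw [List.replicate_succ, List.cons_append, ribbonList, Algebra.smul_def]
      simp [pow_succ]

/-- The span of the ribbon Schur functions of degree `k`. -/
noncomputable def ribbonSpan (k : ℕ) : Submodule ℚ NSym :=
  Submodule.span ℚ (Set.range fun β : Composition k => ribbon β)

theorem ribbonList_mem_ribbonSpan {l : List ℕ} (hl : ∀ b ∈ l, 0 < b) :
    ribbonList completeH l ∈ ribbonSpan l.sum := by
  obtain ⟨β, hβ⟩ := exists_blocks_eq hl rfl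
  exact Submodule.subset_span ⟨β, by simp only [ribbon_eq, hβ]⟩

theorem completeH_mul_mem_ribbonSpan {a : ℕ} (ha : 0 < a) {k : ℕ} {x : NSym}
    (hx : x ∈ ribbonSpan k) : completeH a * x ∈ ribbonSpan (a + k) := by
  induction hx using Submodule.span_induction with
  | mem x hx =>
    obtain ⟨β, rfl⟩ := hx
    have hpos : ∀ b ∈ β.blocks, 0 < b := fun b hb => β.blocks_pos hb
    have hsum := β.blocks_sum
    simp only [ribbon_eq]
    generalize β.blocks = B at hpos hsum
    rcases B with _ | ⟨b, l⟩
    · have := ribbonList_mem_ribbonSpan (l := [a]) (by simpa using ha)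
      simpa [ribbonList, ribbonOf, ← hsum] using this
    · have hl : ∀ b ∈ l, 0 < b := fun c hc => hpos c (by simp [hc])
      have hb := hpos b (by simp)
      have h1 := ribbonList_mem_ribbonSpan (l := a :: b :: l)
        (by simpa only [List.mem_cons, forall_eq_or_imp] using ⟨ha, hb, hl⟩)
      have h2 := ribbonList_mem_ribbonSpan (l := (a + b) :: l)
        (by simpa only [List.mem_cons, forall_eq_or_imp] using ⟨by omega, hl⟩)
      simp only [List.sum_cons] at hsum h1 h2
      rw [hsum] at h1
      rw [add_assoc, hsum] at h2
      simp only [ribbonList] at h1 h2 ⊢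
      rw [mul_ribbonOf]
      exact add_mem h1 h2
  | zero => simp
  | add x y _ _ hx hy => rw [mul_add]; exact add_mem hx hy
  | smul c x _ hx => rw [mul_smul_comm]; exact Submodule.smul_mem _ _ hx

theorem ribbon_mul_mem_ribbonSpan {n : ℕ} (β : Composition n) {k : ℕ} {x : NSym}
    (hx : x ∈ ribbonSpan k) : ribbon β * x ∈ ribbonSpan (n + k) := by
  classical
  have key : ∀ l : List ℕ, (∀ b ∈ l, 0 < b) →
      (l.map completeH).prod * x ∈ ribbonSpan (l.sum + k) := by
    intro l hpos
    induction l with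
    | nil => simpa using hx
    | cons a l ih =>
      rw [List.map_cons, List.prod_cons, List.sum_cons, mul_assoc, add_assoc]
      exact completeH_mul_mem_ribbonSpan (hpos a (by simp)) (ih fun b hb => hpos b (by simp [hb]))
  rw [ribbon, sum_mul]
  refine sum_mem fun α _ => ?_
  rw [smul_mul_assoc]
  refine Submodule.smul_mem _ _ ?_
  have := key α.blocks fun b hb => α.blocks_pos hb
  rwa [α.blocks_sum] at this

theorem powerSum_mul_mem_ribbonSpan (n : ℕ) {k : ℕ} {x : NSym} (hx : x ∈ ribbonSpan k) :
    powerSum n * x ∈ ribbonSpan (n + k) := by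
  rw [powerSum, sum_mul]
  refine sum_mem fun α _ => ?_
  rw [smul_mul_assoc]
  exact Submodule.smul_mem _ _ (ribbon_mul_mem_ribbonSpan _ hx)

/-! ### Ribbons as sums over words with a given descent composition -/

section Words

/-- The words of length `k` in the letters `0, …, N - 1`. -/
def words (N : ℕ) : ℕ → Finset (List ℕ)
  | 0 => {[]}
  | k + 1 => (range N ×ˢ words N k).image fun p => p.1 :: p.2

theorem mem_words {N k : ℕ} {w : List ℕ} : w ∈ words N k ↔ w.length = k ∧ ∀ c ∈ w, c < N := by
  induction k generalizing w with
  | zero => simp +contextual [words]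
  | succ k ih =>
    rcases w with _ | ⟨c, w⟩
    · simp [words]
    · simp [words, ih]
      tauto

theorem sum_words_succ {M : Type*} [AddCommMonoid M] (N k : ℕ) (f : List ℕ → M) :
    ∑ w ∈ words N (k + 1), f w = ∑ c ∈ range N, ∑ w ∈ words N k, f (c :: w) := by
  rw [words, sum_image, sum_product]
  rintro ⟨a, v⟩ _ ⟨b, w⟩ _ h
  simpa using h

/-- Increase the first entry of a list by one. -/
def bumpHead : List ℕ → List ℕ
  | [] => []
  | b :: l => (b + 1) :: l

/-- The lengths of the maximal strictly decreasing runs of the word `c :: w`. -/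
def descComp : ℕ → List ℕ → List ℕ
  | _, [] => [1]
  | c, d :: w => if c ≤ d then 1 :: descComp d w else bumpHead (descComp d w)

theorem descComp_eq_cons (c : ℕ) (w : List ℕ) : ∃ b l, descComp c w = (b + 1) :: l := by
  induction w generalizing c with
  | nil => exact ⟨0, [], rfl⟩
  | cons d w ih =>
    obtain ⟨b, l, h⟩ := ih d
    rw [descComp, h]
    split_ifs
    · exact ⟨0, (b + 1) :: l, rfl⟩
    · exact ⟨b + 1, l, rfl⟩

theorem descComp_pos (c : ℕ) (w : List ℕ) : ∀ b ∈ descComp c w, 0 < b := by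
  induction w generalizing c with
  | nil => simp [descComp]
  | cons d w ih =>
    have := ih d
    obtain ⟨b, l, h⟩ := descComp_eq_cons d w
    rw [descComp]
    rw [h] at this ⊢
    split_ifs
    · simpa using this
    · simp only [bumpHead, List.mem_cons, forall_eq_or_imp] at this ⊢
      exact ⟨by omega, this.2⟩

theorem descComp_sum (c : ℕ) (w : List ℕ) : (descComp c w).sum = w.length + 1 := by
  induction w generalizing c with
  | nil => simp [descComp]
  | cons d w ih =>
    have := ih d
    obtain ⟨b, l, h⟩ := descComp_eq_cons d w
    rw [descComp]
    rw [h] at this ⊢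
    split_ifs <;> simp [bumpHead] at this ⊢ <;> omega

variable {R : Type*} [Ring R]

/-- The sum of all words with first letter `c` and descent composition `β`, evaluated at `t`. -/
noncomputable def wordSum (t : ℕ → R) (N : ℕ) (β : List ℕ) (c : ℕ) : R :=
  ∑ w ∈ words N (β.sum - 1), if descComp c w = β then t c * (w.map t).prod else 0

theorem wordSum_one (t : ℕ → R) (N c : ℕ) : wordSum t N [1] c = t c := by
  simp [wordSum, words, descComp]

theorem wordSum_one_cons (t : ℕ → R) (N b : ℕ) (l : List ℕ) (c : ℕ) :
    wordSum t N (1 :: (b + 1) :: l) c =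
      t c * ∑ d ∈ range N, if c ≤ d then wordSum t N ((b + 1) :: l) d else 0 := by
  have h : (1 :: (b + 1) :: l).sum - 1 = (((b + 1) :: l).sum - 1) + 1 := by simp; omega
  rw [wordSum, h, sum_words_succ, mul_sum]
  refine sum_congr rfl fun d _ => ?_
  split_ifs with hcd
  · rw [wordSum, mul_sum]
    refine sum_congr rfl fun w _ => ?_
    simp [descComp, hcd]
  · rw [mul_zero]
    refine sum_eq_zero fun w _ => ?_
    obtain ⟨b', l', h'⟩ := descComp_eq_cons d w
    simp [descComp, hcd, h', bumpHead]

theorem wordSum_succ_cons (t : ℕ → R) (N b : ℕ) (l : List ℕ) (c : ℕ) :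
    wordSum t N ((b + 2) :: l) c =
      t c * ∑ d ∈ range N, if d < c then wordSum t N ((b + 1) :: l) d else 0 := by
  have h : ((b + 2) :: l).sum - 1 = (((b + 1) :: l).sum - 1) + 1 := by simp; omega
  rw [wordSum, h, sum_words_succ, mul_sum]
  refine sum_congr rfl fun d _ => ?_
  split_ifs with hcd
  · rw [wordSum, mul_sum]
    refine sum_congr rfl fun w _ => ?_
    obtain ⟨b', l', h'⟩ := descComp_eq_cons d w
    simp [descComp, not_le.2 hcd, h', bumpHead]
  · rw [mul_zero]
    refine sum_eq_zero fun w _ => ?_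
    simp [descComp, not_lt.1 hcd]

theorem wordSum_mul (t : ℕ → R) (N a b : ℕ) (l : List ℕ) (c : ℕ) :
    wordSum t N [a + 1] c * ∑ d ∈ range N, wordSum t N ((b + 1) :: l) d =
      wordSum t N ((a + 1) :: (b + 1) :: l) c + wordSum t N ((a + 1 + (b + 1)) :: l) c := by
  induction a generalizing c with
  | zero =>
    rw [zero_add, wordSum_one, wordSum_one_cons, show 1 + (b + 1) = b + 2 by omega,
      wordSum_succ_cons, ← mul_add, ← sum_add_distrib]
    congr 1
    refine sum_congr rfl fun d _ => ?_
    by_cases h : c ≤ d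
    · simp [h, not_lt.2 h]
    · simp [h, not_le.1 h]
  | succ a ih =>
    rw [show a + 1 + 1 + (b + 1) = a + b + 1 + 2 by omega, wordSum_succ_cons, wordSum_succ_cons,
      wordSum_succ_cons, ← mul_add, ← sum_add_distrib, mul_assoc, sum_mul]
    congr 1
    refine sum_congr rfl fun d _ => ?_
    split_ifs
    · rw [ih, show a + b + 1 + 1 = a + 1 + (b + 1) by omega]
    · simp

open PowerSeries in
theorem coeff_decreasingSeries_succ (t : ℕ → R) (N n : ℕ) :
    coeff (n + 1) (decreasingSeries t N 0) =
      ∑ c ∈ range N, t c * coeff n (decreasingSeries t c 0) := by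
  induction N with
  | zero => simp [decreasingSeries, coeff_one]
  | succ N ih =>
    rw [decreasingSeries_succ, add_mul, one_mul, map_add, ih, sum_range_succ, mul_assoc,
      coeff_C_mul, coeff_succ_X_mul, zero_add]

open PowerSeries in
theorem wordSum_single (t : ℕ → R) {N c : ℕ} (hc : c < N) (n : ℕ) :
    wordSum t N [n + 1] c = t c * coeff n (decreasingSeries t c 0) := by
  induction n generalizing c with
  | zero =>
    rw [zero_add, wordSum_one, coeff_zero_decreasingSeries, mul_one]
  | succ n ih =>
    rw [wordSum_succ_cons, coeff_decreasingSeries_succ, ← sum_filter]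
    congr 1
    have : (range N).filter (· < c) = range c := by ext; simp; omega
    rw [this]
    exact sum_congr rfl fun d hd => ih (by simp at hd; omega)

open PowerSeries in
/-- The ribbons of the complete functions in the letters `t_0, …, t_{N-1}` are the sums of the words
with the given descent composition. -/
theorem ribbonOf_eq_wordSum (t : ℕ → R) (N a : ℕ) (l : List ℕ) (hl : ∀ b ∈ a :: l, 0 < b) :
    ribbonOf (fun k => coeff k (decreasingSeries t N 0)) a l =
      ∑ c ∈ range N, wordSum t N (a :: l) c := by
  induction l generalizing a with
  | nil =>
    obtain ⟨a, rfl⟩ : ∃ a', a = a' + 1 := ⟨a - 1, by simp at hl; omega⟩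
    rw [ribbonOf, coeff_decreasingSeries_succ]
    exact sum_congr rfl fun c hc => (wordSum_single t (by simpa using hc) a).symm
  | cons b l ih =>
    simp only [List.mem_cons, forall_eq_or_imp] at hl ih
    obtain ⟨a, rfl⟩ : ∃ a', a = a' + 1 := ⟨a - 1, by omega⟩
    obtain ⟨b, rfl⟩ : ∃ b', b = b' + 1 := ⟨b - 1, by omega⟩
    rw [ribbonOf, ih (b + 1) ⟨by omega, hl.2.2⟩, ih (a + 1 + (b + 1)) ⟨by omega, hl.2.2⟩,
      coeff_decreasingSeries_succ, sub_eq_iff_eq_add, ← sum_add_distrib, sum_mul]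
    refine sum_congr rfl fun c hc => ?_
    rw [← wordSum_mul, wordSum_single t (by simpa using hc)]

end Words

/-! ### Box-adding operators -/

/-- Increase the leftmost entry equal to `c` by one, if there is one. -/
def growPart (c : ℕ) : List ℕ → Option (List ℕ)
  | [] => none
  | b :: l => if b = c then some ((c + 1) :: l) else (growPart c l).map (List.cons b)

/-- Add a box in column `c` to a reverse composition diagram, along a cover of the reverse
composition poset. -/
def step : ℕ → List ℕ → Option (List ℕ)
  | 0, l => some (1 :: l)
  | c + 1, l => growPart (c + 1) l

theorem getD_set_self (γ : List ℕ) {p : ℕ} (hp : p < γ.length) (v : ℕ) :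
    (γ.set p v).getD p 0 = v := by
  simp [List.getD_eq_getElem?_getD, hp]

theorem getD_set_ne (γ : List ℕ) {p i : ℕ} (h : i ≠ p) (v : ℕ) :
    (γ.set p v).getD i 0 = γ.getD i 0 := by
  simp [List.getD_eq_getElem?_getD, List.getElem?_set_ne h.symm]

theorem lt_length_of_getD_pos {γ : List ℕ} {p : ℕ} (h : 0 < γ.getD p 0) : p < γ.length := by
  by_contra hp
  rw [List.getD_eq_default _ _ (not_lt.1 hp)] at h
  exact lt_irrefl _ h

theorem getD_mem {γ : List ℕ} {p : ℕ} (h : p < γ.length) : γ.getD p 0 ∈ γ := by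
  rw [List.getD_eq_getElem _ _ h]
  exact List.getElem_mem h

theorem growPart_eq_some {c : ℕ} {γ β : List ℕ} :
    growPart c γ = some β ↔ ∃ p < γ.length, γ.getD p 0 = c ∧ (∀ i < p, γ.getD i 0 ≠ c) ∧
      β = γ.set p (c + 1) := by
  induction γ generalizing β with
  | nil => simp [growPart]
  | cons b l ih =>
    rw [growPart]
    split_ifs with h
    · subst h
      constructor
      · intro h
        exact ⟨0, by simp, by simp, by simp, by simpa using h.symm⟩
      · rintro ⟨p, hp, h1, h2, rfl⟩
        rcases p with _ | p
        · simp
        · exact absurd (by simp) (h2 0 (by omega))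
    · rw [Option.map_eq_some_iff]
      constructor
      · rintro ⟨δ, hδ, rfl⟩
        obtain ⟨p, hp, h1, h2, rfl⟩ := ih.1 hδ
        refine ⟨p + 1, by simpa using hp, by simpa using h1, fun i hi => ?_, by simp⟩
        rcases i with _ | i
        · simpa using h
        · simpa using h2 i (by omega)
      · rintro ⟨p, hp, h1, h2, rfl⟩
        rcases p with _ | p
        · exact absurd (by simpa using h1) h
        · exact ⟨l.set p (c + 1), ih.2 ⟨p, by simpa using hp, by simpa using h1,
            fun i hi => by simpa using h2 (i + 1) (by omega), rfl⟩, by simp⟩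

theorem sum_set_succ (γ : List ℕ) {p : ℕ} (hp : p < γ.length) :
    (γ.set p (γ.getD p 0 + 1)).sum = γ.sum + 1 := by
  induction γ generalizing p with
  | nil => simp at hp
  | cons b l ih =>
    rcases p with _ | p
    · simp; omega
    · have := ih (p := p) (by simpa using hp)
      simp only [List.set_cons_succ, List.sum_cons, List.getD_cons_succ] at this ⊢
      omega

theorem sum_of_step {c : ℕ} {γ β : List ℕ} (h : step c γ = some β) : β.sum = γ.sum + 1 := by
  rcases c with _ | c
  · obtain rfl : 1 :: γ = β := by simpa [step] using h
    simp [add_comm]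
  · obtain ⟨p, hp, h1, -, rfl⟩ := growPart_eq_some.1 h
    rw [← h1, sum_set_succ γ hp]

theorem pos_of_step {c : ℕ} {γ β : List ℕ} (h : step c γ = some β) (hγ : ∀ b ∈ γ, 0 < b) :
    ∀ b ∈ β, 0 < b := by
  rcases c with _ | c
  · obtain rfl : 1 :: γ = β := by simpa [step] using h
    simpa using hγ
  · obtain ⟨p, hp, h1, -, rfl⟩ := growPart_eq_some.1 h
    intro b hb
    rcases List.mem_or_eq_of_mem_set hb with hb | rfl
    · exact hγ b hb
    · omega

theorem covers_of_step {c : ℕ} {γ β : List ℕ} (h : step c γ = some β) : Covers γ β := by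
  rcases c with _ | c
  · obtain rfl : 1 :: γ = β := by simpa [step] using h
    exact .cons γ
  · replace h : growPart (c + 1) γ = some β := h
    suffices ∃ l r, c + 1 ∉ l ∧ γ = l ++ (c + 1) :: r ∧ β = l ++ (c + 1 + 1) :: r by
      obtain ⟨l, r, h', rfl, rfl⟩ := this
      exact .incr l r _ h'
    induction γ generalizing β with
    | nil => simp [growPart] at h
    | cons b l ih =>
      rw [growPart] at h
      split_ifs at h with hb
      · exact ⟨[], l, by simp, by simp [hb], by simpa using h.symm⟩
      · obtain ⟨δ, hδ, rfl⟩ := Option.map_eq_some_iff.1 h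
        obtain ⟨l', r, h1, rfl, rfl⟩ := ih hδ
        exact ⟨b :: l', r, by simp [h1, Ne.symm hb], by simp, by simp⟩

theorem growPart_comm {a b : ℕ} (hab : a + 2 ≤ b) (γ : List ℕ) :
    (growPart b γ).bind (growPart a) = (growPart a γ).bind (growPart b) := by
  induction γ with
  | nil => simp [growPart]
  | cons d l ih =>
    have hmap : ∀ e, d ≠ e → ∀ o : Option (List ℕ),
        (o.map (List.cons d)).bind (growPart e) = (o.bind (growPart e)).map (List.cons d) := by
      intro e he o
      cases o <;> simp [growPart, he]
    by_cases ha : d = a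
    · subst ha
      have h1 : d ≠ b := by omega
      have h2 : d + 1 ≠ b := by omega
      simp only [growPart, if_neg h1, if_true, Option.bind_some, if_neg h2]
      cases growPart b l <;> simp [growPart]
    · by_cases hb : d = b
      · subst hb
        have h1 : d + 1 ≠ a := by omega
        simp only [growPart, if_neg ha, if_true, Option.bind_some, if_neg h1]
        cases growPart a l <;> simp [growPart]
      · simp only [growPart, if_neg ha, if_neg hb, hmap a ha, hmap b hb, ih]

theorem step_comm {a b : ℕ} (hab : a + 2 ≤ b) (γ : List ℕ) :
    (step b γ).bind (step a) = (step a γ).bind (step b) := by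
  obtain ⟨b, rfl⟩ : ∃ b', b = b' + 1 := ⟨b - 1, by omega⟩
  rcases a with _ | a
  · have : 1 ≠ b + 1 := by omega
    simp only [step, Option.bind_some, growPart, if_neg this]
    cases growPart (b + 1) γ <;> simp [step]
  · exact growPart_comm hab γ

/-- The free vector space on reverse composition diagrams. -/
abbrev DiagramSpace : Type := List ℕ →₀ ℚ

/-- The basis vector of an optional diagram; `none` stands for `0`. -/
noncomputable def optVec : Option (List ℕ) → DiagramSpace
  | none => 0
  | some β => Finsupp.single β 1

/-- The operator adding a box in column `c`. -/
noncomputable def stepOp (c : ℕ) : Module.End ℚ DiagramSpace :=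
  Finsupp.linearCombination ℚ fun γ => optVec (step c γ)

theorem stepOp_single (c : ℕ) (γ : List ℕ) : stepOp c (Finsupp.single γ 1) = optVec (step c γ) := by
  simp [stepOp]

theorem stepOp_optVec (c : ℕ) (o : Option (List ℕ)) :
    stepOp c (optVec o) = optVec (o.bind (step c)) := by
  cases o
  · simp [optVec]
  · simp [optVec, stepOp]

theorem commute_stepOp {a b : ℕ} (hab : a + 2 ≤ b) : Commute (stepOp a) (stepOp b) := by
  refine Finsupp.lhom_ext' fun γ => LinearMap.ext_ring ?_
  change stepOp a (stepOp b (Finsupp.single γ 1)) = stepOp b (stepOp a (Finsupp.single γ 1))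
  rw [stepOp_single, stepOp_single, stepOp_optVec, stepOp_optVec, step_comm hab]

/-- The operators adding a box in one of the first `N` columns, as a sequence of letters. -/
noncomputable def boxOp (N c : ℕ) : Module.End ℚ DiagramSpace := if c < N then stepOp c else 0

theorem boxOp_eq_zero {N : ℕ} (c : ℕ) (h : N ≤ c) : boxOp N c = 0 := by
  simp [boxOp, not_lt.2 h]

theorem commute_boxOp (N : ℕ) (a b : ℕ) (hab : a + 2 ≤ b) : Commute (boxOp N a) (boxOp N b) := by
  rw [boxOp, boxOp]
  split_ifs
  · exact commute_stepOp hab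
  all_goals simp

/-- The diagram built by adding boxes in the columns listed in a word, the last letter first. -/
def run : List ℕ → Option (List ℕ)
  | [] => some []
  | c :: w => (run w).bind (step c)

theorem prod_boxOp_apply {N : ℕ} {w : List ℕ} (hw : ∀ c ∈ w, c < N) :
    (w.map (boxOp N)).prod (Finsupp.single [] 1) = optVec (run w) := by
  induction w with
  | nil => simp [run, optVec]
  | cons c w ih =>
    have hc : c < N := hw c (by simp)
    rw [List.map_cons, List.prod_cons, Module.End.mul_apply, ih fun d hd => hw d (by simp [hd]),
      boxOp, if_pos hc, stepOp_optVec, run]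

theorem sum_and_pos_of_run {w α : List ℕ} (h : run w = some α) :
    α.sum = w.length ∧ ∀ b ∈ α, 0 < b := by
  induction w generalizing α with
  | nil =>
    obtain rfl : [] = α := by simpa [run] using h
    simp
  | cons c w ih =>
    obtain ⟨γ, hγ, h⟩ := Option.bind_eq_some_iff.1 h
    obtain ⟨h1, h2⟩ := ih hγ
    exact ⟨by rw [sum_of_step h, h1, List.length_cons], pos_of_step h h2⟩

/-! ### Standard tableaux as words -/

/-- `τ` is a semistandard tableau of shape `α` in which each of `1, …, n` occupies exactly one
box. -/
structure IsStd (α : List ℕ) (n : ℕ) (τ : ℕ → ℕ → ℕ) : Prop where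
  ssrct : IsSSRCT α τ
  standard : ∀ v, 1 ≤ v → v ≤ n → ∃! c : ℕ × ℕ, IsBox α c.1 c.2 ∧ τ c.1 c.2 = v

/-- The letter `w_v` is the column of the entry `v + 1` of `τ`. -/
def IsColumnWord (α : List ℕ) (w : List ℕ) (τ : ℕ → ℕ → ℕ) : Prop :=
  ∀ v < w.length, ∃ i, IsBox α i (w.getD v 0) ∧ τ i (w.getD v 0) = v + 1

theorem IsStd.eq_of_eq {α : List ℕ} {n : ℕ} {τ : ℕ → ℕ → ℕ} (h : IsStd α n τ) {v : ℕ} (h1 : 1 ≤ v)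
    (hn : v ≤ n) {i j i' j' : ℕ} (hb : IsBox α i j) (hv : τ i j = v) (hb' : IsBox α i' j')
    (hv' : τ i' j' = v) : i = i' ∧ j = j' := by
  have := (h.standard v h1 hn).unique (y₁ := (i, j)) (y₂ := (i', j')) ⟨hb, hv⟩ ⟨hb', hv'⟩
  simpa using this

/-- Enlarge the shape of a tableau from `γ` to `α`, raising all entries and filling the new boxes
with `1`. -/
def growTab (γ α : List ℕ) (τ : ℕ → ℕ → ℕ) (i j : ℕ) : ℕ :=
  if j < γ.getD i 0 then τ i j + 1 else if j < α.getD i 0 then 1 else 0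

/-- A new entry `1` can be put at the end of the topmost row of length `c`, all other entries being
raised by one. For `c = 0` this row has to be at the very top, as the first column increases. -/
theorem IsStd.addBox {γ : List ℕ} {n : ℕ} {τ : ℕ → ℕ → ℕ} (h : IsStd γ n τ) {p c : ℕ}
    (hp : p < γ.length) (hc : γ.getD p 0 = c) (hlt : ∀ i < p, γ.getD i 0 ≠ c)
    (h0 : c = 0 → p = 0) : IsStd (γ.set p (c + 1)) (n + 1) (growTab γ (γ.set p (c + 1)) τ) := by
  have hgp : (γ.set p (c + 1)).getD p 0 = c + 1 := getD_set_self γ hp _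
  have hgn : ∀ i, i ≠ p → (γ.set p (c + 1)).getD i 0 = γ.getD i 0 := fun i hi => getD_set_ne γ hi _
  have hle : ∀ i j, IsBox γ i j → IsBox (γ.set p (c + 1)) i j := by
    intro i j hb
    by_cases hi : i = p
    · subst hi; simp only [IsBox, hgp, hc] at hb ⊢; omega
    · simpa only [IsBox, hgn i hi] using hb
  have hbox : ∀ i j, IsBox (γ.set p (c + 1)) i j → ¬ IsBox γ i j → i = p ∧ j = c := by
    intro i j hb hb'
    by_cases hi : i = p
    · subst hi; simp only [IsBox, hgp, hc] at hb hb'; omega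
    · exact absurd (by simpa only [IsBox, hgn i hi] using hb) hb'
  have hpc : IsBox (γ.set p (c + 1)) p c := by simp only [IsBox, hgp]; omega
  have hpc' : ¬ IsBox γ p c := by simp only [IsBox, hc]; omega
  set α := γ.set p (c + 1) with hα
  have hold : ∀ i j, IsBox γ i j → growTab γ α τ i j = τ i j + 1 := fun i j hb => if_pos hb
  have hnew : growTab γ α τ p c = 1 :=
    (if_neg hpc').trans (if_pos hpc)
  have hout : ∀ i j, ¬ IsBox α i j → growTab γ α τ i j = 0 :=
    fun i j hb => (if_neg (fun h' => hb (hle i j h'))).trans (if_neg hb)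
  refine ⟨⟨?_, hout, ?_, ?_, ?_⟩, ?_⟩
  · intro i j hb
    by_cases hb' : IsBox γ i j
    · rw [hold i j hb']; omega
    · obtain ⟨rfl, rfl⟩ := hbox i j hb hb'
      rw [hnew]; omega
  · intro i j hb
    by_cases hb' : IsBox γ i (j + 1)
    · rw [hold i _ hb', hold i j (by simp only [IsBox] at hb' ⊢; omega)]
      have := h.ssrct.row_weak i j hb'
      omega
    · obtain ⟨rfl, rfl⟩ := hbox i _ hb hb'
      rw [hnew, hold i j (by simp only [IsBox, hc]; omega)]
      omega
  · intro i j hij hi hj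
    by_cases hj' : IsBox γ j 0
    · rw [hold j 0 hj']
      by_cases hi' : IsBox γ i 0
      · rw [hold i 0 hi']
        have := h.ssrct.col_strict i j hij hi' hj'
        omega
      · obtain ⟨rfl, hc0⟩ := hbox i 0 hi hi'
        have := h.ssrct.pos j 0 hj'
        rw [← hc0] at hnew
        rw [hnew]
        omega
    · obtain ⟨rfl, hc0⟩ := hbox j 0 hj hj'
      have := h0 hc0.symm
      omega
  · intro i j k hij hj hle'
    by_cases hj' : IsBox γ j (k + 1)
    · rw [hold j _ hj'] at hle' ⊢
      have hpos := h.ssrct.pos j _ hj'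
      by_cases hik : IsBox γ i k
      · rw [hold i k hik] at hle'
        obtain ⟨h1, h2⟩ := h.ssrct.triple i j k hij hj' (by omega)
        exact ⟨hle _ _ h1, by rw [hold i _ h1]; omega⟩
      · by_cases hik' : IsBox α i k
        · obtain ⟨rfl, rfl⟩ := hbox i k hik' hik
          rw [hnew] at hle'
          omega
        · rw [hout i k hik'] at hle'
          omega
    · obtain ⟨rfl, hk⟩ := hbox j _ hj hj'
      rw [← hk] at hnew
      have hik : IsBox α i k := by
        by_contra hb
        rw [hout i k hb, hnew] at hle'
        omega
      have hi1 : IsBox γ i (k + 1) := by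
        have h1 := hlt i hij
        simp only [IsBox, hgn i hij.ne] at hik ⊢
        omega
      have := h.ssrct.pos i _ hi1
      exact ⟨hle _ _ hi1, by rw [hold i _ hi1, hnew]; omega⟩
  · intro v h1 hn
    rcases h1.lt_or_eq with h1 | rfl
    · obtain ⟨⟨i, j⟩, ⟨hb, hv⟩, huniq⟩ := h.standard (v - 1) (by omega) (by omega)
      simp only at hb hv
      refine ⟨(i, j), ⟨hle i j hb, ?_⟩, ?_⟩
      · simp only
        rw [hold i j hb]; omega
      · rintro ⟨i', j'⟩ ⟨hb', hv'⟩
        simp only at hb' hv'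
        by_cases hb2 : IsBox γ i' j'
        · rw [hold i' j' hb2] at hv'
          exact huniq (i', j') ⟨hb2, by simp only; omega⟩
        · obtain ⟨rfl, rfl⟩ := hbox i' j' hb' hb2
          rw [hnew] at hv'
          omega
    · refine ⟨(p, c), ⟨hpc, hnew⟩, ?_⟩
      rintro ⟨i', j'⟩ ⟨hb', hv'⟩
      simp only at hb' hv'
      by_cases hb2 : IsBox γ i' j'
      · rw [hold i' j' hb2] at hv'
        have := h.ssrct.pos i' j' hb2
        omega
      · obtain ⟨rfl, rfl⟩ := hbox i' j' hb' hb2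
        rfl

/-- The entry `1` of a standard tableau can be removed, along a cover of the reverse composition
poset. -/
theorem IsStd.removeBox {α : List ℕ} {n : ℕ} {τ : ℕ → ℕ → ℕ} (h : IsStd α (n + 1) τ)
    (hα : ∀ b ∈ α, 0 < b) : ∃ p c, p < α.length ∧ α.getD p 0 = c + 1 ∧ τ p c = 1 ∧
      (∀ i < p, α.getD i 0 ≠ c) ∧ (c = 0 → p = 0) ∧
      IsStd (α.set p c) n (fun i j => τ i j - 1) ∧
      τ = growTab (α.set p c) α (fun i j => τ i j - 1) := by
  obtain ⟨⟨p, c⟩, ⟨hb, hv⟩, -⟩ := h.standard 1 le_rfl (by omega)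
  simp only at hb hv
  have hone : ∀ i j, IsBox α i j → τ i j = 1 → i = p ∧ j = c := fun i j hb' hv' =>
    h.eq_of_eq le_rfl (by omega) hb' hv' hb hv
  have hp : p < α.length := lt_length_of_getD_pos (by simp only [IsBox] at hb; omega)
  have hc : α.getD p 0 = c + 1 := by
    by_contra hne
    have hb' : IsBox α p (c + 1) := by simp only [IsBox] at hb ⊢; omega
    have h1 := h.ssrct.row_weak p c hb'
    have h2 := h.ssrct.pos _ _ hb'
    have := (hone p (c + 1) hb' (by omega)).2
    omega
  have hc0 : c = 0 → p = 0 := by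
    rintro rfl
    by_contra hp0
    have hb0 : IsBox α 0 0 := hα _ (getD_mem (by omega))
    have h1 := h.ssrct.col_strict 0 p (by omega) hb0 hb
    have h2 := h.ssrct.pos _ _ hb0
    omega
  have hlt : ∀ i < p, α.getD i 0 ≠ c := by
    intro i hi hic
    rcases c with _ | c
    · have := hc0 rfl
      omega
    · have hb' : IsBox α i c := by simp only [IsBox]; omega
      have h2 := h.ssrct.pos _ _ hb'
      have := (h.ssrct.triple i p c hi hb (by omega)).1
      simp only [IsBox] at this
      omega
  have hgp : (α.set p c).getD p 0 = c := getD_set_self α hp _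
  have hgn : ∀ i, i ≠ p → (α.set p c).getD i 0 = α.getD i 0 := fun i hi => getD_set_ne α hi _
  have hbox : ∀ i j, IsBox (α.set p c) i j ↔ IsBox α i j ∧ τ i j ≠ 1 := by
    intro i j
    by_cases hi : i = p
    · subst hi
      simp only [IsBox, hgp]
      constructor
      · intro hj
        refine ⟨by omega, fun h1 => ?_⟩
        have := (hone i j (by simp only [IsBox]; omega) h1).2
        omega
      · rintro ⟨h1, h2⟩
        have : j ≠ c := by rintro rfl; exact h2 hv
        omega
    · simp only [IsBox, hgn i hi]
      refine ⟨fun hj => ⟨hj, fun h1 => hi (hone i j hj h1).1⟩, fun hj => hj.1⟩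
  have h2 : ∀ i j, IsBox (α.set p c) i j → 2 ≤ τ i j := by
    intro i j hb'
    rw [hbox] at hb'
    have := h.ssrct.pos i j hb'.1
    omega
  refine ⟨p, c, hp, hc, hv, hlt, hc0, ⟨⟨?_, ?_, ?_, ?_, ?_⟩, ?_⟩, ?_⟩
  · intro i j hb'
    have := h2 i j hb'
    omega
  · intro i j hb'
    rw [hbox] at hb'
    by_cases hb2 : IsBox α i j
    · have : τ i j = 1 := by by_contra h3; exact hb' ⟨hb2, h3⟩
      omega
    · rw [h.ssrct.zero i j hb2]
  · intro i j hb'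
    have := h.ssrct.row_weak i j ((hbox _ _).1 hb').1
    omega
  · intro i j hij hi hj
    have := h.ssrct.col_strict i j hij ((hbox _ _).1 hi).1 ((hbox _ _).1 hj).1
    have := h2 _ _ hi
    have := h2 _ _ hj
    omega
  · intro i j k hij hj hle
    have h3 := h2 _ _ hj
    obtain ⟨h4, h5⟩ := h.ssrct.triple i j k hij ((hbox _ _).1 hj).1 (by omega)
    exact ⟨(hbox _ _).2 ⟨h4, by omega⟩, by omega⟩
  · intro v hv1 hvn
    obtain ⟨⟨i, j⟩, ⟨hb', hv'⟩, huniq⟩ := h.standard (v + 1) (by omega) (by omega)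
    simp only at hb' hv'
    refine ⟨(i, j), ⟨(hbox i j).2 ⟨hb', by omega⟩, ?_⟩, ?_⟩
    · simp only
      omega
    rintro ⟨i', j'⟩ ⟨hb2, hv2⟩
    have h3 := h2 _ _ hb2
    simp only at hv2 h3
    exact huniq (i', j') ⟨((hbox _ _).1 hb2).1, by simp only; omega⟩
  · funext i j
    simp only [growTab]
    split_ifs with h3 h4
    · have := h2 i j h3
      omega
    · by_contra h5
      exact h3 ((hbox i j).2 ⟨h4, h5⟩)
    · exact h.ssrct.zero i j h4

/-- An empty top row can be removed from the diagram. -/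
theorem isStd_zero_cons {γ : List ℕ} {n : ℕ} {τ : ℕ → ℕ → ℕ} (h0 : ∀ j, τ 0 j = 0) :
    IsStd (0 :: γ) n τ ↔ IsStd γ n (fun i j => τ (i + 1) j) := by
  have hb : ∀ i j, IsBox (0 :: γ) (i + 1) j ↔ IsBox γ i j := fun i j => by simp [IsBox]
  have hb0 : ∀ j, ¬ IsBox (0 :: γ) 0 j := fun j => by simp [IsBox]
  constructor
  · intro h
    refine ⟨⟨fun i j hij => h.ssrct.pos _ _ ((hb i j).2 hij),
      fun i j hij => h.ssrct.zero _ _ (fun h' => hij ((hb i j).1 h')),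
      fun i j hij => h.ssrct.row_weak _ _ ((hb i _).2 hij),
      fun i j hij hi hj => h.ssrct.col_strict _ _ (by omega) ((hb i _).2 hi) ((hb j _).2 hj),
      fun i j k hij hj hle => ?_⟩, fun v h1 hn => ?_⟩
    · have := h.ssrct.triple (i + 1) (j + 1) k (by omega) ((hb _ _).2 hj) hle
      exact ⟨(hb _ _).1 this.1, this.2⟩
    · obtain ⟨⟨i, j⟩, ⟨hij, hv⟩, huniq⟩ := h.standard v h1 hn
      rcases i with _ | i
      · exact absurd hij (hb0 j)
      · refine ⟨(i, j), ⟨(hb _ _).1 hij, hv⟩, ?_⟩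
        rintro ⟨i', j'⟩ ⟨hij', hv'⟩
        simpa using huniq (i' + 1, j') ⟨(hb _ _).2 hij', hv'⟩
  · intro h
    refine ⟨⟨?_, ?_, ?_, ?_, ?_⟩, ?_⟩
    · rintro (_ | i) j hij
      · exact absurd hij (hb0 j)
      · exact h.ssrct.pos _ _ ((hb i j).1 hij)
    · rintro (_ | i) j hij
      · exact h0 j
      · exact h.ssrct.zero i j (fun h' => hij ((hb i j).2 h'))
    · rintro (_ | i) j hij
      · exact absurd hij (hb0 _)
      · exact h.ssrct.row_weak i j ((hb _ _).1 hij)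
    · rintro (_ | i) (_ | j) hij hi hj
      · omega
      · exact absurd hi (hb0 _)
      · omega
      · exact h.ssrct.col_strict i j (by omega) ((hb _ _).1 hi) ((hb _ _).1 hj)
    · rintro (_ | i) (_ | j) k hij hj hle
      · omega
      · have := h.ssrct.pos j _ ((hb _ _).1 hj)
        rw [h0] at hle
        omega
      · omega
      · have := h.ssrct.triple i j k (by omega) ((hb _ _).1 hj) hle
        exact ⟨(hb _ _).2 this.1, this.2⟩
    · intro v h1 hn
      obtain ⟨⟨i, j⟩, ⟨hij, hv⟩, huniq⟩ := h.standard v h1 hn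
      refine ⟨(i + 1, j), ⟨(hb _ _).2 hij, hv⟩, ?_⟩
      rintro ⟨_ | i', j'⟩ ⟨hij', hv'⟩
      · exact absurd hij' (hb0 _)
      · simpa using huniq (i', j') ⟨(hb _ _).1 hij', hv'⟩

theorem IsStd.exists_columnWord {α : List ℕ} {n : ℕ} {τ : ℕ → ℕ → ℕ} (h : IsStd α n τ) :
    ∃ w : List ℕ, w.length = n ∧ IsColumnWord α w τ := by
  have h1 : ∀ v : Fin n, ∃ c : ℕ × ℕ, IsBox α c.1 c.2 ∧ τ c.1 c.2 = v + 1 := fun v =>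
    (h.standard (v + 1) (by omega) (by omega)).exists
  choose f hf using h1
  refine ⟨List.ofFn fun v => (f v).2, by simp, fun v hv => ⟨(f ⟨v, by simpa using hv⟩).1, ?_⟩⟩
  have : (List.ofFn fun v => (f v).2).getD v 0 = (f ⟨v, by simpa using hv⟩).2 := by
    rw [List.getD_eq_getElem _ _ hv, List.getElem_ofFn]
  rw [this]
  exact hf ⟨v, by simpa using hv⟩

theorem IsStd.columnWord_unique {α : List ℕ} {n : ℕ} {τ : ℕ → ℕ → ℕ} (h : IsStd α n τ)
    {w w' : List ℕ} (hw : w.length = n) (hw' : w'.length = n) (h1 : IsColumnWord α w τ)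
    (h2 : IsColumnWord α w' τ) : w = w' := by
  refine List.ext_getElem (by omega) fun v hv hv' => ?_
  obtain ⟨i, hb, hi⟩ := h1 v hv
  obtain ⟨i', hb', hi'⟩ := h2 v hv'
  have := (h.eq_of_eq (by omega) (by omega) hb hi hb' hi').2
  rwa [List.getD_eq_getElem _ _ hv, List.getD_eq_getElem _ _ hv'] at this

/-- Removing the entry `1` of a standard tableau removes the first letter of its column word. -/
theorem IsStd.exists_step {α : List ℕ} {c : ℕ} {w : List ℕ} {τ : ℕ → ℕ → ℕ}
    (h : IsStd α (w.length + 1) τ) (hα : ∀ b ∈ α, 0 < b) (hw : IsColumnWord α (c :: w) τ) :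
    ∃ γ τ', step c γ = some α ∧ (∀ b ∈ γ, 0 < b) ∧ IsStd γ w.length τ' ∧ IsColumnWord γ w τ' ∧
      τ = if c = 0 then growTab (0 :: γ) α (fun i j => if i = 0 then 0 else τ' (i - 1) j)
        else growTab γ α τ' := by
  obtain ⟨p, c', hp, hc, hv, hlt, hc0, hstd, heq⟩ := h.removeBox hα
  obtain rfl : c = c' := by
    obtain ⟨i, hb, hi⟩ := hw 0 (by simp)
    exact (h.eq_of_eq le_rfl (by omega) hb hi (by simp only [IsBox]; omega) hv).2
  have hw' : IsColumnWord (α.set p c) w fun i j => τ i j - 1 := by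
    intro v hvw
    obtain ⟨i, hb, hi⟩ := hw (v + 1) (by simpa using hvw)
    rw [List.getD_cons_succ] at hb hi
    have hi' : τ i (w.getD v 0) - 1 = v + 1 := by omega
    refine ⟨i, ?_, hi'⟩
    by_contra hb'
    have h0 : τ i (w.getD v 0) - 1 = 0 := hstd.ssrct.zero _ _ hb'
    omega
  rcases Nat.eq_zero_or_pos c with rfl | hcpos
  · obtain rfl := hc0 rfl
    rcases α with _ | ⟨a, γ⟩
    · simp at hp
    obtain rfl : a = 1 := by simpa using hc
    rw [List.set_cons_zero] at hstd hw' heq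
    have h0 : ∀ j, τ 0 j - 1 = 0 := fun j => hstd.ssrct.zero 0 j (by simp [IsBox])
    refine ⟨γ, _, rfl, fun b hb => hα b (by simp [hb]), (isStd_zero_cons h0).1 hstd, ?_, ?_⟩
    · intro v hvw
      obtain ⟨i, hb, hi⟩ := hw' v hvw
      rcases i with _ | i
      · simp [IsBox] at hb
      · exact ⟨i, by simpa [IsBox] using hb, hi⟩
    · rw [if_pos rfl]
      refine heq.trans ?_
      congr 1
      funext i j
      rcases i with _ | i
      · simp [h0]
      · simp
  · refine ⟨α.set p c, _, ?_, ?_, hstd, hw', ?_⟩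
    · obtain ⟨d, rfl⟩ : ∃ d, c = d + 1 := ⟨c - 1, by omega⟩
      refine growPart_eq_some.2 ⟨p, by simpa using hp, getD_set_self α hp _, fun i hi => ?_, ?_⟩
      · rw [getD_set_ne α hi.ne]
        exact hlt i hi
      · rw [List.set_set, ← hc, List.getD_eq_getElem _ _ hp, List.set_getElem_self]
    · intro b hb
      rcases List.mem_or_eq_of_mem_set hb with hb | rfl
      · exact hα b hb
      · exact hcpos
    · rw [if_neg hcpos.ne']
      exact heq

theorem IsStd.run_eq {α : List ℕ} {w : List ℕ} {τ : ℕ → ℕ → ℕ} (h : IsStd α w.length τ)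
    (hα : ∀ b ∈ α, 0 < b) (hsum : α.sum = w.length) (hw : IsColumnWord α w τ) :
    run w = some α := by
  induction w generalizing α τ with
  | nil =>
    rcases α with _ | ⟨a, l⟩
    · rfl
    · have := hα a (by simp)
      simp at hsum
      omega
  | cons c w ih =>
    obtain ⟨γ, τ', hstep, hpos, hstd, hw', -⟩ := h.exists_step hα hw
    have := sum_of_step hstep
    rw [run, ih hstd hpos (by simp at hsum; omega) hw', Option.bind_some, hstep]

/-- A standard tableau is determined by its column word. -/
theorem IsStd.eq_of_columnWord {α : List ℕ} {w : List ℕ} {τ σ : ℕ → ℕ → ℕ}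
    (h : IsStd α w.length τ) (h' : IsStd α w.length σ) (hα : ∀ b ∈ α, 0 < b)
    (hsum : α.sum = w.length) (hw : IsColumnWord α w τ) (hw' : IsColumnWord α w σ) : τ = σ := by
  induction w generalizing α τ σ with
  | nil =>
    rcases α with _ | ⟨a, l⟩
    · funext i j
      rw [h.ssrct.zero i j (by simp [IsBox]), h'.ssrct.zero i j (by simp [IsBox])]
    · have := hα a (by simp)
      simp at hsum
      omega
  | cons c w ih =>
    obtain ⟨γ, τ', hs1, hpos1, hstd1, hw1, rfl⟩ := h.exists_step hα hw
    obtain ⟨δ, σ', hs2, hpos2, hstd2, hw2, rfl⟩ := h'.exists_step hα hw'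
    have e1 := sum_of_step hs1
    have e2 := sum_of_step hs2
    simp only [List.length_cons] at hsum
    have r1 := hstd1.run_eq hpos1 (by omega) hw1
    have r2 := hstd2.run_eq hpos2 (by omega) hw2
    obtain rfl : γ = δ := by simpa [r1] using r2
    rw [ih hstd1 hstd2 hpos1 (by omega) hw1 hw2]

/-- Every word that builds a diagram is the column word of a standard tableau. -/
theorem exists_isStd_of_run {w α : List ℕ} (h : run w = some α) :
    ∃ τ, IsStd α w.length τ ∧ IsColumnWord α w τ := by
  induction w generalizing α with
  | nil =>
    obtain rfl : [] = α := by simpa [run] using h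
    refine ⟨fun _ _ => 0, ⟨⟨?_, ?_, ?_, ?_, ?_⟩, ?_⟩, ?_⟩
    any_goals simp [IsBox]
    · intro v h1 h2
      omega
    · intro v hv
      simp at hv
  | cons c w ih =>
    obtain ⟨γ, hγ, hs⟩ := Option.bind_eq_some_iff.1 h
    obtain ⟨τ, hstd, hw⟩ := ih hγ
    -- a new row is the growth of an empty row on top
    obtain ⟨δ, σ, p, hp, hc, hlt, hc0, rfl, hstd', hw'⟩ : ∃ δ σ p, p < List.length δ ∧
        δ.getD p 0 = c ∧ (∀ i < p, δ.getD i 0 ≠ c) ∧ (c = 0 → p = 0) ∧ α = δ.set p (c + 1) ∧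
        IsStd δ w.length σ ∧ IsColumnWord δ w σ := by
      rcases c with _ | c
      · obtain rfl : 1 :: γ = α := by simpa [step] using hs
        refine ⟨0 :: γ, fun i j => if i = 0 then 0 else τ (i - 1) j, 0, by simp, by simp, by simp,
          by simp, by simp, (isStd_zero_cons (by simp)).2 (by simpa using hstd), fun v hv => ?_⟩
        obtain ⟨i, hb, hi⟩ := hw v hv
        exact ⟨i + 1, by simpa [IsBox] using hb, by simpa using hi⟩
      · obtain ⟨p, hp, h1, h2, h3⟩ := growPart_eq_some.1 hs
        exact ⟨γ, τ, p, hp, h1, h2, by simp, h3, hstd, hw⟩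
    refine ⟨_, hstd'.addBox hp hc hlt hc0, ?_⟩
    intro v hv
    rcases v with _ | v
    · refine ⟨p, ?_, ?_⟩
      · rw [List.getD_cons_zero, IsBox, getD_set_self δ hp]
        omega
      · rw [List.getD_cons_zero, growTab, if_neg (by omega), if_pos]
        rw [getD_set_self δ hp]
        omega
    · obtain ⟨i, hb, hi⟩ := hw' v (by simpa using hv)
      rw [List.getD_cons_succ]
      refine ⟨i, ?_, ?_⟩
      · rw [IsBox] at hb ⊢
        by_cases hip : i = p
        · subst hip
          rw [getD_set_self δ hp]
          omega
        · rwa [getD_set_ne δ hip]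
      · rw [IsBox] at hb
        rw [growTab, if_pos hb, hi]

/-- The positions `v ≥ 1` of a word at which the next letter is weakly larger. -/
def wordDescents (w : List ℕ) : Set ℕ :=
  {v | 1 ≤ v ∧ v < w.length ∧ w.getD (v - 1) 0 ≤ w.getD v 0}

/-- The proper partial sums of a list. -/
def properSums (l : List ℕ) : Set ℕ := {v | ∃ i, 0 < i ∧ i < l.length ∧ v = (l.take i).sum}

theorem properSums_cons_cons (a b : ℕ) (l : List ℕ) (v : ℕ) :
    v ∈ properSums (a :: b :: l) ↔ v = a ∨ ∃ u ∈ properSums (b :: l), v = a + u := by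
  constructor
  · rintro ⟨i, h0, hi, rfl⟩
    rcases i with _ | _ | i
    · omega
    · simp
    · exact Or.inr ⟨_, ⟨i + 1, by omega, by simpa using hi, rfl⟩, by simp⟩
  · rintro (rfl | ⟨_, ⟨i, h0, hi, rfl⟩, rfl⟩)
    · exact ⟨1, by simp⟩
    · exact ⟨i + 1, by omega, by simpa using hi, by simp⟩

theorem properSums_single (a : ℕ) : properSums [a] = ∅ := by
  ext v
  simp only [properSums, Set.mem_ofPred_eq, Set.mem_empty_iff_false, iff_false]
  rintro ⟨i, h0, hi, -⟩
  simp at hi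
  omega

theorem mem_properSums_bumpHead (b : ℕ) (l : List ℕ) (v : ℕ) :
    v ∈ properSums ((b + 1) :: l) ↔ ∃ u ∈ properSums (b :: l), v = u + 1 := by
  rcases l with _ | ⟨c, l⟩
  · simp [properSums_single]
  · simp only [properSums_cons_cons]
    constructor
    · rintro (rfl | ⟨u, hu, rfl⟩)
      · exact ⟨b, Or.inl rfl, rfl⟩
      · exact ⟨b + u, Or.inr ⟨u, hu, rfl⟩, by omega⟩
    · rintro ⟨_, rfl | ⟨u, hu, rfl⟩, rfl⟩
      · exact Or.inl rfl
      · exact Or.inr ⟨u, hu, by omega⟩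

theorem mem_wordDescents_cons_cons (c d : ℕ) (w : List ℕ) (v : ℕ) :
    v ∈ wordDescents (c :: d :: w) ↔ (v = 1 ∧ c ≤ d) ∨ ∃ u ∈ wordDescents (d :: w), v = u + 1 := by
  rcases v with _ | _ | v
  · simp [wordDescents]
  · simp [wordDescents]
  · simp [wordDescents]

theorem wordDescents_eq_properSums (c : ℕ) (w : List ℕ) :
    wordDescents (c :: w) = properSums (descComp c w) := by
  induction w generalizing c with
  | nil =>
    ext v
    simp only [descComp, properSums_single, Set.mem_empty_iff_false, iff_false]
    rintro ⟨h1, h2, -⟩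
    simp at h2
    omega
  | cons d w ih =>
    ext v
    rw [mem_wordDescents_cons_cons, ih, descComp]
    obtain ⟨b, l, h⟩ := descComp_eq_cons d w
    rw [h]
    split_ifs with hcd
    · rw [properSums_cons_cons]
      simp [hcd, add_comm]
    · rw [bumpHead, mem_properSums_bumpHead]
      simp [hcd]

theorem properSums_injective {l l' : List ℕ} (hl : ∀ b ∈ l, 0 < b) (hl' : ∀ b ∈ l', 0 < b)
    (hsum : l.sum = l'.sum) (h : properSums l = properSums l') : l = l' := by
  obtain ⟨n, hn⟩ : ∃ n, l'.sum = n := ⟨_, rfl⟩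
  obtain ⟨α, rfl⟩ := exists_blocks_eq hl (hsum.trans hn)
  obtain ⟨β, rfl⟩ := exists_blocks_eq hl' hn
  have key : ∀ (n : ℕ) (γ : Composition n) (v : ℕ), (∃ i : Fin (γ.length + 1), γ.sizeUpTo i = v) ↔
      v = 0 ∨ v = n ∨ v ∈ properSums γ.blocks := by
    intro n γ v
    constructor
    · rintro ⟨i, rfl⟩
      rcases Nat.eq_zero_or_pos (i : ℕ) with h0 | h0
      · simp [h0]
      · rcases (Nat.lt_succ_iff.1 i.2).lt_or_eq with h1 | h1
        · exact Or.inr (Or.inr ⟨i, h0, h1, rfl⟩)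
        · simp [h1]
    · rintro (rfl | rfl | ⟨i, h0, h1, rfl⟩)
      · exact ⟨0, by simp⟩
      · exact ⟨Fin.last _, by simp⟩
      · exact ⟨⟨i, h1.trans (Nat.lt_succ_self _)⟩, rfl⟩
  have hb : α.boundaries = β.boundaries := by
    ext x
    have h1 := key _ α x
    have h2 := key _ β x
    rw [h] at h1
    rw [← h2] at h1
    simpa [Composition.boundaries, Composition.boundary, Fin.ext_iff] using h1
  have : α.toCompositionAsSet = β.toCompositionAsSet := CompositionAsSet.ext hb
  rw [(compositionEquiv _).injective this]

/-- The descent composition of a word. -/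
def wordComp : List ℕ → List ℕ
  | [] => []
  | c :: w => descComp c w

theorem wordComp_pos (w : List ℕ) : ∀ b ∈ wordComp w, 0 < b := by
  cases w with
  | nil => simp [wordComp]
  | cons c w => exact descComp_pos c w

theorem wordComp_sum (w : List ℕ) : (wordComp w).sum = w.length := by
  cases w with
  | nil => simp [wordComp]
  | cons c w => exact descComp_sum c w

theorem wordDescents_eq (w : List ℕ) : wordDescents w = properSums (wordComp w) := by
  cases w with
  | nil => ext v; simp [wordDescents, properSums, wordComp]
  | cons c w => exact wordDescents_eq_properSums c w

theorem isSRCT_iff {n : ℕ} (α : Composition n) (τ : ℕ → ℕ → ℕ) :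
    IsSRCT α τ ↔ IsStd α.blocks n τ :=
  ⟨fun h => ⟨h.ssrct, h.standard⟩, fun h => ⟨h.ssrct, h.standard⟩⟩

theorem descentSet_eq {n : ℕ} {α : Composition n} {τ : ℕ → ℕ → ℕ} (h : IsStd α.blocks n τ)
    {w : List ℕ} (hn : w.length = n) (hw : IsColumnWord α.blocks w τ) :
    descentSet α τ = wordDescents w := by
  ext v
  constructor
  · rintro ⟨h1, hv, i, j, i', j', hb, hi, hb', hi', hj⟩
    refine ⟨h1, by omega, ?_⟩
    obtain ⟨p, hp, hp'⟩ := hw (v - 1) (by omega)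
    obtain ⟨q, hq, hq'⟩ := hw v (by omega)
    rw [← (h.eq_of_eq h1 hv.le hb hi hp (by omega)).2,
      ← (h.eq_of_eq (by omega) (by omega) hb' hi' hq hq').2]
    exact hj
  · rintro ⟨h1, hv, hle⟩
    obtain ⟨p, hp, hp'⟩ := hw (v - 1) (by omega)
    obtain ⟨q, hq, hq'⟩ := hw v (by omega)
    exact ⟨h1, by omega, p, _, q, _, hp, by omega, hq, hq', hle⟩

/-- The number `d_{α,β}` counts the words that build `α` and have descent composition `β`. -/
theorem numSRCT_eq {n : ℕ} (α β : Composition n) {N : ℕ} (hN : n ≤ N) :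
    numSRCT α β = ((words N n).filter fun w =>
      run w = some α.blocks ∧ wordComp w = β.blocks).card := by
  have hαpos : ∀ b ∈ α.blocks, 0 < b := fun b hb => α.blocks_pos hb
  rw [numSRCT, ← Set.ncard_coe_finset]
  have hdesc : ∀ {τ : ℕ → ℕ → ℕ} {w : List ℕ}, IsStd α.blocks n τ → w.length = n →
      IsColumnWord α.blocks w τ → (descentSet α τ = partialSums β ↔ wordComp w = β.blocks) := by
    intro τ w h hn hw
    rw [descentSet_eq h hn hw, wordDescents_eq]
    change _ = properSums β.blocks ↔ _
    refine ⟨fun h' => ?_, fun h' => by rw [h']⟩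
    exact properSums_injective (wordComp_pos w) (fun b hb => β.blocks_pos hb)
      (by rw [wordComp_sum, hn, β.blocks_sum]) h'
  refine Set.ncard_congr (fun τ hτ => ((isSRCT_iff α τ).1 hτ.1).exists_columnWord.choose) ?_ ?_ ?_
  · intro τ hτ
    have hstd := (isSRCT_iff α τ).1 hτ.1
    obtain ⟨hn, hw⟩ := hstd.exists_columnWord.choose_spec
    set w := hstd.exists_columnWord.choose
    have hrun : run w = some α.blocks :=
      IsStd.run_eq (by rwa [hn]) hαpos (by rw [hn, α.blocks_sum]) hw
    simp only [coe_filter, Set.mem_ofPred_eq, mem_words]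
    refine ⟨⟨hn, fun c hc => ?_⟩, hrun, (hdesc hstd hn hw).1 hτ.2⟩
    obtain ⟨v, hv, rfl⟩ := List.getElem_of_mem hc
    obtain ⟨i, hb, -⟩ := hw v hv
    rw [List.getD_eq_getElem _ _ hv, IsBox] at hb
    have h1 := List.le_sum_of_mem
      (getD_mem (lt_length_of_getD_pos (by omega : 0 < α.blocks.getD i 0)))
    rw [α.blocks_sum] at h1
    change w[v] < N
    omega
  · intro τ σ hτ hσ heq
    have h1 := (isSRCT_iff α τ).1 hτ.1
    have h2 := (isSRCT_iff α σ).1 hσ.1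
    obtain ⟨hn, hw⟩ := h1.exists_columnWord.choose_spec
    obtain ⟨-, hw'⟩ := h2.exists_columnWord.choose_spec
    rw [← heq] at hw'
    set w := h1.exists_columnWord.choose
    exact IsStd.eq_of_columnWord (w := w) (by rwa [hn]) (by rwa [hn]) hαpos
      (by rw [hn, α.blocks_sum]) hw hw'
  · intro w hw
    simp only [coe_filter, Set.mem_ofPred_eq, mem_words] at hw
    obtain ⟨⟨hn, -⟩, hrun, hcomp⟩ := hw
    obtain ⟨τ, hstd, hcw⟩ := exists_isStd_of_run hrun
    rw [hn] at hstd
    refine ⟨τ, ⟨(isSRCT_iff α τ).2 hstd, (hdesc hstd hn hcw).2 hcomp⟩, ?_⟩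
    obtain ⟨hn', hw'⟩ := hstd.exists_columnWord.choose_spec
    exact hstd.columnWord_unique hn' hn hw' hcw

/-! ### The action of `NSym` on diagrams -/

/-- The generating function of the complete functions in the box-adding operators of the first `N`
columns. -/
noncomputable abbrev boxSeries (N : ℕ) : PowerSeries (Module.End ℚ DiagramSpace) :=
  decreasingSeries (boxOp N) N 0

/-- The action of `NSym` on diagrams: `h_k` adds `k` boxes in distinct columns among the first `N`,
from left to right. -/
noncomputable def boxRep (N : ℕ) : NSym →ₐ[ℚ] Module.End ℚ DiagramSpace :=
  FreeAlgebra.lift ℚ fun k : ℕ+ => PowerSeries.coeff (k : ℕ) (boxSeries N)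

theorem boxRep_completeH (N k : ℕ) :
    boxRep N (completeH k) = PowerSeries.coeff k (boxSeries N) := by
  rw [completeH]
  split_ifs with hk
  · exact FreeAlgebra.lift_ι_apply _ _
  · obtain rfl : k = 0 := by omega
    rw [map_one, coeff_zero_decreasingSeries]

theorem boxRep_ribbonOf (N a : ℕ) (l : List ℕ) : boxRep N (ribbonOf completeH a l) =
    ribbonOf (fun k => PowerSeries.coeff k (boxSeries N)) a l := by
  have := map_ribbonOf (boxRep N : NSym →+* Module.End ℚ DiagramSpace) completeH a l
  simpa [boxRep_completeH] using this

theorem hookSum_map {R S : Type*} [Ring R] [Ring S] (f : R →+* S) (h : ℕ → R) (n : ℕ) :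
    f (hookSum h n) = hookSum (fun k => f (h k)) n := by
  cases n with
  | zero => simp [hookSum]
  | succ n => simp [hookSum, nearHookSum, map_ribbonOf]

/-- The action of the power sums. -/
theorem boxRep_powerSum (N n : ℕ) :
    boxRep N (powerSum n) = ∑ a ∈ range N, leastLetterSum (boxOp N) n a := by
  have := hookSum_map (boxRep N : NSym →+* Module.End ℚ DiagramSpace) completeH n
  rw [powerSum_eq, ← hookSum_coeff_decreasingSeries (commute_boxOp N) boxOp_eq_zero]
  simpa [boxRep_completeH] using this

/-- The diagrams obtained from the empty one by the action of `NSym`. -/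
noncomputable def onEmpty (N : ℕ) : NSym →ₗ[ℚ] DiagramSpace :=
  (LinearMap.applyₗ (Finsupp.single [] 1 : DiagramSpace)).comp (boxRep N).toLinearMap

theorem onEmpty_apply (N : ℕ) (x : NSym) : onEmpty N x = boxRep N x (Finsupp.single [] 1) := rfl

theorem onEmpty_mul (N : ℕ) (x y : NSym) : onEmpty N (x * y) = boxRep N x (onEmpty N y) := by
  simp [onEmpty_apply]

theorem onEmpty_ribbon_eq_sum_words {N n : ℕ} (β : Composition n) : onEmpty N (ribbon β) =
    ∑ w ∈ words N n, if wordComp w = β.blocks then optVec (run w) else 0 := by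
  rw [ribbon_eq, onEmpty_apply]
  have hsum := β.blocks_sum
  have hpos : ∀ b ∈ β.blocks, 0 < b := fun b hb => β.blocks_pos hb
  generalize β.blocks = B at hsum hpos
  rcases B with _ | ⟨a, l⟩
  · obtain rfl : n = 0 := by simpa using hsum.symm
    simp [ribbonList, words, wordComp, run, optVec]
  · obtain ⟨k, rfl⟩ : ∃ k, n = k + 1 := ⟨n - 1, by have := hpos a (by simp); simp at hsum; omega⟩
    rw [ribbonList, boxRep_ribbonOf, ribbonOf_eq_wordSum _ _ _ _ hpos, sum_words_succ,
      LinearMap.sum_apply]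
    refine sum_congr rfl fun c hc => ?_
    rw [wordSum, hsum, Nat.add_sub_cancel, LinearMap.sum_apply]
    refine sum_congr rfl fun w hw => ?_
    rw [wordComp]
    split_ifs
    · rw [← prod_boxOp_apply (N := N), List.map_cons, List.prod_cons]
      simpa using ⟨by simpa using hc, (mem_words.1 hw).2⟩
    · rfl

theorem onEmpty_ribbon {N n : ℕ} (hN : n ≤ N) (β : Composition n) : onEmpty N (ribbon β) =
    ∑ α : Composition n, (numSRCT α β : ℚ) • Finsupp.single α.blocks (1 : ℚ) := by
  have hvec : ∀ w ∈ words N n, optVec (run w) =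
      ∑ α : Composition n, if run w = some α.blocks then Finsupp.single α.blocks (1 : ℚ) else 0 := by
    intro w hw
    rcases hr : run w with _ | δ
    · simp [optVec]
    · obtain ⟨h1, h2⟩ := sum_and_pos_of_run hr
      obtain ⟨α, rfl⟩ := exists_blocks_eq h2 (h1.trans (mem_words.1 hw).1)
      rw [sum_eq_single α]
      · simp [optVec]
      · intro γ _ hγ
        rw [if_neg]
        intro h
        exact hγ (Composition.ext (Option.some.inj h).symm)
      · simp
  rw [onEmpty_ribbon_eq_sum_words]
  have h1 : ∀ w ∈ words N n, (if wordComp w = β.blocks then optVec (run w) else 0) =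
      ∑ α : Composition n, if run w = some α.blocks ∧ wordComp w = β.blocks then
        Finsupp.single α.blocks (1 : ℚ) else 0 := by
    intro w hw
    split_ifs with h
    · simp [hvec w hw, h]
    · simp [h]
  rw [sum_congr rfl h1, sum_comm]
  refine sum_congr rfl fun α _ => ?_
  rw [numSRCT_eq α β hN, ← sum_filter, sum_const, Nat.cast_smul_eq_nsmul]

/-! ### Every diagram is reached: the linear system is solvable -/

/-- The span of the diagrams with a given property. -/
noncomputable abbrev diagramSpan (P : List ℕ → Prop) : Submodule ℚ DiagramSpace :=
  Submodule.span ℚ ((fun β => Finsupp.single β 1) '' {β | P β})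

theorem single_mem_diagramSpan {P : List ℕ → Prop} {β : List ℕ} (h : P β) :
    (Finsupp.single β 1 : DiagramSpace) ∈ diagramSpan P :=
  Submodule.subset_span ⟨β, h, rfl⟩

theorem boxOp_mem_diagramSpan {P Q : List ℕ → Prop} {N c : ℕ}
    (h : ∀ β β', P β → step c β = some β' → Q β') {v : DiagramSpace} (hv : v ∈ diagramSpan P) :
    boxOp N c v ∈ diagramSpan Q := by
  rw [boxOp]
  split_ifs
  swap
  · simp
  induction hv using Submodule.span_induction with
  | mem x hx =>
    obtain ⟨β, hβ, rfl⟩ := hx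
    simp only [stepOp_single]
    rcases hs : step c β with _ | β'
    · simp [optVec]
    · exact single_mem_diagramSpan (h β β' hβ hs)
  | zero => simp
  | add x y _ _ hx hy => rw [map_add]; exact add_mem hx hy
  | smul r x _ hx => rw [map_smul]; exact Submodule.smul_mem _ _ hx

theorem coeff_mem_diagramSpan {P : ℕ → List ℕ → Prop} {N d a : ℕ}
    (h : ∀ n c β β', a ≤ c → P n β → step c β = some β' → P (n + 1) β') {m : ℕ} (n : ℕ)
    {v : DiagramSpace} (hv : v ∈ diagramSpan (P m)) :
    PowerSeries.coeff n (decreasingSeries (boxOp N) d a) v ∈ diagramSpan (P (m + n)) := by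
  induction d generalizing a m n v with
  | zero =>
    rw [decreasingSeries, PowerSeries.coeff_one]
    split_ifs with hn
    · subst hn
      exact hv
    · simp
  | succ d ih =>
    rcases n with _ | n
    · rw [coeff_zero_decreasingSeries]
      exact hv
    · rw [coeff_succ_decreasingSeries, LinearMap.add_apply, Module.End.mul_apply]
      have h' : ∀ n c β β', a + 1 ≤ c → P n β → step c β = some β' → P (n + 1) β' :=
        fun n c β β' hc => h n c β β' (by omega)
      refine add_mem (ih h' _ hv) ?_
      rw [show m + (n + 1) = m + 1 + n by omega]
      exact ih h' _ (boxOp_mem_diagramSpan (fun β β' => h m a β β' le_rfl) hv)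

theorem length_of_step {c : ℕ} (hc : 1 ≤ c) {γ β : List ℕ} (h : step c γ = some β) :
    β.length = γ.length := by
  obtain ⟨c, rfl⟩ : ∃ c', c = c' + 1 := ⟨c - 1, by omega⟩
  obtain ⟨p, -, -, -, rfl⟩ := growPart_eq_some.1 h
  simp

theorem step_cons_of_ne {a c : ℕ} (hc : 1 ≤ c) (h : a ≠ c) (γ : List ℕ) :
    step c (a :: γ) = (step c γ).map (List.cons a) := by
  obtain ⟨c, rfl⟩ : ∃ c', c = c' + 1 := ⟨c - 1, by omega⟩
  simp [step, growPart, h]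

theorem step_cons_self {a : ℕ} (ha : 1 ≤ a) (γ : List ℕ) :
    step a (a :: γ) = some ((a + 1) :: γ) := by
  obtain ⟨a, rfl⟩ : ∃ a', a = a' + 1 := ⟨a - 1, by omega⟩
  simp [step, growPart]

/-- Adding `n` boxes in distinct columns from `a` on to a diagram with top row `a` either fills
the top row up to `a + n` or leaves it shorter. -/
theorem coeff_apply_cons {N d a : ℕ} (ha : 1 ≤ a) (hN : a + d ≤ N) (n : ℕ) {γ : List ℕ}
    (hγ : ∀ b ∈ γ, 0 < b) :
    PowerSeries.coeff n (decreasingSeries (boxOp N) d a) (Finsupp.single (a :: γ) 1) -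
      (if n ≤ d then Finsupp.single ((a + n) :: γ) 1 else 0) ∈
      diagramSpan fun β => (∀ b ∈ β, 0 < b) ∧ β.sum = a + γ.sum + n ∧
        ∃ b γ', β = b :: γ' ∧ b < a + n ∧ γ'.length = γ.length := by
  induction d generalizing a n with
  | zero =>
    rw [decreasingSeries, PowerSeries.coeff_one]
    rcases n with _ | n <;> simp
  | succ d ih =>
    rcases n with _ | n
    · simp [coeff_zero_decreasingSeries]
    · rw [coeff_succ_decreasingSeries, LinearMap.add_apply, Module.End.mul_apply, add_sub_assoc,
        boxOp, if_pos (by omega), stepOp_single, step_cons_self ha, optVec]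
      refine add_mem ?_ ?_
      · -- letters above `a` do not touch the top row
        have := coeff_mem_diagramSpan (N := N) (d := d) (a := a + 1) (m := 0)
          (P := fun n β => (∀ b ∈ β, 0 < b) ∧ β.sum = a + γ.sum + n ∧
            ∃ γ', β = a :: γ' ∧ γ'.length = γ.length) ?_ (n + 1) (single_mem_diagramSpan
            (β := a :: γ) ⟨by simpa using ⟨by omega, hγ⟩, by simp, γ, rfl, rfl⟩)
        · refine Submodule.span_mono (Set.image_mono ?_) this
          rintro β ⟨h1, h2, γ', rfl, h3⟩
          exact ⟨h1, by rw [h2, zero_add], a, γ', rfl, by omega, h3⟩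
        · rintro n c _ β' hc ⟨h1, h2, γ', rfl, h3⟩ hs
          have h4 := sum_of_step hs
          refine ⟨pos_of_step hs h1, by omega, ?_⟩
          rw [step_cons_of_ne (by omega) (by omega)] at hs
          obtain ⟨δ, hδ, rfl⟩ := Option.map_eq_some_iff.1 hs
          exact ⟨δ, rfl, by rw [length_of_step (by omega) hδ, h3]⟩
      · have := ih (a := a + 1) (by omega) (by omega) n
        rw [show a + (n + 1) = a + 1 + n by omega]
        simp only [Nat.add_le_add_iff_right]
        refine Submodule.span_mono (Set.image_mono ?_) this
        rintro β ⟨h1, h2, h3⟩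
        exact ⟨h1, by rw [h2]; omega, h3⟩

/-- Each diagram is obtained from the empty one by the action of a combination of ribbons:
`h_a` times the diagram with the top row `a` removed produces the diagram itself, and diagrams with
fewer rows or with as many rows and a shorter top row. -/
theorem single_mem_map_ribbonSpan {N k : ℕ} (hk : k ≤ N) {β : List ℕ} (hβ : ∀ b ∈ β, 0 < b)
    (hsum : β.sum = k) : Finsupp.single β 1 ∈ (ribbonSpan k).map (onEmpty N) := by
  obtain ⟨l, hl⟩ : ∃ l, β.length = l := ⟨_, rfl⟩
  obtain ⟨b, hb⟩ : ∃ b, β.headD 0 = b := ⟨_, rfl⟩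
  induction k using Nat.strong_induction_on generalizing β l b with
  | _ k ihk =>
  induction l using Nat.strong_induction_on generalizing β b with
  | _ l ihl =>
  induction b using Nat.strong_induction_on generalizing β with
  | _ b ihb =>
  rcases β with _ | ⟨a, γ⟩
  · obtain rfl : k = 0 := by simpa using hsum.symm
    exact ⟨1, ribbonList_mem_ribbonSpan (l := []) (by simp), by simp [onEmpty_apply]⟩
  · simp only [List.mem_cons, forall_eq_or_imp, List.sum_cons, List.length_cons,
      List.headD_cons] at hβ hsum hl hb
    subst hb
    obtain ⟨n, rfl⟩ : ∃ n, a = n + 1 := ⟨a - 1, by omega⟩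
    obtain ⟨M, rfl⟩ : ∃ M, N = M + 1 := ⟨N - 1, by omega⟩
    obtain ⟨x, hx, hxγ⟩ := ihk γ.sum (by omega) (by omega) hβ.2 rfl _ rfl _ rfl
    have h1 : PowerSeries.coeff (n + 1) (boxSeries (M + 1)) (Finsupp.single γ 1) ∈
        (ribbonSpan k).map (onEmpty (M + 1)) := by
      refine ⟨completeH (n + 1) * x, ?_, ?_⟩
      · have := completeH_mul_mem_ribbonSpan hβ.1 hx
        rwa [hsum] at this
      · rw [onEmpty_mul, hxγ, boxRep_completeH]
    have h2 := coeff_apply_cons (N := M + 1) (d := M) (a := 1) le_rfl (by omega) n hβ.2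
    rw [if_pos (by omega)] at h2
    have h3 := coeff_mem_diagramSpan (N := M + 1) (d := M) (a := 1) (m := 0)
      (P := fun n β => (∀ b ∈ β, 0 < b) ∧ β.sum = γ.sum + n ∧ β.length = γ.length)
      (fun n c β β' hc hP hs => ⟨pos_of_step hs hP.1, by rw [sum_of_step hs, hP.2.1]; omega,
        by rw [length_of_step hc hs, hP.2.2]⟩) (n + 1)
      (single_mem_diagramSpan ⟨hβ.2, by simp, rfl⟩)
    have h4 : diagramSpan (fun β => (∀ b ∈ β, 0 < b) ∧ β.sum = γ.sum + (0 + (n + 1)) ∧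
        β.length = γ.length) ≤ (ribbonSpan k).map (onEmpty (M + 1)) := by
      refine Submodule.span_le.2 ?_
      rintro _ ⟨β, ⟨hp, hs, hlen⟩, rfl⟩
      exact ihl γ.length (by omega) hp (by omega) hlen _ rfl
    have h5 : diagramSpan (fun β => (∀ b ∈ β, 0 < b) ∧ β.sum = 1 + γ.sum + n ∧
        ∃ b γ', β = b :: γ' ∧ b < 1 + n ∧ γ'.length = γ.length) ≤
        (ribbonSpan k).map (onEmpty (M + 1)) := by
      refine Submodule.span_le.2 ?_
      rintro _ ⟨_, ⟨hp, hs, b, γ', rfl, hb, hlen⟩, rfl⟩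
      exact ihb b (by omega) hp (by omega) (by simp; omega) rfl
    have h6 : PowerSeries.coeff (n + 1) (boxSeries (M + 1)) (Finsupp.single γ 1) =
        PowerSeries.coeff (n + 1) (decreasingSeries (boxOp (M + 1)) M 1) (Finsupp.single γ 1) +
        PowerSeries.coeff n (decreasingSeries (boxOp (M + 1)) M 1) (Finsupp.single (1 :: γ) 1) := by
      rw [boxSeries, coeff_succ_decreasingSeries, LinearMap.add_apply, Module.End.mul_apply,
        boxOp, if_pos (by omega), stepOp_single]
      rfl
    rw [h6] at h1
    have := sub_mem (sub_mem h1 (h4 h3)) (h5 h2)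
    rw [show 1 + n = n + 1 by omega] at this
    simpa using this

theorem isUnit_descentMatrix (n : ℕ) : IsUnit (descentMatrix n) := by
  have h1 : ∀ α : Composition n, ∃ c : Composition n → ℚ,
      ∑ β, c β • onEmpty n (ribbon β) = Finsupp.single α.blocks 1 := by
    intro α
    obtain ⟨x, hx, hxα⟩ := single_mem_map_ribbonSpan (le_refl n) (fun b hb => α.blocks_pos hb)
      α.blocks_sum
    obtain ⟨c, rfl⟩ := (Submodule.mem_span_range_iff_exists_fun ℚ).1 hx
    exact ⟨c, by rw [← hxα]; simp⟩
  choose c hc using h1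
  refine (isUnit_iff_exists_inv' (M := Matrix (Composition n) (Composition n) ℚ)).2
    ⟨Matrix.of c, ?_⟩
  ext α δ
  have := DFunLike.congr_fun (hc α) δ.blocks
  simp only [onEmpty_ribbon (le_refl n)] at this
  rw [Finsupp.finsetSum_apply] at this
  have hb : ∀ α β : Composition n, α.blocks = β.blocks ↔ α = β := fun α β =>
    ⟨Composition.ext, fun h => by rw [h]⟩
  simp only [Finsupp.smul_apply, Finsupp.finsetSum_apply, Finsupp.single_apply, hb] at this
  simpa [Matrix.mul_apply, descentMatrix, Matrix.one_apply] using this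

/-- The defining relations of the noncommutative Schur functions. -/
theorem ribbon_eq_sum_ncSchur {n : ℕ} (γ : Composition n) :
    ribbon γ = ∑ δ : Composition n, (numSRCT δ γ : ℚ) • ncSchur δ := by
  have h := Matrix.mul_nonsing_inv (descentMatrix n)
    ((Matrix.isUnit_iff_isUnit_det _).1 (isUnit_descentMatrix n))
  simp only [ncSchur, smul_sum, smul_smul]
  rw [sum_comm]
  simp only [← sum_smul]
  have h1 : ∀ β, ∑ δ, (numSRCT δ γ : ℚ) * (descentMatrix n)⁻¹ δ β =
      (1 : Matrix (Composition n) (Composition n) ℚ) γ β := by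
    intro β
    rw [← h, Matrix.mul_apply]
    rfl
  simp [h1, Matrix.one_apply]

theorem onEmpty_ncSchur {N n : ℕ} (hN : n ≤ N) (α : Composition n) :
    onEmpty N (ncSchur α) = Finsupp.single α.blocks 1 := by
  have h := Matrix.nonsing_inv_mul (descentMatrix n)
    ((Matrix.isUnit_iff_isUnit_det _).1 (isUnit_descentMatrix n))
  simp only [ncSchur, map_sum, map_smul, onEmpty_ribbon hN, smul_sum, smul_smul]
  rw [sum_comm]
  simp only [← sum_smul]
  have h1 : ∀ δ, ∑ β, (descentMatrix n)⁻¹ α β * (numSRCT δ β : ℚ) =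
      (1 : Matrix (Composition n) (Composition n) ℚ) α δ := by
    intro β
    rw [← h, Matrix.mul_apply]
    rfl
  simp [h1, Matrix.one_apply]

theorem ncSchur_mem_ribbonSpan {n : ℕ} (α : Composition n) : ncSchur α ∈ ribbonSpan n :=
  sum_mem fun β _ => Submodule.smul_mem _ _ (Submodule.subset_span ⟨β, rfl⟩)

/-- An element of degree `n` is determined by its action on the empty diagram. -/
theorem eq_of_onEmpty_eq {N n : ℕ} (hN : n ≤ N) {x y : NSym} (hx : x ∈ ribbonSpan n)
    (hy : y ∈ ribbonSpan n) (h : onEmpty N x = onEmpty N y) : x = y := by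
  suffices ∀ z ∈ ribbonSpan n, onEmpty N z = 0 → z = 0 from
    sub_eq_zero.1 (this _ (sub_mem hx hy) (by rw [map_sub, h, sub_self]))
  intro z hz h0
  have hle : ribbonSpan n ≤ Submodule.span ℚ (Set.range fun α : Composition n => ncSchur α) := by
    refine Submodule.span_le.2 ?_
    rintro _ ⟨γ, rfl⟩
    simp only [ribbon_eq_sum_ncSchur]
    exact sum_mem fun δ _ => Submodule.smul_mem _ _ (Submodule.subset_span ⟨δ, rfl⟩)
  obtain ⟨c, rfl⟩ := (Submodule.mem_span_range_iff_exists_fun ℚ).1 (hle hz)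
  simp only [map_sum, map_smul, onEmpty_ncSchur hN] at h0
  refine sum_eq_zero fun α _ => ?_
  have := DFunLike.congr_fun h0 α.blocks
  have hb : ∀ α β : Composition n, α.blocks = β.blocks ↔ α = β := fun α β =>
    ⟨Composition.ext, fun h => by rw [h]⟩
  rw [Finsupp.finsetSum_apply] at this
  simp only [Finsupp.smul_apply, Finsupp.single_apply, hb] at this
  have hc : c α = 0 := by simpa using this
  rw [hc, zero_smul]

/-! ### Border strips column by column -/

/-- The box in row `i` and column `c` is added in passing from row lengths `x` to `y`. -/
def Added (x y : ℕ → ℕ) (i c : ℕ) : Prop := x i ≤ c ∧ c < y i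

/-- The skew shape between the row lengths `x` and `y` is an nc border strip without north-east
columns, and its leftmost column is `a`. The condition `left` is the trace of the order of
compositions: if a box `(j, c)` with `c ≥ 1` is added, then each row above `j` of initial length `c`
receives a box too. -/
structure IsStrip (a : ℕ) (x y : ℕ → ℕ) : Prop where
  le : ∀ i, x i ≤ y i
  least : ∃ i, Added x y i a
  ge : ∀ i c, Added x y i c → a ≤ c
  conn : ∀ c, a ≤ c → (∃ i, Added x y i (c + 1)) → ∃ i, Added x y i c
  left : ∀ i j c, i < j → 1 ≤ c → Added x y j c → x i = c → c < y i
  first : ∀ i, Added x y i 0 → Added x y i 1 → ∀ i', Added x y i' 0 → i' ≤ i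
  other : ∀ i c, 1 ≤ c → Added x y i c → Added x y i (c + 1) → ∀ i', Added x y i' c → i ≤ i'
  notNE : ∀ c, (∃ i, Added x y i c) → (∃ i, Added x y i (c + 1)) →
    ∃ i₁ i₂, Added x y i₁ (c + 1) ∧ Added x y i₂ c ∧ i₂ ≤ i₁

/-- The topmost row of length `a` is `p`. -/
def Leftmost (a : ℕ) (x : ℕ → ℕ) (p : ℕ) : Prop := x p = a ∧ ∀ i < p, x i ≠ a

section Strips

variable {a p q : ℕ} {x y : ℕ → ℕ}

theorem Leftmost.unique {p' : ℕ} (h : Leftmost a x p) (h' : Leftmost a x p') : p = p' := by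
  rcases lt_trichotomy p p' with h1 | h1 | h1
  · exact absurd h.1 (h'.2 p h1)
  · exact h1
  · exact absurd h'.1 (h.2 p' h1)

theorem IsStrip.eq_of_added (h : IsStrip a x y) {i : ℕ} (hi : Added x y i a) : x i = a := by
  have := h.ge i (x i) ⟨le_rfl, by have := hi.1; have := hi.2; omega⟩
  have := hi.1
  omega

theorem IsStrip.eq_of_lt (h : IsStrip a x y) {i : ℕ} (hi : x i < a) : y i = x i := by
  by_contra hne
  have := h.le i
  have := h.ge i (x i) ⟨le_rfl, by omega⟩
  omega

/-- The first box of the strip sits at the end of the topmost row of length `a`. -/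
theorem IsStrip.exists_top (ha : 1 ≤ a) (h : IsStrip a x y) :
    ∃ p, Leftmost a x p ∧ Added x y p a ∧ ∀ i, Added x y i a → p ≤ i := by
  classical
  have hex := h.least
  refine ⟨Nat.find hex, ⟨h.eq_of_added (Nat.find_spec hex), fun i hi hxi => ?_⟩,
    Nat.find_spec hex, fun i hi => Nat.find_min' hex hi⟩
  have := h.left i _ a hi ha (Nat.find_spec hex) hxi
  exact Nat.find_min hex hi ⟨hxi.le, this⟩

/-- Remove the bottommost of several boxes in the leftmost column. -/
theorem IsStrip.remove_bottom (ha : 1 ≤ a) (h : IsStrip a x y) (hp : Added x y p a)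
    (hq : Added x y q a) (hbot : ∀ i, Added x y i a → i ≤ q) (hpq : p ≠ q) :
    y q = a + 1 ∧ x q = a ∧ IsStrip a x (Function.update y q a) ∧
      Leftmost a (Function.update y q a) q := by
  have hpq' : p < q := lt_of_le_of_ne (hbot p hp) hpq
  have hxq := h.eq_of_added hq
  have hxp := h.eq_of_added hp
  have hyq : y q = a + 1 := by
    by_contra hne
    have := h.other q a ha hq ⟨by have := hq.1; omega, by have := hq.2; omega⟩ p hp
    omega
  have hadd : ∀ i c, Added x (Function.update y q a) i c ↔ Added x y i c ∧ ¬ (i = q ∧ c = a) := by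
    intro i c
    simp only [Added, Function.update_apply]
    grind
  refine ⟨hyq, hxq, ⟨?_, ⟨p, ?_⟩, ?_, ?_, ?_, ?_, ?_, ?_⟩, ?_, ?_⟩
  · intro i
    have := h.le i
    rw [Function.update_apply]
    grind
  · rw [hadd]
    grind
  · intro i c hi
    rw [hadd] at hi
    exact h.ge i c hi.1
  · rintro c hc ⟨i, hi⟩
    rw [hadd] at hi
    obtain ⟨j, hj⟩ := h.conn c hc ⟨i, hi.1⟩
    by_cases hjq : j = q ∧ c = a
    · refine ⟨p, ?_⟩
      rw [hadd]
      grind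
    · exact ⟨j, (hadd _ _).2 ⟨hj, hjq⟩⟩
  · intro i j c hij hc hj hi
    rw [hadd] at hj
    have := h.left i j c hij hc hj.1 hi
    have := hbot j
    rw [Function.update_apply]
    grind
  · intro i hi
    rw [hadd] at hi
    have := h.ge i 0 hi.1
    omega
  · intro i c hc h1 h2 i' h3
    rw [hadd] at h1 h2 h3
    exact h.other i c hc h1.1 h2.1 i' h3.1
  · rintro c ⟨i, hi⟩ ⟨j, hj⟩
    rw [hadd] at hi hj
    obtain ⟨i₁, i₂, h1, h2, h3⟩ := h.notNE c ⟨i, hi.1⟩ ⟨j, hj.1⟩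
    have h1' : ¬ (i₁ = q ∧ c + 1 = a) := by
      rintro ⟨-, h4⟩
      have := h.ge i₂ c h2
      omega
    by_cases h4 : i₂ = q ∧ c = a
    · exact ⟨i₁, p, (hadd _ _).2 ⟨h1, h1'⟩, (hadd _ _).2 ⟨by rw [h4.2]; exact hp, by omega⟩,
        by omega⟩
    · exact ⟨i₁, i₂, (hadd _ _).2 ⟨h1, h1'⟩, (hadd _ _).2 ⟨h2, h4⟩, h3⟩
  · simp
  · intro i hi hyi
    rw [Function.update_of_ne hi.ne] at hyi
    have h1 := h.le i
    rcases (show x i ≤ a by omega).lt_or_eq with h2 | h2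
    · have := h.eq_of_lt h2
      omega
    · have := h.left i q a hi ha hq h2
      omega

/-- Add a further box to the leftmost column. -/
theorem IsStrip.add_bottom (ha : 1 ≤ a) (h : IsStrip a x y) (hq : Leftmost a y q) :
    x q = a ∧ IsStrip a x (Function.update y q (a + 1)) ∧
      (∃ p, p ≠ q ∧ Added x (Function.update y q (a + 1)) p a) ∧
      ∀ i, Added x (Function.update y q (a + 1)) i a → i ≤ q := by
  obtain ⟨hyq, hlt⟩ := hq
  obtain ⟨p, hp, hpa, hptop⟩ := h.exists_top ha
  have hxq : x q = a := by
    by_contra hne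
    have := h.le q
    have := h.eq_of_lt (i := q) (by omega)
    omega
  have hadd : ∀ i c, Added x (Function.update y q (a + 1)) i c ↔
      Added x y i c ∨ (i = q ∧ c = a) := by
    intro i c
    simp only [Added, Function.update_apply]
    grind
  have hbot : ∀ i, Added x y i a → i < q := by
    intro i hi
    by_contra hiq
    have hne : i ≠ q := by rintro rfl; have := hi.2; omega
    have := h.left q i a (by omega) ha hi hxq
    omega
  have hpq := hbot p hpa
  refine ⟨hxq, ⟨?_, ⟨p, ?_⟩, ?_, ?_, ?_, ?_, ?_, ?_⟩, ⟨p, by omega, (hadd _ _).2 (Or.inl hpa)⟩, ?_⟩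
  · intro i
    have := h.le i
    rw [Function.update_apply]
    grind
  · exact (hadd _ _).2 (Or.inl hpa)
  · intro i c hi
    rcases (hadd _ _).1 hi with hi | hi
    · exact h.ge i c hi
    · omega
  · rintro c hc ⟨i, hi⟩
    rcases (hadd _ _).1 hi with hi | hi
    · obtain ⟨j, hj⟩ := h.conn c hc ⟨i, hi⟩
      exact ⟨j, (hadd _ _).2 (Or.inl hj)⟩
    · omega
  · intro i j c hij hc hj hi
    rw [Function.update_apply]
    rcases (hadd _ _).1 hj with hj | ⟨rfl, rfl⟩
    · have := h.left i j c hij hc hj hi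
      grind
    · have := hlt i hij
      have := h.le i
      grind
  · intro i hi
    rcases (hadd _ _).1 hi with hi | hi
    · have := h.ge i 0 hi
      omega
    · omega
  · intro i c hc h1 h2 i' h3
    rcases (hadd _ _).1 h2 with h5 | h5
    · rcases (hadd _ _).1 h1 with h4 | ⟨rfl, rfl⟩
      · rcases (hadd _ _).1 h3 with h3 | ⟨rfl, rfl⟩
        · exact h.other i c hc h4 h5 i' h3
        · exact (hbot i h4).le
      · have := h5.2
        omega
    · rcases (hadd _ _).1 h1 with h1 | ⟨-, h1⟩
      · have := h.ge i c h1
        omega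
      · omega
  · rintro c ⟨i, hi⟩ ⟨j, hj⟩
    have hj' : Added x y j (c + 1) := by
      rcases (hadd _ _).1 hj with hj | hj
      · exact hj
      · rcases (hadd _ _).1 hi with hi | hi
        · have := h.ge _ _ hi
          omega
        · omega
    have hi' : ∃ i, Added x y i c := by
      rcases (hadd _ _).1 hi with hi | ⟨-, rfl⟩
      · exact ⟨i, hi⟩
      · exact ⟨p, hpa⟩
    obtain ⟨i₁, i₂, h1, h2, h3⟩ := h.notNE c hi' ⟨j, hj'⟩
    exact ⟨i₁, i₂, (hadd _ _).2 (Or.inl h1), (hadd _ _).2 (Or.inl h2), h3⟩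
  · intro i hi
    rcases (hadd _ _).1 hi with hi | hi
    · exact (hbot i hi).le
    · omega

/-- A strip with one box in its leftmost column, whose row extends further. -/
theorem IsStrip.remove_long (ha : 1 ≤ a) (h : IsStrip a x y) (hp : Added x y p a)
    (huniq : ∀ i, Added x y i a → i = p) (hyp : a + 2 ≤ y p) :
    IsStrip (a + 1) (Function.update x p (a + 1)) y := by
  have hxp := h.eq_of_added hp
  have hadd : ∀ i c, Added (Function.update x p (a + 1)) y i c ↔
      Added x y i c ∧ c ≠ a := by
    intro i c
    have := huniq i
    have := h.ge i c
    simp only [Added, Function.update_apply] at *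
    grind
  refine ⟨?_, ⟨p, ?_⟩, ?_, ?_, ?_, ?_, ?_, ?_⟩
  · intro i
    have := h.le i
    rw [Function.update_apply]
    grind
  · rw [hadd]
    exact ⟨⟨by omega, by omega⟩, by omega⟩
  · intro i c hi
    rw [hadd] at hi
    have := h.ge i c hi.1
    omega
  · rintro c hc ⟨i, hi⟩
    rw [hadd] at hi
    obtain ⟨j, hj⟩ := h.conn c (by omega) ⟨i, hi.1⟩
    exact ⟨j, (hadd _ _).2 ⟨hj, by omega⟩⟩
  · intro i j c hij hc hj hi
    rw [hadd] at hj
    rw [Function.update_apply] at hi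
    split_ifs at hi with hip
    · subst hip
      omega
    · exact h.left i j c hij hc hj.1 hi
  · intro i hi
    rw [hadd] at hi
    have := h.ge i 0 hi.1
    omega
  · intro i c hc h1 h2 i' h3
    rw [hadd] at h1 h2 h3
    exact h.other i c hc h1.1 h2.1 i' h3.1
  · rintro c ⟨i, hi⟩ ⟨j, hj⟩
    rw [hadd] at hi hj
    obtain ⟨i₁, i₂, h1, h2, h3⟩ := h.notNE c ⟨i, hi.1⟩ ⟨j, hj.1⟩
    exact ⟨i₁, i₂, (hadd _ _).2 ⟨h1, hj.2⟩, (hadd _ _).2 ⟨h2, hi.2⟩, h3⟩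

theorem IsStrip.add_long (hp : Leftmost a x p)
    (h : IsStrip (a + 1) (Function.update x p (a + 1)) y) (hyp : a + 2 ≤ y p) :
    IsStrip a x y ∧ Added x y p a ∧ ∀ i, Added x y i a → i = p := by
  obtain ⟨hxp, hlt⟩ := hp
  have huniq : ∀ i, Added x y i a → i = p := by
    intro i hi
    by_contra hne
    have := h.ge i a (by simpa only [Added, Function.update_of_ne hne] using hi)
    omega
  have hadd : ∀ i c, Added x y i c ↔
      Added (Function.update x p (a + 1)) y i c ∨ (i = p ∧ c = a) := by
    intro i c
    simp only [Added, Function.update_apply]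
    grind
  have hpa : Added x y p a := ⟨by omega, by omega⟩
  refine ⟨⟨?_, ⟨p, hpa⟩, ?_, ?_, ?_, ?_, ?_, ?_⟩, hpa, huniq⟩
  · intro i
    have := h.le i
    rw [Function.update_apply] at this
    grind
  · intro i c hi
    rcases (hadd _ _).1 hi with hi | hi
    · have := h.ge i c hi
      omega
    · omega
  · rintro c hc ⟨i, hi⟩
    rcases hc.lt_or_eq with hc | rfl
    · rcases (hadd _ _).1 hi with hi | hi
      · obtain ⟨j, hj⟩ := h.conn c hc ⟨i, hi⟩
        exact ⟨j, (hadd _ _).2 (Or.inl hj)⟩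
      · omega
    · exact ⟨p, hpa⟩
  · intro i j c hij hc hj hi
    rcases (hadd _ _).1 hj with hj | ⟨rfl, rfl⟩
    · have := h.ge _ _ hj
      have hne : i ≠ p := by rintro rfl; omega
      exact h.left i j c hij hc hj (by rwa [Function.update_of_ne hne])
    · exact absurd hi (hlt i hij)
  · intro i h0 h1 i' h2
    rcases (hadd _ _).1 h0 with h0 | h0
    · have := h.ge _ _ h0
      omega
    · rcases (hadd _ _).1 h2 with h2 | h2
      · have := h.ge _ _ h2
        omega
      · omega
  · intro i c hc h1 h2 i' h3
    rcases (hadd _ _).1 h3 with h3 | ⟨rfl, rfl⟩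
    · have := h.ge _ _ h3
      rcases (hadd _ _).1 h1 with h1 | ⟨-, h1⟩
      · rcases (hadd _ _).1 h2 with h2 | ⟨-, h2⟩
        · exact h.other i c hc h1 h2 i' h3
        · omega
      · omega
    · exact (huniq i h1).le
  · rintro c ⟨i, hi⟩ ⟨j, hj⟩
    rcases (hadd _ _).1 hi with hi | ⟨-, rfl⟩
    · have := h.ge _ _ hi
      rcases (hadd _ _).1 hj with hj | hj
      · obtain ⟨i₁, i₂, h1, h2, h3⟩ := h.notNE c ⟨i, hi⟩ ⟨j, hj⟩
        exact ⟨i₁, i₂, (hadd _ _).2 (Or.inl h1), (hadd _ _).2 (Or.inl h2), h3⟩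
      · omega
    · exact ⟨p, p, ⟨by omega, by omega⟩, hpa, le_rfl⟩

theorem added_update_right_iff (hyp : y p = a + 1) (hxp : x p = a) (i c : ℕ) :
    Added x y i c ↔ Added x (Function.update y p a) i c ∨ (i = p ∧ c = a) := by
  simp only [Added, Function.update_apply]
  grind

/-- A strip with one box in its leftmost column, whose row does not extend further. -/
theorem IsStrip.remove_short (ha : 1 ≤ a) (h : IsStrip a x y) (hp : Added x y p a)
    (hpl : Leftmost a x p)
    (huniq : ∀ i, Added x y i a → i = p) (hyp : y p = a + 1) (hne : ∃ i, Added x y i (a + 1)) :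
    IsStrip (a + 1) x (Function.update y p a) ∧ Leftmost a (Function.update y p a) p ∧
      ∃ i, p < i ∧ Added x (Function.update y p a) i (a + 1) := by
  have hxp := h.eq_of_added hp
  have hadd := added_update_right_iff hyp hxp
  have hnot : ¬ Added x (Function.update y p a) p a := by
    rintro ⟨-, h2⟩
    simp at h2
  have hadd' : ∀ i c, a + 1 ≤ c → Added x y i c → Added x (Function.update y p a) i c := by
    intro i c hc hi
    rcases (hadd _ _).1 hi with hi | hi
    · exact hi
    · omega
  refine ⟨⟨?_, ?_, ?_, ?_, ?_, ?_, ?_, ?_⟩, ⟨by simp, ?_⟩, ?_⟩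
  · intro i
    have := h.le i
    rw [Function.update_apply]
    grind
  · obtain ⟨i, hi⟩ := hne
    exact ⟨i, hadd' _ _ le_rfl hi⟩
  · intro i c hi
    have hi' := (hadd i c).2 (Or.inl hi)
    rcases (h.ge i c hi').lt_or_eq with hc | rfl
    · exact hc
    · rw [huniq i hi'] at hi
      exact absurd hi hnot
  · rintro c hc ⟨i, hi⟩
    obtain ⟨j, hj⟩ := h.conn c (by omega) ⟨i, (hadd _ _).2 (Or.inl hi)⟩
    exact ⟨j, hadd' _ _ hc hj⟩
  · intro i j c hij hc hj hi
    have hj' := (hadd _ _).2 (Or.inl hj)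
    have h1 := h.left i j c hij hc hj' hi
    rw [Function.update_apply]
    split_ifs with hip
    · subst hip
      have := huniq j (by rwa [← hxp, hi])
      omega
    · exact h1
  · intro i hi
    have := h.ge i 0 ((hadd _ _).2 (Or.inl hi))
    omega
  · intro i c hc h1 h2 i' h3
    exact h.other i c hc ((hadd _ _).2 (Or.inl h1)) ((hadd _ _).2 (Or.inl h2)) i'
      ((hadd _ _).2 (Or.inl h3))
  · rintro c ⟨i, hi⟩ ⟨j, hj⟩
    have hi' := (hadd _ _).2 (Or.inl hi)
    have hc : a + 1 ≤ c := by
      rcases (h.ge i c hi').lt_or_eq with hc | rfl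
      · exact hc
      · rw [huniq i hi'] at hi
        exact absurd hi hnot
    obtain ⟨i₁, i₂, h1, h2, h3⟩ := h.notNE c ⟨i, hi'⟩ ⟨j, (hadd _ _).2 (Or.inl hj)⟩
    exact ⟨i₁, i₂, hadd' _ _ (by omega) h1, hadd' _ _ hc h2, h3⟩
  · intro i hi hyi
    rw [Function.update_of_ne hi.ne] at hyi
    have h1 := h.le i
    rcases (show x i ≤ a by omega).lt_or_eq with h2 | h2
    · have := h.eq_of_lt h2
      omega
    · exact hpl.2 i hi h2
  · obtain ⟨i₁, i₂, h1, h2, h3⟩ := h.notNE a ⟨p, hp⟩ hne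
    obtain rfl := huniq i₂ h2
    refine ⟨i₁, lt_of_le_of_ne h3 ?_, hadd' _ _ le_rfl h1⟩
    rintro rfl
    have := h1.2
    omega

theorem IsStrip.leftmost_of_leftmost (h : IsStrip (a + 1) x y) (hp : Leftmost a y p) :
    Leftmost a x p := by
  have key : ∀ i, x i = a → y i = a := fun i hi => by rw [h.eq_of_lt (by omega), hi]
  refine ⟨?_, fun i hi hxi => hp.2 i hi (key i hxi)⟩
  have h1 := h.le p
  rw [hp.1] at h1
  rw [← hp.1, h.eq_of_lt (by omega)]

theorem IsStrip.add_short (h : IsStrip (a + 1) x y) (hp : Leftmost a y p)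
    (hi : ∃ i, p < i ∧ Added x y i (a + 1)) :
    IsStrip a x (Function.update y p (a + 1)) ∧ Added x (Function.update y p (a + 1)) p a ∧
      ∀ i, Added x (Function.update y p (a + 1)) i a → i = p := by
  obtain ⟨i₀, hi₀, hi₀'⟩ := hi
  obtain ⟨hxp, hlt⟩ := h.leftmost_of_leftmost hp
  have hadd : ∀ i c, Added x (Function.update y p (a + 1)) i c ↔
      Added x y i c ∨ (i = p ∧ c = a) := by
    intro i c
    have := hp.1
    simp only [Added, Function.update_apply]
    grind
  have hpa : Added x (Function.update y p (a + 1)) p a := (hadd _ _).2 (Or.inr ⟨rfl, rfl⟩)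
  have huniq : ∀ i, Added x (Function.update y p (a + 1)) i a → i = p := by
    intro i hi
    rcases (hadd _ _).1 hi with hi | hi
    · have := h.ge _ _ hi
      omega
    · exact hi.1
  refine ⟨⟨?_, ⟨p, hpa⟩, ?_, ?_, ?_, ?_, ?_, ?_⟩, hpa, huniq⟩
  · intro i
    have := h.le i
    rw [Function.update_apply]
    grind
  · intro i c hi
    rcases (hadd _ _).1 hi with hi | hi
    · have := h.ge i c hi
      omega
    · omega
  · rintro c hc ⟨i, hi⟩
    rcases hc.lt_or_eq with hc | rfl
    · rcases (hadd _ _).1 hi with hi | hi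
      · obtain ⟨j, hj⟩ := h.conn c hc ⟨i, hi⟩
        exact ⟨j, (hadd _ _).2 (Or.inl hj)⟩
      · omega
    · exact ⟨p, hpa⟩
  · intro i j c hij hc hj hi
    rcases (hadd _ _).1 hj with hj | ⟨rfl, rfl⟩
    · have := h.left i j c hij hc hj hi
      have := h.ge _ _ hj
      rw [Function.update_apply]
      grind
    · exact absurd hi (hlt i hij)
  · intro i h0 h1 i' h2
    rcases (hadd _ _).1 h0 with h0 | h0
    · have := h.ge _ _ h0
      omega
    · rcases (hadd _ _).1 h2 with h2 | h2
      · have := h.ge _ _ h2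
        omega
      · omega
  · intro i c hc h1 h2 i' h3
    rcases (hadd _ _).1 h3 with h3 | ⟨rfl, rfl⟩
    · have := h.ge _ _ h3
      rcases (hadd _ _).1 h1 with h1 | ⟨-, h1⟩
      · rcases (hadd _ _).1 h2 with h2 | ⟨-, h2⟩
        · exact h.other i c hc h1 h2 i' h3
        · omega
      · omega
    · exact (huniq i h1).le
  · rintro c ⟨i, hi⟩ ⟨j, hj⟩
    rcases (hadd _ _).1 hi with hi | ⟨-, rfl⟩
    · have := h.ge _ _ hi
      rcases (hadd _ _).1 hj with hj | hj
      · obtain ⟨i₁, i₂, h1, h2, h3⟩ := h.notNE c ⟨i, hi⟩ ⟨j, hj⟩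
        exact ⟨i₁, i₂, (hadd _ _).2 (Or.inl h1), (hadd _ _).2 (Or.inl h2), h3⟩
      · omega
    · exact ⟨i₀, p, (hadd _ _).2 (Or.inl hi₀'), hpa, hi₀.le⟩

/-- If a box in column `a` is added to a row below the boxes in column `a + 1`, this box can be
added before or after the strip. -/
theorem IsStrip.add_after (hp : Leftmost a x p)
    (h : IsStrip (a + 1) (Function.update x p (a + 1)) y) (hyp : y p = a + 1) :
    IsStrip (a + 1) x (Function.update y p a) ∧ Leftmost a (Function.update y p a) p ∧
      ∀ i, Added x (Function.update y p a) i (a + 1) → i < p := by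
  obtain ⟨hxp, hlt⟩ := hp
  have hadd : ∀ i c, Added x (Function.update y p a) i c ↔
      Added (Function.update x p (a + 1)) y i c := by
    intro i c
    simp only [Added, Function.update_apply]
    grind
  refine ⟨⟨?_, ?_, ?_, ?_, ?_, ?_, ?_, ?_⟩, ⟨by simp, ?_⟩, ?_⟩
  · intro i
    have := h.le i
    rw [Function.update_apply] at this ⊢
    grind
  · simpa only [hadd] using h.least
  · simpa only [hadd] using h.ge
  · simpa only [hadd] using h.conn
  · intro i j c hij hc hj hi
    rw [hadd] at hj
    have := h.ge _ _ hj
    have hne : i ≠ p := by rintro rfl; omega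
    rw [Function.update_of_ne hne]
    exact h.left i j c hij hc hj (by rwa [Function.update_of_ne hne])
  · simpa only [hadd] using h.first
  · simpa only [hadd] using h.other
  · simpa only [hadd] using h.notNE
  · intro i hi hyi
    rw [Function.update_of_ne hi.ne] at hyi
    have h1 := h.le i
    rw [Function.update_of_ne hi.ne] at h1
    have h2 := h.eq_of_lt (i := i) (by rw [Function.update_of_ne hi.ne]; omega)
    rw [Function.update_of_ne hi.ne] at h2
    exact hlt i hi (by omega)
  · intro i hi
    rw [hadd] at hi
    by_contra hip
    rcases (not_lt.1 hip).lt_or_eq with h1 | rfl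
    · have := h.left p i (a + 1) h1 (by omega) hi (by simp)
      omega
    · have := hi.2
      omega

theorem IsStrip.add_before (h : IsStrip (a + 1) x y) (hp : Leftmost a y p)
    (hi : ∀ i, Added x y i (a + 1) → i < p) :
    IsStrip (a + 1) (Function.update x p (a + 1)) (Function.update y p (a + 1)) := by
  obtain ⟨hxp, hlt⟩ := h.leftmost_of_leftmost hp
  have hadd : ∀ i c, Added (Function.update x p (a + 1)) (Function.update y p (a + 1)) i c ↔
      Added x y i c := by
    intro i c
    have := hp.1
    simp only [Added, Function.update_apply]
    grind
  refine ⟨?_, ?_, ?_, ?_, ?_, ?_, ?_, ?_⟩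
  · intro i
    have := h.le i
    rw [Function.update_apply, Function.update_apply]
    grind
  · simpa only [hadd] using h.least
  · simpa only [hadd] using h.ge
  · simpa only [hadd] using h.conn
  · intro i j c hij hc hj hxi
    rw [hadd] at hj
    by_cases hne : i = p
    · subst hne
      rw [Function.update_self] at hxi
      subst hxi
      have := hi j hj
      omega
    · rw [Function.update_of_ne hne] at hxi ⊢
      exact h.left i j c hij hc hj hxi
  · simpa only [hadd] using h.first
  · simpa only [hadd] using h.other
  · simpa only [hadd] using h.notNE

end Strips

/-! ### The action of the power sums away from the first column -/

/-- The row lengths of a diagram. -/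
def rowLen (α : List ℕ) (i : ℕ) : ℕ := α.getD i 0

theorem rowLen_set {α : List ℕ} {p : ℕ} (hp : p < α.length) (v : ℕ) :
    rowLen (α.set p v) = Function.update (rowLen α) p v := by
  funext i
  rw [Function.update_apply]
  split_ifs with h
  · subst h
    exact getD_set_self α hp v
  · exact getD_set_ne α h v

theorem lt_length_of_rowLen_pos {α : List ℕ} {i : ℕ} (h : 0 < rowLen α i) : i < α.length :=
  lt_length_of_getD_pos h

theorem eq_of_rowLen_le {α β : List ℕ} (hlen : α.length = β.length) (hsum : β.sum ≤ α.sum)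
    (hle : ∀ i, rowLen α i ≤ rowLen β i) : α = β := by
  induction α generalizing β with
  | nil => exact (List.length_eq_zero_iff.1 hlen.symm).symm
  | cons a α ih =>
    rcases β with _ | ⟨b, β⟩
    · simp at hlen
    · have h0 : a ≤ b := hle 0
      have h1 : ∀ i, rowLen α i ≤ rowLen β i := fun i => hle (i + 1)
      have hlen' : α.length = β.length := by simpa using hlen
      have hs : ∀ γ δ : List ℕ, γ.length = δ.length → (∀ i, rowLen γ i ≤ rowLen δ i) →
          γ.sum ≤ δ.sum := by
        intro γ
        induction γ with
        | nil => simp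
        | cons c γ ihγ =>
          rintro (_ | ⟨d, δ⟩) h2 h3
          · simp at h2
          · have h4 : c ≤ d := h3 0
            have := ihγ δ (by simpa using h2) fun i => h3 (i + 1)
            simp only [List.sum_cons]
            omega
      have := hs α β hlen' h1
      simp only [List.sum_cons] at hsum
      rw [ih hlen' (by omega) h1, show a = b by omega]

theorem step_iff {a : ℕ} (ha : 1 ≤ a) {γ β : List ℕ} : step a γ = some β ↔
    ∃ p, Leftmost a (rowLen γ) p ∧ β = γ.set p (a + 1) := by
  obtain ⟨a, rfl⟩ : ∃ a', a = a' + 1 := ⟨a - 1, by omega⟩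
  rw [step, growPart_eq_some]
  constructor
  · rintro ⟨p, hp, h1, h2, h3⟩
    exact ⟨p, ⟨h1, h2⟩, h3⟩
  · rintro ⟨p, ⟨h1, h2⟩, h3⟩
    exact ⟨p, lt_length_of_rowLen_pos (by omega), h1, h2, h3⟩

/-- The rows, among the first `L`, that receive boxes. -/
def changedRows (x y : ℕ → ℕ) (L : ℕ) : Finset ℕ := (range L).filter fun i => x i < y i

/-- The shape between the diagrams `α` and `β`, with equally many rows, is a strip of size `n` with
leftmost column `a`. -/
def EqStrip (a n : ℕ) (α β : List ℕ) : Prop :=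
  α.length = β.length ∧ β.sum = α.sum + n ∧ IsStrip a (rowLen α) (rowLen β)

/-- The sign of the height of the shape between two diagrams with equally many rows. -/
noncomputable def stripSign (α β : List ℕ) : ℚ :=
  (-1) ^ ((changedRows (rowLen α) (rowLen β) β.length).card - 1)

/-- There is more than one added box in column `a`. -/
def HasTwo (a : ℕ) (α β : List ℕ) : Prop :=
  ∃ p q, p ≠ q ∧ Added (rowLen α) (rowLen β) p a ∧ Added (rowLen α) (rowLen β) q a

theorem exists_bottom {α β : List ℕ} {a : ℕ} (h : ∃ i, Added (rowLen α) (rowLen β) i a) :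
    ∃ q, Added (rowLen α) (rowLen β) q a ∧ ∀ i, Added (rowLen α) (rowLen β) i a → i ≤ q := by
  classical
  have hlt : ∀ i, Added (rowLen α) (rowLen β) i a → i < β.length := fun i hi =>
    lt_length_of_rowLen_pos (by have := hi.2; omega)
  obtain ⟨i, hi⟩ := h
  obtain ⟨q, hq, hmax⟩ := exists_max_image
    ((range β.length).filter fun i => Added (rowLen α) (rowLen β) i a) id
    ⟨i, by simpa using ⟨hlt i hi, hi⟩⟩
  simp only [mem_filter, mem_range, id] at hq hmax
  exact ⟨q, hq.2, fun i hi => hmax i ⟨hlt i hi, hi⟩⟩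

theorem set_set_eq {β : List ℕ} {p v : ℕ} (hv : rowLen β p = v) (hp : p < β.length) (u : ℕ) :
    (β.set p u).set p v = β := by
  rw [List.set_set, ← hv, rowLen, List.getD_eq_getElem _ _ hp, List.set_getElem_self]

theorem sum_set_add_one {γ : List ℕ} {p a : ℕ} (h : rowLen γ p = a) (hp : p < γ.length) :
    (γ.set p (a + 1)).sum = γ.sum + 1 := by
  rw [← h]
  exact sum_set_succ γ hp

theorem stripSign_add {α γ : List ℕ} {a q : ℕ} (hα : rowLen α q = a) (hγ : rowLen γ q = a)
    (hq : q < γ.length) (hne : ∃ i, rowLen α i < rowLen γ i) :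
    stripSign α (γ.set q (a + 1)) = -stripSign α γ := by
  have h1 : changedRows (rowLen α) (rowLen (γ.set q (a + 1))) (γ.set q (a + 1)).length =
      insert q (changedRows (rowLen α) (rowLen γ) γ.length) := by
    ext i
    simp only [changedRows, mem_filter, mem_range, mem_insert, List.length_set, rowLen_set hq,
      Function.update_apply]
    grind
  have h2 : q ∉ changedRows (rowLen α) (rowLen γ) γ.length := by
    simp [changedRows, hα, hγ]
  obtain ⟨i, hi⟩ := hne
  have h3 : 0 < (changedRows (rowLen α) (rowLen γ) γ.length).card :=
    card_pos.2 ⟨i, by simp [changedRows, hi, lt_length_of_rowLen_pos (by omega : 0 < rowLen γ i)]⟩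
  rw [stripSign, stripSign, h1, card_insert_of_notMem h2]
  obtain ⟨k, hk⟩ : ∃ k, (changedRows (rowLen α) (rowLen γ) γ.length).card = k + 1 :=
    ⟨_, (Nat.sub_add_cancel h3).symm⟩
  rw [hk]
  simp [pow_succ]

theorem IsStrip.exists_lt {a : ℕ} {x y : ℕ → ℕ} (h : IsStrip a x y) : ∃ i, x i < y i := by
  obtain ⟨i, h1, h2⟩ := h.least
  exact ⟨i, by omega⟩

theorem stripSign_long {α β : List ℕ} {a p : ℕ} (hα : rowLen α p = a) (hp : p < α.length)
    (hβ : a + 2 ≤ rowLen β p) : stripSign (α.set p (a + 1)) β = stripSign α β := by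
  rw [stripSign, stripSign]
  congr 3
  ext i
  simp only [changedRows, mem_filter, mem_range, rowLen_set hp, Function.update_apply]
  grind

theorem stripSign_both {α γ : List ℕ} {a p : ℕ} (hα : rowLen α p = a) (hp : p < α.length)
    (hγ : rowLen γ p = a) (hp' : p < γ.length) :
    stripSign (α.set p (a + 1)) (γ.set p (a + 1)) = stripSign α γ := by
  rw [stripSign, stripSign]
  congr 2
  rw [List.length_set]
  congr 1
  ext i
  simp only [changedRows, mem_filter, mem_range, rowLen_set hp, rowLen_set hp',
    Function.update_apply]
  grind

theorem optVec_apply (o : Option (List ℕ)) (β : List ℕ) [Decidable (o = some β)] :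
    optVec o β = if o = some β then 1 else 0 := by
  classical
  cases o
  · simp [optVec]
  · simp [optVec, Finsupp.single_apply]

theorem stepOp_apply (a : ℕ) (v : DiagramSpace) (β : List ℕ) :
    stepOp a v β = ∑ γ ∈ v.support, v γ * optVec (step a γ) β := by
  rw [stepOp, Finsupp.linearCombination_apply, Finsupp.sum, Finsupp.finsetSum_apply]
  rfl

theorem stepOp_apply_eq {a : ℕ} {v : DiagramSpace} {β γ : List ℕ} (h : step a γ = some β)
    (huniq : ∀ δ, step a δ = some β → v δ ≠ 0 → δ = γ) : stepOp a v β = v γ := by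
  classical
  rw [stepOp_apply, sum_eq_single γ]
  · simp [optVec_apply, h]
  · intro δ hδ hne
    rw [optVec_apply, if_neg, mul_zero]
    exact fun hs => hne (huniq δ hs (Finsupp.mem_support_iff.1 hδ))
  · intro hγ
    rw [Finsupp.notMem_support_iff.1 hγ, zero_mul]

theorem stepOp_apply_eq_zero {a : ℕ} {v : DiagramSpace} {β : List ℕ}
    (h : ∀ γ, step a γ = some β → v γ = 0) : stepOp a v β = 0 := by
  classical
  rw [stepOp_apply]
  refine sum_eq_zero fun γ _ => ?_
  rw [optVec_apply]
  split_ifs with hs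
  · rw [h γ hs, zero_mul]
  · rw [mul_zero]

open Classical in
/-- The coefficient of `β` in the part of the Murnaghan–Nakayama sum for `α` with leftmost column
`a`, when `β` has as many rows as `α`. -/
noncomputable def stripCoeff (a n : ℕ) (α β : List ℕ) : ℚ :=
  if EqStrip a n α β then stripSign α β else 0

theorem EqStrip.exists_top {a n : ℕ} (ha : 1 ≤ a) {α β : List ℕ} (h : EqStrip a n α β) :
    ∃ p, Leftmost a (rowLen α) p ∧ p < α.length ∧ p < β.length ∧
      Added (rowLen α) (rowLen β) p a := by
  obtain ⟨p, h1, h2, -⟩ := h.2.2.exists_top ha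
  have := h2.2
  have hp : p < β.length := lt_length_of_rowLen_pos (by omega)
  exact ⟨p, h1, by rw [h.1]; exact hp, hp, h2⟩

/-- If no column to the right of the leftmost one is occupied, there are no other boxes. -/
theorem IsStrip.col_empty {a : ℕ} {x y : ℕ → ℕ} (h : IsStrip a x y)
    (h0 : ∀ i, ¬ Added x y i (a + 1)) {i c : ℕ} (hi : Added x y i c) : c = a := by
  have key : ∀ d i, ¬ Added x y i (a + 1 + d) := by
    intro d
    induction d with
    | zero => exact h0
    | succ d ih =>
      intro i hi
      obtain ⟨j, hj⟩ := h.conn (a + 1 + d) (by omega) ⟨i, hi⟩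
      exact ih j hj
  by_contra hc
  have := h.ge i c hi
  exact key (c - a - 1) i (by rwa [show a + 1 + (c - a - 1) = c by omega])

theorem EqStrip.eq_set {a n : ℕ} {α β : List ℕ} (h : EqStrip a n α β) {p : ℕ}
    (hpα : p < α.length) (hp : Added (rowLen α) (rowLen β) p a)
    (huniq : ∀ i, Added (rowLen α) (rowLen β) i a → i = p)
    (h0 : ∀ i, ¬ Added (rowLen α) (rowLen β) i (a + 1)) : β = α.set p (a + 1) ∧ n = 1 := by
  have hα := h.2.2.eq_of_added hp
  have heq : rowLen β = Function.update (rowLen α) p (a + 1) := by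
    funext i
    have h1 := h.2.2.le i
    rw [Function.update_apply]
    split_ifs with hi
    · subst hi
      have := h0 i
      have := hp.2
      simp only [Added] at *
      omega
    · by_contra hne
      have h2 := h.2.2.col_empty h0 (i := i) (c := rowLen α i) ⟨le_rfl, by omega⟩
      exact hi (huniq i ⟨h2.le, by omega⟩)
  have hlen := h.1
  have hset : β = α.set p (a + 1) := by
    refine List.ext_getElem (by simp [hlen]) fun i h1 h2 => ?_
    have := congrFun heq i
    rw [← rowLen_set hpα, rowLen, rowLen, List.getD_eq_getElem _ _ h1,
      List.getD_eq_getElem _ _ h2] at this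
    exact this
  refine ⟨hset, ?_⟩
  have h1 := sum_set_add_one hα hpα
  rw [← hset, h.2.1] at h1
  omega

theorem eqStrip_one {a : ℕ} (ha : 1 ≤ a) {α : List ℕ} {p : ℕ} (hp : Leftmost a (rowLen α) p) :
    EqStrip a 1 α (α.set p (a + 1)) := by
  obtain ⟨h1, h2⟩ := hp
  have hpα : p < α.length := lt_length_of_rowLen_pos (by omega)
  refine ⟨by simp, sum_set_add_one h1 hpα, ?_⟩
  rw [rowLen_set hpα]
  have hadd : ∀ i c, Added (rowLen α) (Function.update (rowLen α) p (a + 1)) i c ↔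
      i = p ∧ c = a := by
    intro i c
    simp only [Added, Function.update_apply]
    grind
  refine ⟨?_, ⟨p, by simp [hadd]⟩, ?_, ?_, ?_, ?_, ?_, ?_⟩
  · intro i
    rw [Function.update_apply]
    split_ifs with hi
    · subst hi; omega
    · exact le_rfl
  all_goals simp only [hadd]
  · rintro i c ⟨-, rfl⟩
    exact le_rfl
  · rintro c hc ⟨i, -, hi⟩
    omega
  · rintro i j c hij hc ⟨rfl, rfl⟩ hi
    exact absurd hi (h2 i hij)
  · rintro i ⟨-, h⟩
    omega
  · rintro i c _ ⟨-, h3⟩ ⟨-, h4⟩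
    omega
  · rintro c ⟨i, -, h3⟩ ⟨j, -, h4⟩
    omega

theorem stripCoeff_one {a : ℕ} (ha : 1 ≤ a) (α β : List ℕ) :
    stripCoeff a 1 α β = optVec (step a α) β := by
  classical
  rw [stripCoeff, optVec_apply]
  have hiff : EqStrip a 1 α β ↔ step a α = some β := by
    rw [step_iff ha]
    constructor
    · intro h
      obtain ⟨p, hp, hpα, hpβ, hadd⟩ := h.exists_top ha
      refine ⟨p, hp, (eq_of_rowLen_le (by simp [h.1]) ?_ ?_).symm⟩
      · rw [sum_set_add_one hp.1 hpα, h.2.1]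
      · intro i
        have := h.2.2.le i
        have := hadd.2
        rw [rowLen_set hpα, Function.update_apply]
        split_ifs with hi
        · subst hi; omega
        · omega
    · rintro ⟨p, hp, rfl⟩
      exact eqStrip_one ha hp
  simp only [hiff]
  split_ifs with hs
  · obtain ⟨p, hp, rfl⟩ := (step_iff ha).1 hs
    have hpα : p < α.length := lt_length_of_rowLen_pos (by have := hp.1; omega)
    have h1 : changedRows (rowLen α) (rowLen (α.set p (a + 1))) (α.set p (a + 1)).length = {p} := by
      ext i
      have := hp.1
      simp only [changedRows, mem_filter, mem_range, rowLen_set hpα, Function.update_apply,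
        List.length_set, mem_singleton]
      grind
    rw [stripSign, h1]
    simp
  · rfl

/-- Adding a box in column `a` to a diagram that contains a strip with leftmost column `a`. -/
theorem EqStrip.of_step {a n : ℕ} (ha : 1 ≤ a) {α β γ : List ℕ} (hs : step a γ = some β)
    (h : EqStrip a n α γ) : EqStrip a (n + 1) α β ∧ HasTwo a α β ∧
      stripSign α β = -stripSign α γ ∧ ∃ q, (Added (rowLen α) (rowLen β) q a ∧
        ∀ i, Added (rowLen α) (rowLen β) i a → i ≤ q) ∧ γ = β.set q a := by
  obtain ⟨q, hq, rfl⟩ := (step_iff ha).1 hs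
  have hqγ : q < γ.length := lt_length_of_rowLen_pos (by have := hq.1; omega)
  obtain ⟨h1, h2, ⟨p, hpq, hp⟩, h3⟩ := h.2.2.add_bottom ha hq
  have hqa : Added (rowLen α) (Function.update (rowLen γ) q (a + 1)) q a :=
    ⟨h1.le, by simp⟩
  refine ⟨⟨by simp [h.1], ?_, ?_⟩, ⟨p, q, hpq, ?_⟩, stripSign_add h1 hq.1 hqγ h.2.2.exists_lt, q,
    ?_, ?_⟩
  · rw [sum_set_add_one hq.1 hqγ, h.2.1, add_assoc]
  · rwa [rowLen_set hqγ]
  · rw [rowLen_set hqγ]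
    exact ⟨hp, hqa⟩
  · rw [rowLen_set hqγ]
    exact ⟨hqa, h3⟩
  · rw [set_set_eq hq.1 hqγ]

/-- Adding a box in column `a` to a diagram that contains a strip with leftmost column `a + 1`. -/
theorem EqStrip.of_step_succ {a n : ℕ} (ha : 1 ≤ a) {α β γ : List ℕ} (hs : step a γ = some β)
    (h : EqStrip (a + 1) n α γ) : ∃ p, Leftmost a (rowLen α) p ∧ rowLen β p = a + 1 ∧
      γ = β.set p a ∧ ((EqStrip a (n + 1) α β ∧ ¬ HasTwo a α β) ∨
        EqStrip (a + 1) n (α.set p (a + 1)) β) := by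
  obtain ⟨p, hp, rfl⟩ := (step_iff ha).1 hs
  have hpγ : p < γ.length := lt_length_of_rowLen_pos (by have := hp.1; omega)
  have hpα := h.2.2.leftmost_of_leftmost hp
  have hpα' : p < α.length := by rw [h.1]; exact hpγ
  refine ⟨p, hpα, by rw [rowLen_set hpγ]; simp, by rw [set_set_eq hp.1 hpγ], ?_⟩
  by_cases hi : ∃ i, p < i ∧ Added (rowLen α) (rowLen γ) i (a + 1)
  · left
    obtain ⟨h1, h2, h3⟩ := h.2.2.add_short hp hi
    refine ⟨⟨by simp [h.1], by rw [sum_set_add_one hp.1 hpγ, h.2.1, add_assoc],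
      by rwa [rowLen_set hpγ]⟩, ?_⟩
    rintro ⟨q, r, hqr, hq, hr⟩
    rw [rowLen_set hpγ] at hq hr
    exact hqr ((h3 q hq).trans (h3 r hr).symm)
  · right
    refine ⟨by simp [h.1], ?_, ?_⟩
    · rw [sum_set_add_one hp.1 hpγ, h.2.1, sum_set_add_one hpα.1 hpα']
      omega
    · rw [rowLen_set hpγ, rowLen_set hpα']
      refine h.2.2.add_before hp fun i hi' => ?_
      by_contra hip
      rcases (not_lt.1 hip).lt_or_eq with h1 | rfl
      · exact hi ⟨i, h1, hi'⟩
      · have := hi'.2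
        have := hp.1
        omega

/-- The recursion for the part of the power sum with least letter `a`, on the side of strips. -/
theorem stripCoeff_succ {a n : ℕ} (ha : 1 ≤ a) (hn : 1 ≤ n) {α : List ℕ} {v₁ v₂ v₃ : DiagramSpace}
    (h₁ : ∀ γ, v₁ γ = stripCoeff a n α γ)
    (h₂ : ∀ γ, v₂ γ = match step a α with
      | none => 0
      | some α' => stripCoeff (a + 1) n α' γ)
    (h₃ : ∀ γ, v₃ γ = stripCoeff (a + 1) n α γ) (β : List ℕ) :
    stripCoeff a (n + 1) α β = -stepOp a v₁ β + (v₂ β - stepOp a v₃ β) := by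
  classical
  have hv₁ : ∀ γ, v₁ γ ≠ 0 → EqStrip a n α γ := fun γ hγ => by
    by_contra hc
    exact hγ (by rw [h₁, stripCoeff, if_neg hc])
  have hv₃ : ∀ γ, v₃ γ ≠ 0 → EqStrip (a + 1) n α γ := fun γ hγ => by
    by_contra hc
    exact hγ (by rw [h₃, stripCoeff, if_neg hc])
  have hv₂ : ∀ p, Leftmost a (rowLen α) p → v₂ β = stripCoeff (a + 1) n (α.set p (a + 1)) β := by
    intro p hp
    rw [h₂, (step_iff ha).2 ⟨p, hp, rfl⟩]
  have hv₂' : v₂ β ≠ 0 → ∃ p, Leftmost a (rowLen α) p ∧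
      EqStrip (a + 1) n (α.set p (a + 1)) β := by
    intro h
    rw [h₂] at h
    rcases hs : step a α with _ | α'
    · simp [hs] at h
    · obtain ⟨p, hp, rfl⟩ := (step_iff ha).1 hs
      refine ⟨p, hp, ?_⟩
      by_contra hc
      simp [hs, stripCoeff, hc] at h
  by_cases hstrip : EqStrip a (n + 1) α β
  · rw [stripCoeff, if_pos hstrip]
    obtain ⟨p, hpl, hpα, hpβ, hp⟩ := hstrip.exists_top ha
    have hxp := hpl.1
    by_cases htwo : HasTwo a α β
    · -- only the bottommost box of column `a` can be the last one
      obtain ⟨r, s, hrs, hr, hs⟩ := htwo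
      have hlong : ∀ p, Leftmost a (rowLen α) p → ¬ EqStrip (a + 1) n (α.set p (a + 1)) β := by
        intro p hp h
        have hpα : p < α.length := lt_length_of_rowLen_pos (by have := hp.1; omega)
        have key : ∀ i, Added (rowLen α) (rowLen β) i a → i = p := by
          intro i hi
          by_contra hne
          have := h.2.2.ge i a (by
            rw [rowLen_set hpα, Added, Function.update_of_ne hne]; exact hi)
          omega
        exact hrs ((key r hr).trans (key s hs).symm)
      obtain ⟨q, hq, hbot⟩ := exists_bottom ⟨p, hp⟩
      have hpq : ∃ p', p' ≠ q ∧ Added (rowLen α) (rowLen β) p' a := by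
        by_cases hrq : r = q
        · exact ⟨s, fun h => hrs (hrq.trans h.symm), hs⟩
        · exact ⟨r, hrq, hr⟩
      obtain ⟨p', hp'q, hp'⟩ := hpq
      have hqβ : q < β.length := lt_length_of_rowLen_pos (by have := hq.2; omega)
      obtain ⟨h4, h5, h6, h7⟩ := hstrip.2.2.remove_bottom ha hp' hq hbot hp'q
      rw [← rowLen_set hqβ] at h6 h7
      have hst : step a (β.set q a) = some β :=
        (step_iff ha).2 ⟨q, h7, (set_set_eq h4 hqβ a).symm⟩
      have hγ : EqStrip a n α (β.set q a) := by
        refine ⟨by simp [hstrip.1], ?_, h6⟩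
        have := sum_of_step hst
        have := hstrip.2.1
        omega
      have e1 : stepOp a v₁ β = -stripSign α β := by
        rw [stepOp_apply_eq hst, h₁, stripCoeff, if_pos hγ, (hγ.of_step ha hst).2.2.1, neg_neg]
        intro δ hδ hvδ
        obtain ⟨-, -, -, q', ⟨hq', hbot'⟩, rfl⟩ := (hv₁ δ hvδ).of_step ha hδ
        rw [le_antisymm (hbot q' hq') (hbot' q hq)]
      have e2 : v₂ β = 0 := by
        by_contra hne
        obtain ⟨p, hp, h⟩ := hv₂' hne
        exact hlong p hp h
      have e3 : stepOp a v₃ β = 0 := by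
        refine stepOp_apply_eq_zero fun γ hγ => ?_
        by_contra hne
        obtain ⟨p, hp, -, -, ⟨-, h⟩ | h⟩ := (hv₃ γ hne).of_step_succ ha hγ
        · exact h ⟨r, s, hrs, hr, hs⟩
        · exact hlong p hp h
      rw [e1, e2, e3]
      ring
    · have huniq : ∀ i, Added (rowLen α) (rowLen β) i a → i = p := by
        intro i hi
        by_contra hne
        exact htwo ⟨i, p, hne, hi, hp⟩
      have e1 : stepOp a v₁ β = 0 := by
        refine stepOp_apply_eq_zero fun γ hγ => ?_
        by_contra hne
        exact htwo ((hv₁ γ hne).of_step ha hγ).2.1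
      by_cases hlong : a + 2 ≤ rowLen β p
      · -- the box in column `a` was the first one, and its row was extended later
        have h4 : EqStrip (a + 1) n (α.set p (a + 1)) β := by
          refine ⟨by simp [hstrip.1], ?_, ?_⟩
          · rw [sum_set_add_one hxp hpα, hstrip.2.1]
            omega
          · rw [rowLen_set hpα]
            exact hstrip.2.2.remove_long ha hp huniq hlong
        have e2 : v₂ β = stripSign α β := by
          rw [hv₂ p hpl, stripCoeff, if_pos h4, stripSign_long hxp hpα hlong]
        have e3 : stepOp a v₃ β = 0 := by
          refine stepOp_apply_eq_zero fun γ hγ => ?_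
          by_contra hne
          obtain ⟨p', hp', h5, -⟩ := (hv₃ γ hne).of_step_succ ha hγ
          rw [hp'.unique hpl] at h5
          omega
        rw [e1, e2, e3]
        ring
      · -- the box in column `a` was the last one
        have hyp : rowLen β p = a + 1 := by
          have := hp.2
          omega
        have hne : ∃ i, Added (rowLen α) (rowLen β) i (a + 1) := by
          by_contra hno
          have := (hstrip.eq_set hpα hp huniq (not_exists.1 hno)).2
          omega
        obtain ⟨h4, h5, i₀, h6, h7⟩ := hstrip.2.2.remove_short ha hp hpl huniq hyp hne
        have e2 : v₂ β = 0 := by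
          by_contra hne
          obtain ⟨p', hp', h8⟩ := hv₂' hne
          obtain rfl := hp'.unique hpl
          have h9 := h8.2.2
          rw [rowLen_set hpα] at h9
          have := (h9.add_after hpl hyp).2.2 i₀ h7
          omega
        rw [← rowLen_set hpβ] at h4 h5
        have hst : step a (β.set p a) = some β :=
          (step_iff ha).2 ⟨p, h5, (set_set_eq hyp hpβ a).symm⟩
        have hγ : EqStrip (a + 1) n α (β.set p a) := by
          refine ⟨by simp [hstrip.1], ?_, h4⟩
          have := sum_of_step hst
          have := hstrip.2.1
          omega
        have e3 : stepOp a v₃ β = -stripSign α β := by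
          have hsg := stripSign_add hxp h5.1 (by simpa using hpβ) h4.exists_lt
          rw [set_set_eq hyp hpβ] at hsg
          rw [stepOp_apply_eq hst, h₃, stripCoeff, if_pos hγ, hsg, neg_neg]
          intro δ hδ hvδ
          obtain ⟨p', hp', -, rfl, -⟩ := (hv₃ δ hvδ).of_step_succ ha hδ
          rw [hp'.unique hpl]
        rw [e1, e2, e3]
        ring
  · rw [stripCoeff, if_neg hstrip]
    have e1 : stepOp a v₁ β = 0 := by
      refine stepOp_apply_eq_zero fun γ hγ => ?_
      by_contra hne
      exact hstrip ((hv₁ γ hne).of_step ha hγ).1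
    by_cases hv : v₂ β = 0
    · have e3 : stepOp a v₃ β = 0 := by
        refine stepOp_apply_eq_zero fun γ hγ => ?_
        by_contra hne
        obtain ⟨p, hp, h5, rfl, ⟨h6, -⟩ | h6⟩ := (hv₃ γ hne).of_step_succ ha hγ
        · exact hstrip h6
        · rw [hv₂ p hp, stripCoeff, if_pos h6, stripSign] at hv
          exact absurd hv (pow_ne_zero _ (by norm_num))
      rw [e1, e3, hv]
      ring
    · -- the box in column `a` can be added before or after the strip: the terms cancel
      obtain ⟨p, hpl, h4⟩ := hv₂' hv
      have hxp := hpl.1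
      have hpα : p < α.length := lt_length_of_rowLen_pos (by omega)
      have hpβ : p < β.length := by
        have := h4.1
        rw [List.length_set] at this
        omega
      have h5 := h4.2.2
      rw [rowLen_set hpα] at h5
      have hyp : rowLen β p = a + 1 := by
        by_contra hne
        have h6 := h5.le p
        rw [Function.update_self] at h6
        refine hstrip ⟨by simpa using h4.1, ?_, (IsStrip.add_long hpl h5 (by omega)).1⟩
        rw [h4.2.1, sum_set_add_one hxp hpα]
        omega
      obtain ⟨h6, h7, -⟩ := h5.add_after hpl hyp
      rw [← rowLen_set hpβ] at h6 h7
      have hst : step a (β.set p a) = some β :=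
        (step_iff ha).2 ⟨p, h7, (set_set_eq hyp hpβ a).symm⟩
      have hγ : EqStrip (a + 1) n α (β.set p a) := by
        refine ⟨by simpa using h4.1, ?_, h6⟩
        have h8 := sum_of_step hst
        have h9 := h4.2.1
        rw [sum_set_add_one hxp hpα] at h9
        omega
      have e3 : stepOp a v₃ β = v₂ β := by
        have hsg := stripSign_both hxp hpα h7.1 (by simpa using hpβ)
        rw [set_set_eq hyp hpβ] at hsg
        rw [stepOp_apply_eq hst, h₃, stripCoeff, if_pos hγ, hv₂ p hpl, stripCoeff, if_pos h4, hsg]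
        intro δ hδ hvδ
        obtain ⟨p', hp', -, rfl, -⟩ := (hv₃ δ hvδ).of_step_succ ha hδ
        rw [hp'.unique hpl]
      rw [e1, e3]
      ring

theorem boxOp_single {N a : ℕ} (ha : a < N) (α : List ℕ) :
    boxOp N a (Finsupp.single α 1) = optVec (step a α) := by
  rw [boxOp, if_pos ha, stepOp_single]

theorem EqStrip.lt_sum {a n : ℕ} {α β : List ℕ} (h : EqStrip a n α β) : a < α.sum + n := by
  obtain ⟨i, -, hi⟩ := h.2.2.least
  have := List.le_sum_of_mem (getD_mem (lt_length_of_rowLen_pos (by omega : 0 < rowLen β i)))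
  rw [h.2.1] at this
  exact hi.trans_le this

theorem leastLetterSum_apply {N n a : ℕ} (ha : 1 ≤ a) {α : List ℕ} (hN : α.sum + (n + 1) ≤ N)
    (β : List ℕ) :
    leastLetterSum (boxOp N) (n + 1) a (Finsupp.single α 1) β = stripCoeff a (n + 1) α β := by
  induction n generalizing a α β with
  | zero =>
    by_cases haN : a < N
    · rw [zero_add, leastLetterSum, boxOp_single haN, stripCoeff_one ha]
    · rw [leastLetterSum_eq_zero boxOp_eq_zero _ (not_lt.1 haN), stripCoeff, if_neg]
      · rfl
      · intro h
        have := h.lt_sum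
        omega
  | succ n ih =>
    by_cases haN : a < N
    · have hop : boxOp N a = stepOp a := if_pos haN
      rw [stripCoeff_succ ha (by omega)
        (v₁ := leastLetterSum (boxOp N) (n + 1) a (Finsupp.single α 1))
        (v₂ := leastLetterSum (boxOp N) (n + 1) (a + 1) (optVec (step a α)))
        (v₃ := leastLetterSum (boxOp N) (n + 1) (a + 1) (Finsupp.single α 1))
        (ih ha (by omega)) ?_ (ih (by omega) (by omega)), leastLetterSum]
      · simp only [LinearMap.add_apply, LinearMap.sub_apply, LinearMap.neg_apply,
          Module.End.mul_apply, Finsupp.add_apply, Finsupp.sub_apply, Finsupp.neg_apply,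
          boxOp_single haN]
        rw [hop]
      · intro γ
        rcases hs : step a α with _ | α'
        · simp [optVec]
        · have := sum_of_step hs
          exact ih (by omega) (by omega) γ
    · rw [leastLetterSum_eq_zero boxOp_eq_zero _ (not_lt.1 haN), stripCoeff, if_neg]
      · rfl
      · intro h
        have := h.lt_sum
        omega

/-! ### The action of the power sums including the first column -/

/-- The diagram `α`, with empty rows on top so that it has as many rows as `β`. -/
def padded (α β : List ℕ) : List ℕ := List.replicate (β.length - α.length) 0 ++ α

theorem padded_of_length_eq {α β : List ℕ} (h : α.length = β.length) : padded α β = α := by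
  simp [padded, h]

theorem padded_cons {α β : List ℕ} (h : α.length ≤ β.length) (b : ℕ) :
    padded α (b :: β) = 0 :: padded α β := by
  rw [padded, List.length_cons, Nat.succ_sub h, List.replicate_succ, List.cons_append, padded]

theorem length_padded {α β : List ℕ} (h : α.length ≤ β.length) :
    (padded α β).length = β.length := by
  simp [padded, h]

theorem sum_padded (α β : List ℕ) : (padded α β).sum = α.sum := by
  simp [padded]

theorem padded_pos_of_le {α β : List ℕ} (hα : ∀ b ∈ α, 0 < b) {i : ℕ}
    (h : β.length - α.length ≤ i) (hi : i < β.length) : 0 < rowLen (padded α β) i := by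
  rw [rowLen, padded, List.getD_append_right _ _ _ _ (by simpa using h)]
  exact hα _ (getD_mem (by simp; omega))

theorem padded_eq_zero {α β : List ℕ} {i : ℕ} (h : i < β.length - α.length) :
    rowLen (padded α β) i = 0 := by
  rw [rowLen, padded, List.getD_append _ _ _ _ (by simpa using h)]
  simp [h]

theorem pos_of_le {α β : List ℕ} (hlen : α.length = β.length) (hα : ∀ b ∈ α, 0 < b)
    (h : ∀ i, rowLen α i ≤ rowLen β i) : ∀ b ∈ β, 0 < b := by
  intro b hb
  obtain ⟨i, hi, rfl⟩ := List.getElem_of_mem hb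
  have h1 := h i
  have h2 : 0 < rowLen α i := hα _ (getD_mem (by omega))
  rw [rowLen, rowLen, List.getD_eq_getElem _ _ hi] at h1
  rw [rowLen] at h2
  omega

/-- The shape between the diagrams `α` and `β`, bottom-aligned, is a strip of size `n` with leftmost
column `a`. -/
def SkewStrip (a n : ℕ) (α β : List ℕ) : Prop :=
  (∀ b ∈ β, 0 < b) ∧ β.sum = α.sum + n ∧ α.length ≤ β.length ∧
    IsStrip a (rowLen (padded α β)) (rowLen β)

open Classical in
/-- The coefficient of `β` in the part of the Murnaghan–Nakayama sum for `α` with leftmost column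
`a`. -/
noncomputable def skewCoeff (a n : ℕ) (α β : List ℕ) : ℚ :=
  if SkewStrip a n α β then stripSign (padded α β) β else 0

theorem skewStrip_iff {a n : ℕ} (ha : 1 ≤ a) {α β : List ℕ} (hα : ∀ b ∈ α, 0 < b) :
    SkewStrip a n α β ↔ EqStrip a n α β := by
  constructor
  · rintro ⟨h1, h2, h3, h4⟩
    have hlen : α.length = β.length := by
      by_contra hne
      have h0 : rowLen (padded α β) 0 = 0 := padded_eq_zero (by omega)
      have := h4.ge 0 0 ⟨h0.le, h1 _ (getD_mem (by omega))⟩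
      omega
    rw [padded_of_length_eq hlen] at h4
    exact ⟨hlen, h2, h4⟩
  · rintro ⟨hlen, h2, h4⟩
    refine ⟨pos_of_le hlen hα h4.le, h2, hlen.le, ?_⟩
    rwa [padded_of_length_eq hlen]

theorem skewCoeff_eq {a n : ℕ} (ha : 1 ≤ a) {α : List ℕ} (hα : ∀ b ∈ α, 0 < b) (β : List ℕ) :
    skewCoeff a n α β = stripCoeff a n α β := by
  classical
  rw [skewCoeff, stripCoeff]
  simp only [skewStrip_iff ha hα]
  split_ifs with h
  · rw [padded_of_length_eq h.1]
  · rfl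

theorem SkewStrip.length_lt {n : ℕ} {α β : List ℕ} (hα : ∀ b ∈ α, 0 < b)
    (h : SkewStrip 0 n α β) : α.length < β.length := by
  obtain ⟨i, hi, hi'⟩ := h.2.2.2.least
  by_contra hlt
  have := padded_pos_of_le (β := β) hα (i := i) (by omega) (lt_length_of_rowLen_pos (by omega))
  omega

theorem card_changedRows_cons (a b L : ℕ) (A B : List ℕ) :
    (changedRows (rowLen (a :: A)) (rowLen (b :: B)) (L + 1)).card =
      (changedRows (rowLen A) (rowLen B) L).card + if a < b then 1 else 0 := by
  simp only [changedRows, card_filter]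
  rw [sum_range_succ']
  rfl

section FirstColumn

variable {A B : List ℕ} {b : ℕ}

/-- Remove the topmost of several boxes in the first column. -/
theorem IsStrip.remove_row (hb : 0 < b) (h0 : Added (rowLen A) (rowLen B) 0 0)
    (h : IsStrip 0 (rowLen (0 :: A)) (rowLen (b :: B))) :
    b = 1 ∧ IsStrip 0 (rowLen A) (rowLen B) := by
  have hb1 : b = 1 := by
    by_contra hne
    have := h.first 0 ⟨le_rfl, hb⟩ ⟨by simp [rowLen], by simp [rowLen]; omega⟩ 1 h0
    omega
  subst hb1
  have hrow : ∀ c, Added (rowLen (0 :: A)) (rowLen (1 :: B)) 0 c → c = 0 := by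
    rintro c ⟨-, hc⟩
    simpa [rowLen] using hc
  refine ⟨rfl, ⟨fun i => h.le (i + 1), ⟨0, h0⟩, fun i c _ => Nat.zero_le c, ?_, ?_, ?_, ?_, ?_⟩⟩
  · rintro c - ⟨i, hi⟩
    obtain ⟨j, hj⟩ := h.conn c (Nat.zero_le c) ⟨i + 1, hi⟩
    rcases j with _ | j
    · rw [hrow c hj]
      exact ⟨0, h0⟩
    · exact ⟨j, hj⟩
  · exact fun i j c hij hc hj hi => h.left (i + 1) (j + 1) c (by omega) hc hj hi
  · intro i h1 h2 i' h3
    have := h.first (i + 1) h1 h2 (i' + 1) h3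
    omega
  · intro i c hc h1 h2 i' h3
    have := h.other (i + 1) c hc h1 h2 (i' + 1) h3
    omega
  · rintro c ⟨i, hi⟩ ⟨j, hj⟩
    obtain ⟨i₁, i₂, h1, h2, h3⟩ := h.notNE c ⟨i + 1, hi⟩ ⟨j + 1, hj⟩
    rcases i₁ with _ | i₁
    · have := hrow _ h1
      omega
    · rcases i₂ with _ | i₂
      · have hc := hrow _ h2
        subst hc
        exact ⟨i₁, 0, h1, h0, Nat.zero_le _⟩
      · exact ⟨i₁, i₂, h1, h2, by omega⟩

theorem IsStrip.add_row (h0 : Added (rowLen A) (rowLen B) 0 0)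
    (h : IsStrip 0 (rowLen A) (rowLen B)) : IsStrip 0 (rowLen (0 :: A)) (rowLen (1 :: B)) := by
  have hrow : ∀ c, Added (rowLen (0 :: A)) (rowLen (1 :: B)) 0 c → c = 0 := by
    rintro c ⟨-, hc⟩
    simpa [rowLen] using hc
  have h00 : Added (rowLen (0 :: A)) (rowLen (1 :: B)) 0 0 := ⟨le_rfl, Nat.one_pos⟩
  refine ⟨?_, ⟨0, h00⟩, fun i c _ => Nat.zero_le c, ?_, ?_, ?_, ?_, ?_⟩
  · rintro (_ | i)
    · exact Nat.zero_le _
    · exact h.le i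
  · rintro c - ⟨_ | i, hi⟩
    · have := hrow _ hi
      omega
    · obtain ⟨j, hj⟩ := h.conn c (Nat.zero_le c) ⟨i, hi⟩
      exact ⟨j + 1, hj⟩
  · rintro (_ | i) (_ | j) c hij hc hj hi
    · omega
    · have : c = 0 := hi.symm
      omega
    · omega
    · exact h.left i j c (by omega) hc hj hi
  · rintro (_ | i) h1 h2 (_ | i') h3
    · omega
    · have := hrow _ h2
      omega
    · omega
    · have := h.first i h1 h2 i' h3
      omega
  · rintro (_ | i) c hc h1 h2 (_ | i') h3
    · omega
    · omega
    · have := hrow _ h3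
      omega
    · have := h.other i c hc h1 h2 i' h3
      omega
  · rintro c ⟨i, hi⟩ ⟨_ | j, hj⟩
    · have := hrow _ hj
      omega
    · have hex : ∃ i, Added (rowLen A) (rowLen B) i c := by
        rcases i with _ | i
        · rw [hrow _ hi]
          exact ⟨0, h0⟩
        · exact ⟨i, hi⟩
      obtain ⟨i₁, i₂, h1, h2, h3⟩ := h.notNE c hex ⟨j, hj⟩
      exact ⟨i₁ + 1, i₂ + 1, h1, h2, by omega⟩

/-- A strip with one box in the first column, whose row extends further. -/
theorem isStrip_row_long (hA : ∀ i c, Added (rowLen A) (rowLen B) i c → 1 ≤ c) (hb : 2 ≤ b) :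
    IsStrip 0 (rowLen (0 :: A)) (rowLen (b :: B)) ↔
      IsStrip 1 (rowLen (1 :: A)) (rowLen (b :: B)) := by
  have hadd : ∀ i c, Added (rowLen (1 :: A)) (rowLen (b :: B)) i c ↔
      Added (rowLen (0 :: A)) (rowLen (b :: B)) i c ∧ 1 ≤ c := by
    rintro (_ | i) c
    · simp [Added, rowLen]
      omega
    · exact ⟨fun h => ⟨h, hA i c h⟩, fun h => h.1⟩
  have h00 : Added (rowLen (0 :: A)) (rowLen (b :: B)) 0 0 := ⟨le_rfl, by simp [rowLen]; omega⟩
  have h01 : Added (rowLen (0 :: A)) (rowLen (b :: B)) 0 1 :=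
    ⟨by simp [rowLen], by simp [rowLen]; omega⟩
  have hz : ∀ i, Added (rowLen (0 :: A)) (rowLen (b :: B)) i 0 → i = 0 := by
    rintro (_ | i) hi
    · rfl
    · have := hA i 0 hi
      omega
  constructor
  · intro h
    refine ⟨?_, ⟨0, (hadd _ _).2 ⟨h01, le_rfl⟩⟩, fun i c hi => ((hadd _ _).1 hi).2, ?_, ?_, ?_, ?_, ?_⟩
    · rintro (_ | i)
      · change 1 ≤ b
        omega
      · exact h.le (i + 1)
    · rintro c hc ⟨i, hi⟩
      obtain ⟨j, hj⟩ := h.conn c (by omega) ⟨i, ((hadd _ _).1 hi).1⟩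
      exact ⟨j, (hadd _ _).2 ⟨hj, hc⟩⟩
    · rintro (_ | i) j c hij hc hj hi
      · have : 1 = c := hi
        subst this
        change 1 < b
        omega
      · exact h.left (i + 1) j c hij hc ((hadd _ _).1 hj).1 hi
    · intro i hi
      have := ((hadd _ _).1 hi).2
      omega
    · intro i c hc h1 h2 i' h3
      exact h.other i c hc ((hadd _ _).1 h1).1 ((hadd _ _).1 h2).1 i' ((hadd _ _).1 h3).1
    · rintro c ⟨i, hi⟩ ⟨j, hj⟩
      have hc := ((hadd _ _).1 hi).2
      obtain ⟨i₁, i₂, h1, h2, h3⟩ :=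
        h.notNE c ⟨i, ((hadd _ _).1 hi).1⟩ ⟨j, ((hadd _ _).1 hj).1⟩
      exact ⟨i₁, i₂, (hadd _ _).2 ⟨h1, by omega⟩, (hadd _ _).2 ⟨h2, hc⟩, h3⟩
  · intro h
    refine ⟨?_, ⟨0, h00⟩, fun i c _ => Nat.zero_le c, ?_, ?_, ?_, ?_, ?_⟩
    · rintro (_ | i)
      · exact Nat.zero_le _
      · exact h.le (i + 1)
    · rintro c - ⟨i, hi⟩
      rcases Nat.eq_zero_or_pos c with rfl | hc
      · exact ⟨0, h00⟩
      · obtain ⟨j, hj⟩ := h.conn c hc ⟨i, (hadd _ _).2 ⟨hi, by omega⟩⟩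
        exact ⟨j, ((hadd _ _).1 hj).1⟩
    · rintro (_ | i) j c hij hc hj hi
      · have : 0 = c := hi
        omega
      · exact h.left (i + 1) j c hij hc ((hadd _ _).2 ⟨hj, hc⟩) hi
    · intro i h1 _ i' h3
      rw [hz _ h1, hz _ h3]
    · intro i c hc h1 h2 i' h3
      exact h.other i c hc ((hadd _ _).2 ⟨h1, hc⟩) ((hadd _ _).2 ⟨h2, by omega⟩) i'
        ((hadd _ _).2 ⟨h3, hc⟩)
    · rintro c ⟨i, hi⟩ ⟨j, hj⟩
      rcases Nat.eq_zero_or_pos c with rfl | hc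
      · exact ⟨0, 0, h01, h00, le_rfl⟩
      · obtain ⟨i₁, i₂, h1, h2, h3⟩ :=
          h.notNE c ⟨i, (hadd _ _).2 ⟨hi, hc⟩⟩ ⟨j, (hadd _ _).2 ⟨hj, by omega⟩⟩
        exact ⟨i₁, i₂, ((hadd _ _).1 h1).1, ((hadd _ _).1 h2).1, h3⟩

/-- A strip with one box in the first column, whose row does not extend further. -/
theorem isStrip_row_short (hA : ∀ i c, Added (rowLen A) (rowLen B) i c → 1 ≤ c)
    (hne : ∃ i, rowLen A i < rowLen B i) :
    IsStrip 0 (rowLen (0 :: A)) (rowLen (1 :: B)) ↔ IsStrip 1 (rowLen A) (rowLen B) := by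
  have hrow : ∀ c, Added (rowLen (0 :: A)) (rowLen (1 :: B)) 0 c → c = 0 := by
    rintro c ⟨-, hc⟩
    simpa [rowLen] using hc
  have h00 : Added (rowLen (0 :: A)) (rowLen (1 :: B)) 0 0 := ⟨le_rfl, Nat.one_pos⟩
  have hpos : ∀ i c, 1 ≤ c → Added (rowLen (0 :: A)) (rowLen (1 :: B)) i c →
      ∃ j, i = j + 1 ∧ Added (rowLen A) (rowLen B) j c := by
    rintro (_ | i) c hc hi
    · have := hrow _ hi
      omega
    · exact ⟨i, rfl, hi⟩
  have hz : ∀ i, Added (rowLen (0 :: A)) (rowLen (1 :: B)) i 0 → i = 0 := by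
    rintro (_ | i) hi
    · rfl
    · have := hA i 0 hi
      omega
  constructor
  · intro h
    have hone : ∃ i, Added (rowLen A) (rowLen B) i 1 := by
      by_contra hno
      obtain ⟨i, hi⟩ := hne
      have hadd : Added (rowLen A) (rowLen B) i (rowLen A i) := ⟨le_rfl, hi⟩
      have := hA _ _ hadd
      have := h.col_empty (i := i + 1) (c := rowLen A i) (fun j hj => by
        obtain ⟨k, -, hk⟩ := hpos _ _ le_rfl hj
        exact hno ⟨k, hk⟩) hadd
      omega
    refine ⟨fun i => h.le (i + 1), hone, hA, ?_, ?_, ?_, ?_, ?_⟩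
    · rintro c hc ⟨i, hi⟩
      obtain ⟨j, hj⟩ := h.conn c (by omega) ⟨i + 1, hi⟩
      obtain ⟨k, -, hk⟩ := hpos _ _ hc hj
      exact ⟨k, hk⟩
    · exact fun i j c hij hc hj hi => h.left (i + 1) (j + 1) c (by omega) hc hj hi
    · intro i hi
      have := hA _ _ hi
      omega
    · intro i c hc h1 h2 i' h3
      have := h.other (i + 1) c hc h1 h2 (i' + 1) h3
      omega
    · rintro c ⟨i, hi⟩ ⟨j, hj⟩
      obtain ⟨i₁, i₂, h1, h2, h3⟩ := h.notNE c ⟨i + 1, hi⟩ ⟨j + 1, hj⟩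
      obtain ⟨k₁, rfl, hk₁⟩ := hpos _ _ (by omega) h1
      obtain ⟨k₂, rfl, hk₂⟩ := hpos _ _ (hA _ _ hi) h2
      exact ⟨k₁, k₂, hk₁, hk₂, by omega⟩
  · intro h
    refine ⟨?_, ⟨0, h00⟩, fun i c _ => Nat.zero_le c, ?_, ?_, ?_, ?_, ?_⟩
    · rintro (_ | i)
      · exact Nat.zero_le _
      · exact h.le i
    · rintro c - ⟨i, hi⟩
      rcases Nat.eq_zero_or_pos c with rfl | hc
      · exact ⟨0, h00⟩
      · obtain ⟨k, -, hk⟩ := hpos _ _ (by omega) hi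
        obtain ⟨j, hj⟩ := h.conn c hc ⟨k, hk⟩
        exact ⟨j + 1, hj⟩
    · rintro (_ | i) (_ | j) c hij hc hj hi
      · omega
      · have : 0 = c := hi
        omega
      · omega
      · exact h.left i j c (by omega) hc hj hi
    · intro i h1 _ i' h3
      rw [hz _ h1, hz _ h3]
    · intro i c hc h1 h2 i' h3
      obtain ⟨k₁, rfl, hk₁⟩ := hpos _ _ hc h1
      obtain ⟨k₃, rfl, hk₃⟩ := hpos _ _ hc h3
      have := h.other k₁ c hc hk₁ h2 k₃ hk₃
      omega
    · rintro c ⟨i, hi⟩ ⟨j, hj⟩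
      obtain ⟨k, -, hk⟩ := hpos _ _ (by omega) hj
      rcases Nat.eq_zero_or_pos c with rfl | hc
      · exact ⟨k + 1, 0, hk, h00, Nat.zero_le _⟩
      · obtain ⟨l, -, hl⟩ := hpos _ _ hc hi
        obtain ⟨i₁, i₂, h1, h2, h3⟩ := h.notNE c ⟨l, hl⟩ ⟨k, hk⟩
        exact ⟨i₁ + 1, i₂ + 1, h1, h2, by omega⟩

end FirstColumn

theorem stepOp_zero_cons (v : DiagramSpace) (b : ℕ) (B : List ℕ) :
    stepOp 0 v (b :: B) = if b = 1 then v B else 0 := by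
  split_ifs with hb
  · subst hb
    refine stepOp_apply_eq rfl fun δ hδ _ => ?_
    simpa [step] using hδ
  · refine stepOp_apply_eq_zero fun γ hγ => ?_
    simp only [step, Option.some.injEq, List.cons.injEq] at hγ
    exact absurd hγ.1.symm hb

theorem stepOp_zero_nil (v : DiagramSpace) : stepOp 0 v [] = 0 :=
  stepOp_apply_eq_zero fun γ hγ => by simp [step] at hγ

theorem stripSign_cons {A B : List ℕ} {a b : ℕ} (hab : a < b)
    (hne : ∃ i, rowLen A i < rowLen B i) : stripSign (a :: A) (b :: B) = -stripSign A B := by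
  obtain ⟨i, hi⟩ := hne
  have h3 : 0 < (changedRows (rowLen A) (rowLen B) B.length).card :=
    card_pos.2 ⟨i, by simp [changedRows, hi, lt_length_of_rowLen_pos (by omega : 0 < rowLen B i)]⟩
  rw [stripSign, stripSign, List.length_cons, card_changedRows_cons, if_pos hab]
  obtain ⟨k, hk⟩ : ∃ k, (changedRows (rowLen A) (rowLen B) B.length).card = k + 1 :=
    ⟨_, (Nat.sub_add_cancel h3).symm⟩
  rw [hk]
  simp [pow_succ]

theorem skewCoeff_nil (n : ℕ) (α : List ℕ) : skewCoeff 0 n α [] = 0 := by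
  rw [skewCoeff, if_neg]
  rintro ⟨-, -, -, h⟩
  obtain ⟨i, -, hi⟩ := h.least
  simp [rowLen] at hi

theorem skewCoeff_zero_one {α : List ℕ} (hα : ∀ b ∈ α, 0 < b) (β : List ℕ) :
    skewCoeff 0 1 α β = optVec (step 0 α) β := by
  classical
  rw [optVec_apply, step]
  by_cases hβ : β = 1 :: α
  · subst hβ
    rw [if_pos rfl]
    have hpad : padded α (1 :: α) = 0 :: α := by
      rw [padded_cons le_rfl, padded_of_length_eq rfl]
    have hadd : ∀ i c, Added (rowLen (0 :: α)) (rowLen (1 :: α)) i c ↔ i = 0 ∧ c = 0 := by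
      rintro (_ | i) c
      · simp [Added, rowLen]
      · simp [Added, rowLen]
    have hstrip : SkewStrip 0 1 α (1 :: α) := by
      refine ⟨by simpa using hα, by simp [add_comm], by simp, ?_⟩
      rw [hpad]
      refine ⟨?_, ⟨0, by simp [hadd]⟩, fun i c _ => Nat.zero_le c, ?_, ?_, ?_, ?_, ?_⟩
      · rintro (_ | i) <;> simp [rowLen]
      all_goals simp only [hadd]
      · rintro c - ⟨i, -, hi⟩
        omega
      · rintro i j c hij hc ⟨-, rfl⟩
        omega
      · rintro i - ⟨-, h⟩
        omega
      · rintro i c hc ⟨-, rfl⟩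
        omega
      · rintro c - ⟨i, -, hi⟩
        omega
    have h1 : (changedRows (rowLen α) (rowLen α) α.length).card = 0 := by simp [changedRows]
    rw [skewCoeff, if_pos hstrip, hpad, stripSign, List.length_cons, card_changedRows_cons, h1]
    simp
  · rw [if_neg (by simpa using Ne.symm hβ), skewCoeff, if_neg]
    intro h
    have hlen := h.length_lt hα
    obtain ⟨h1, h2, h3, h4⟩ := h
    rcases β with _ | ⟨b, B⟩
    · simp at hlen
    have hlen' : α.length ≤ B.length := by simp at hlen; omega
    have hb : 0 < b := h1 b (by simp)
    rw [padded_cons hlen'] at h4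
    have hpB : padded α B = B := by
      refine eq_of_rowLen_le (length_padded hlen') ?_ fun i => h4.le (i + 1)
      rw [sum_padded]
      simp only [List.sum_cons] at h2
      omega
    have hsum := sum_padded α B
    rw [hpB] at hsum
    have hb1 : b = 1 := by
      simp only [List.sum_cons] at h2
      omega
    have hlenB : α.length = B.length := by
      by_contra hne
      have h5 := padded_eq_zero (α := α) (β := B) (i := 0) (by omega)
      rw [hpB] at h5
      have h6 : 0 < rowLen B 0 := h1 _ (List.mem_cons_of_mem _ (getD_mem (by omega)))
      omega
    rw [padded_of_length_eq hlenB] at hpB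
    exact hβ (by rw [hb1, hpB])

/-- The recursion for the part of the power sum with least letter `0`, on the side of strips. -/
theorem skewCoeff_zero_succ {n : ℕ} (hn : 1 ≤ n) {α : List ℕ} (hα : ∀ b ∈ α, 0 < b)
    {v₁ v₂ v₃ : DiagramSpace} (h₁ : ∀ γ, v₁ γ = skewCoeff 0 n α γ)
    (h₂ : ∀ γ, v₂ γ = stripCoeff 1 n (1 :: α) γ) (h₃ : ∀ γ, v₃ γ = stripCoeff 1 n α γ)
    (β : List ℕ) :
    skewCoeff 0 (n + 1) α β = -stepOp 0 v₁ β + (v₂ β - stepOp 0 v₃ β) := by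
  classical
  rcases β with _ | ⟨b, B⟩
  · have : ¬ EqStrip 1 n (1 :: α) [] := fun h => by simpa using h.1
    rw [skewCoeff_nil, stepOp_zero_nil, stepOp_zero_nil, h₂, stripCoeff, if_neg this]
    simp
  rw [stepOp_zero_cons, stepOp_zero_cons, h₁, h₂, h₃]
  rcases lt_trichotomy B.length α.length with hlen | hlen | hlen
  · have e1 : ¬ SkewStrip 0 (n + 1) α (b :: B) := fun h => by
      have := h.length_lt hα
      simp at this
      omega
    have e2 : ¬ SkewStrip 0 n α B := fun h => by
      have := h.length_lt hα
      omega
    have e3 : ¬ EqStrip 1 n (1 :: α) (b :: B) := fun h => by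
      have := h.1
      simp at this
      omega
    have e4 : ¬ EqStrip 1 n α B := fun h => by
      have := h.1
      omega
    simp [skewCoeff, stripCoeff, e1, e2, e3, e4]
  · -- a single new row
    have e2 : ¬ SkewStrip 0 n α B := fun h => by
      have := h.length_lt hα
      omega
    have hA : ∀ i c, Added (rowLen α) (rowLen B) i c → 1 ≤ c := by
      intro i c hi
      have hiB : i < B.length := lt_length_of_rowLen_pos (by have := hi.2; omega)
      have h5 : 0 < rowLen α i := hα _ (getD_mem (by omega))
      have := hi.1
      omega
    have hpad : padded α (b :: B) = 0 :: α := by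
      rw [padded_cons hlen.ge, padded_of_length_eq hlen.symm]
    rw [skewCoeff, skewCoeff, if_neg e2, hpad]
    by_cases hb : b = 1
    · subst hb
      have e3 : ¬ EqStrip 1 n (1 :: α) (1 :: B) := fun h => by
        obtain ⟨j, hj⟩ := h.2.2.least
        rcases j with _ | j
        · have := hj.2
          simp [rowLen] at this
        · have := h.2.2.left 0 (j + 1) 1 (by omega) le_rfl hj rfl
          simp [rowLen] at this
      have hiff : SkewStrip 0 (n + 1) α (1 :: B) ↔ EqStrip 1 n α B := by
        rw [SkewStrip, EqStrip, hpad]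
        constructor
        · rintro ⟨h1, h2, -, h4⟩
          simp only [List.sum_cons] at h2
          refine ⟨hlen.symm, by omega, (isStrip_row_short hA ?_).1 h4⟩
          by_contra hno
          push Not at hno
          have : B = α := eq_of_rowLen_le hlen (by omega) hno
          rw [this] at h2
          omega
        · rintro ⟨h1, h2, h3⟩
          have h5 := pos_of_le h1 hα h3.le
          exact ⟨by simpa using h5, by simp; omega, by simp; omega,
            (isStrip_row_short hA h3.exists_lt).2 h3⟩
      simp only [hiff, stripCoeff, if_neg e3, if_true]
      split_ifs with h
      · rw [stripSign_cons (by omega) h.2.2.exists_lt]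
        ring
      · ring
    · have hiff : SkewStrip 0 (n + 1) α (b :: B) ↔ EqStrip 1 n (1 :: α) (b :: B) := by
        rw [SkewStrip, EqStrip, hpad]
        constructor
        · rintro ⟨h1, h2, -, h4⟩
          have := h1 b (by simp)
          exact ⟨by simp [hlen], by simp at h2 ⊢; omega, (isStrip_row_long hA (by omega)).1 h4⟩
        · rintro ⟨h1, h2, h4⟩
          have h5 : 1 ≤ b := h4.le 0
          refine ⟨?_, by simp at h2 ⊢; omega, by simp; omega,
            (isStrip_row_long hA (by omega)).2 h4⟩
          simpa using ⟨h5, pos_of_le hlen.symm hα fun i => h4.le (i + 1)⟩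
      simp only [hiff, stripCoeff, if_neg hb]
      split_ifs with h
      · have h5 : 1 ≤ b := h.2.2.le 0
        rw [stripSign, stripSign, List.length_cons, card_changedRows_cons, card_changedRows_cons,
          if_pos (by omega), if_pos (by omega)]
        ring
      · ring
  · -- several new rows
    have e3 : ¬ EqStrip 1 n (1 :: α) (b :: B) := fun h => by
      have := h.1
      simp at this
      omega
    have e4 : ¬ EqStrip 1 n α B := fun h => by
      have := h.1
      omega
    have hpad : padded α (b :: B) = 0 :: padded α B := padded_cons hlen.le b
    have hiff : SkewStrip 0 (n + 1) α (b :: B) ↔ b = 1 ∧ SkewStrip 0 n α B := by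
      rw [SkewStrip, SkewStrip, hpad]
      have h0 : (∀ c ∈ B, 0 < c) → Added (rowLen (padded α B)) (rowLen B) 0 0 := fun hB =>
        ⟨(padded_eq_zero (by omega)).le, hB _ (getD_mem (by omega))⟩
      constructor
      · rintro ⟨h1, h2, h3, h4⟩
        simp only [List.mem_cons, forall_eq_or_imp, List.sum_cons] at h1 h2
        obtain ⟨rfl, h5⟩ := h4.remove_row h1.1 (h0 h1.2)
        exact ⟨rfl, h1.2, by omega, hlen.le, h5⟩
      · rintro ⟨rfl, h1, h2, h3, h4⟩
        exact ⟨by simpa using h1, by simp; omega, by simp; omega, h4.add_row (h0 h1)⟩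
    simp only [skewCoeff, stripCoeff, if_neg e3, if_neg e4, hiff, hpad]
    by_cases hb : b = 1
    · subst hb
      simp only [true_and, if_true]
      split_ifs with h
      · rw [stripSign_cons (by omega) h.2.2.2.exists_lt]
        ring
      · ring
    · simp [hb]

/-- The part of the power sum with least letter `a` adds the strips with leftmost column `a`. -/
theorem leastLetterSum_apply_eq_skewCoeff {N n : ℕ} (a : ℕ) {α : List ℕ} (hα : ∀ b ∈ α, 0 < b)
    (hN : α.sum + (n + 1) ≤ N) (β : List ℕ) :
    leastLetterSum (boxOp N) (n + 1) a (Finsupp.single α 1) β = skewCoeff a (n + 1) α β := by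
  rcases Nat.eq_zero_or_pos a with rfl | ha
  swap
  · rw [leastLetterSum_apply ha hN, skewCoeff_eq ha hα]
  induction n generalizing β with
  | zero => rw [zero_add, leastLetterSum, boxOp_single (by omega), skewCoeff_zero_one hα]
  | succ n ih =>
    have hop : boxOp N 0 = stepOp 0 := if_pos (by omega)
    rw [skewCoeff_zero_succ (by omega) hα
      (v₁ := leastLetterSum (boxOp N) (n + 1) 0 (Finsupp.single α 1))
      (v₂ := leastLetterSum (boxOp N) (n + 1) 1 (Finsupp.single (1 :: α) 1))
      (v₃ := leastLetterSum (boxOp N) (n + 1) 1 (Finsupp.single α 1)) (ih (by omega))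
      (leastLetterSum_apply le_rfl (by simp; omega)) (leastLetterSum_apply le_rfl (by omega)),
      leastLetterSum]
    simp only [LinearMap.add_apply, LinearMap.sub_apply, LinearMap.neg_apply,
      Module.End.mul_apply, Finsupp.add_apply, Finsupp.sub_apply, Finsupp.neg_apply,
      boxOp_single (by omega : 0 < N)]
    rw [hop]
    rfl

/-! ### Strips in the reverse composition poset -/

/-- Each diagram in the expansion of the power sum lies above the original one. -/
theorem leastLetterSum_mem_diagramSpan {N : ℕ} (n a : ℕ) (α : List ℕ) :
    leastLetterSum (boxOp N) (n + 1) a (Finsupp.single α 1) ∈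
      diagramSpan (Relation.TransGen Covers α) := by
  have hbox : ∀ a α, boxOp N a (Finsupp.single α 1) ∈
      diagramSpan fun β => step a α = some β := fun a α =>
    boxOp_mem_diagramSpan (P := (· = α)) (by rintro β β' rfl h; exact h)
      (single_mem_diagramSpan rfl)
  have htail : ∀ (a : ℕ) {α : List ℕ} {v : DiagramSpace},
      v ∈ diagramSpan (Relation.TransGen Covers α) →
      boxOp N a v ∈ diagramSpan (Relation.TransGen Covers α) := fun a α v hv =>
    boxOp_mem_diagramSpan (fun β β' h hs => h.tail (covers_of_step hs)) hv
  induction n generalizing a α with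
  | zero =>
    rw [zero_add, leastLetterSum]
    exact Submodule.span_mono (Set.image_mono fun β h => .single (covers_of_step h)) (hbox a α)
  | succ n ih =>
    rw [leastLetterSum]
    simp only [LinearMap.add_apply, LinearMap.sub_apply, LinearMap.neg_apply,
      Module.End.mul_apply]
    refine add_mem (neg_mem (htail a (ih a α))) (sub_mem ?_ (htail a (ih (a + 1) α)))
    -- a box is added before the strip
    have := hbox a α
    generalize boxOp N a (Finsupp.single α 1) = v at this
    induction this using Submodule.span_induction with
    | mem x hx =>
      obtain ⟨β, hβ, rfl⟩ := hx
      exact Submodule.span_mono (Set.image_mono fun γ h => .head (covers_of_step hβ) h)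
        (ih (a + 1) β)
    | zero => simp
    | add x y _ _ hx hy => rw [map_add]; exact add_mem hx hy
    | smul r x _ hx => rw [map_smul]; exact Submodule.smul_mem _ _ hx

theorem mem_of_mem_diagramSpan {P : List ℕ → Prop} {v : DiagramSpace} (hv : v ∈ diagramSpan P)
    {β : List ℕ} (h : v β ≠ 0) : P β := by
  have h1 : v ∈ Finsupp.supported ℚ ℚ {β | P β} := by
    rw [Finsupp.supported_eq_span_single]
    exact hv
  exact (Finsupp.mem_supported ℚ v).1 h1 (Finsupp.mem_support_iff.2 h)

theorem transGen_of_skewStrip {a n : ℕ} {α β : List ℕ} (hα : ∀ b ∈ α, 0 < b)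
    (h : SkewStrip a (n + 1) α β) : Relation.TransGen Covers α β := by
  refine mem_of_mem_diagramSpan
    (leastLetterSum_mem_diagramSpan (N := α.sum + (n + 1)) n a α) ?_
  rw [leastLetterSum_apply_eq_skewCoeff a hα le_rfl, skewCoeff, if_pos h, stripSign]
  exact pow_ne_zero _ (by norm_num)

/-- What the order of compositions says about row lengths: rows only grow, and when a box `(j, c)`
is added, no row above `j` of length `c` stays as it is. -/
theorem rowLen_of_transGen {α γ : List ℕ} (h : Relation.TransGen Covers α γ) :
    α.length ≤ γ.length ∧ (∀ i, rowLen (padded α γ) i ≤ rowLen γ i) ∧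
      ∀ i j c, i < j → 1 ≤ c → Added (rowLen (padded α γ)) (rowLen γ) j c →
        rowLen (padded α γ) i = c → c < rowLen γ i := by
  have key : ∀ {γ δ : List ℕ}, Covers γ δ → (α.length ≤ γ.length ∧
      (∀ i, rowLen (padded α γ) i ≤ rowLen γ i) ∧
      ∀ i j c, i < j → 1 ≤ c → Added (rowLen (padded α γ)) (rowLen γ) j c →
        rowLen (padded α γ) i = c → c < rowLen γ i) → α.length ≤ δ.length ∧
      (∀ i, rowLen (padded α δ) i ≤ rowLen δ i) ∧
      ∀ i j c, i < j → 1 ≤ c → Added (rowLen (padded α δ)) (rowLen δ) j c →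
        rowLen (padded α δ) i = c → c < rowLen δ i := by
    rintro γ δ hcov ⟨h1, h2, h3⟩
    cases hcov with
    | cons =>
      rw [padded_cons h1]
      refine ⟨by simp; omega, ?_, ?_⟩
      · rintro (_ | i)
        · exact Nat.zero_le _
        · exact h2 i
      · rintro (_ | i) (_ | j) c hij hc hj hi
        · omega
        · have : 0 = c := hi
          omega
        · omega
        · exact h3 i j c (by omega) hc hj hi
    | incr l r a ha =>
      have hset : l ++ (a + 1) :: r = (l ++ a :: r).set l.length (a + 1) := by simp
      have hp : l.length < (l ++ a :: r).length := by simp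
      have hpad : padded α (l ++ (a + 1) :: r) = padded α (l ++ a :: r) := by
        rw [padded, padded]
        simp
      have hrow : rowLen (l ++ a :: r) l.length = a := by simp [rowLen]
      have hlt : ∀ i < l.length, rowLen (l ++ a :: r) i ≠ a := by
        intro i hi h
        rw [rowLen, List.getD_append _ _ _ _ hi] at h
        exact ha (h ▸ getD_mem hi)
      rw [hpad, hset, rowLen_set hp, List.length_set]
      refine ⟨h1, fun i => ?_, fun i j c hij hc hj hi => ?_⟩
      · have := h2 i
        rw [Function.update_apply]
        split_ifs with hi
        · subst hi; omega
        · exact this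
      · have hle := h2 i
        by_cases hnew : j = l.length ∧ c = a
        · obtain ⟨rfl, rfl⟩ := hnew
          have := hlt i hij
          rw [Function.update_of_ne hij.ne]
          omega
        · have := h3 i j c hij hc (by
            simp only [Added, Function.update_apply] at hj ⊢
            grind) hi
          rw [Function.update_apply]
          split_ifs with hi'
          · subst hi'; omega
          · exact this
  have hrefl : α.length ≤ α.length ∧ (∀ i, rowLen (padded α α) i ≤ rowLen α i) ∧
      ∀ i j c, i < j → 1 ≤ c → Added (rowLen (padded α α)) (rowLen α) j c →
        rowLen (padded α α) i = c → c < rowLen α i := by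
    rw [padded_of_length_eq rfl]
    refine ⟨le_rfl, fun i => le_rfl, fun i j c _ _ hj _ => ?_⟩
    have := hj.1
    have := hj.2
    omega
  induction h with
  | single h => exact key h hrefl
  | tail _ h ih => exact key h ih

theorem mem_skewShape {m k : ℕ} (α : Composition m) (β : Composition k) (i c : ℕ) :
    (i, c) ∈ skewShape α β ↔ Added (rowLen (padded α.blocks β.blocks)) (rowLen β.blocks) i c := by
  simp only [skewShape, mem_filter, mem_product, mem_range]
  change _ ∧ Added (rowLen (padded α.blocks β.blocks)) (rowLen β.blocks) i c ↔ _
  refine ⟨fun h => h.2, fun h => ⟨?_, h⟩⟩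
  have hi : i < β.blocks.length := lt_length_of_rowLen_pos (by have := h.2; omega)
  exact ⟨hi, h.2.trans_le ((List.le_sum_of_mem (getD_mem hi)).trans β.blocks_sum.le)⟩

theorem height_skewShape {m k : ℕ} (α : Composition m) (β : Composition k) :
    (-1 : ℚ) ^ height (skewShape α β) = stripSign (padded α.blocks β.blocks) β.blocks := by
  rw [height, stripSign]
  congr 3
  ext i
  simp only [mem_image, Prod.exists, exists_and_right, exists_eq_right, mem_skewShape, changedRows,
    mem_filter, mem_range]
  constructor
  · rintro ⟨c, h1, h2⟩
    exact ⟨lt_length_of_rowLen_pos (by omega), by omega⟩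
  · rintro ⟨-, h⟩
    exact ⟨_, le_rfl, h⟩

/-- The set `P_{α,n}` consists of the strips of size `n`, with any leftmost column. -/
theorem mem_stripSet {m n : ℕ} (hn : 1 ≤ n) (α : Composition m) (β : Composition (m + n)) :
    β ∈ stripSet α n ↔ ∃ a, SkewStrip a n α.blocks β.blocks := by
  classical
  have hcol : ∀ c, c ∈ ((skewShape α β).image Prod.snd : Set ℕ) ↔
      ∃ i, Added (rowLen (padded α.blocks β.blocks)) (rowLen β.blocks) i c := by
    intro c
    rw [Finset.mem_coe, mem_image]
    constructor
    · rintro ⟨⟨i, c⟩, h, rfl⟩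
      exact ⟨i, (mem_skewShape α β _ _).1 h⟩
    · rintro ⟨i, h⟩
      exact ⟨(i, c), (mem_skewShape α β _ _).2 h, rfl⟩
  have hα : ∀ b ∈ α.blocks, 0 < b := fun b hb => α.blocks_pos hb
  rw [stripSet, mem_filter]
  constructor
  · rintro ⟨-, hlt, hstrip, hne⟩
    obtain ⟨hlen, hle, hleft⟩ := rowLen_of_transGen hlt
    have hex : ∃ c i, Added (rowLen (padded α.blocks β.blocks)) (rowLen β.blocks) i c := by
      by_contra hno
      have hge : ∀ i, rowLen β.blocks i ≤ rowLen (padded α.blocks β.blocks) i := by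
        intro i
        by_contra hi
        exact hno ⟨_, i, le_rfl, not_le.1 hi⟩
      have := eq_of_rowLen_le (length_padded hlen).symm
        (by rw [sum_padded, α.blocks_sum, β.blocks_sum]; omega) hge
      have h1 := β.blocks_sum
      rw [this, sum_padded, α.blocks_sum] at h1
      omega
    refine ⟨Nat.find hex, fun b hb => β.blocks_pos hb, by rw [α.blocks_sum, β.blocks_sum], hlen,
      hle, Nat.find_spec hex, fun i c hi => Nat.find_min' hex ⟨i, hi⟩, ?_, hleft, ?_, ?_, ?_⟩
    · intro c hc h
      have h1 := hstrip.interval.out ((hcol _).2 (Nat.find_spec hex)) ((hcol _).2 h)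
      exact (hcol c).1 (h1 ⟨hc, Nat.le_succ c⟩)
    · intro i h1 h2 i' h3
      rw [← mem_skewShape] at h1 h2 h3
      exact hstrip.first i h1 h2 i' h3
    · intro i c hc h1 h2 i' h3
      rw [← mem_skewShape] at h1 h2 h3
      exact hstrip.other i c hc h1 h2 i' h3
    · intro c h1 h2
      have := hne c
      simp only [IsNorthEast, mem_skewShape] at this
      by_contra hno
      push Not at hno
      exact this ⟨h1, h2, hno⟩
  · rintro ⟨a, h⟩
    obtain ⟨k, rfl⟩ : ∃ k, n = k + 1 := ⟨n - 1, by omega⟩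
    refine ⟨mem_univ _, transGen_of_skewStrip hα h, ⟨?_, ?_, ?_⟩, ?_⟩
    · refine ⟨fun c hc d hd e he => ?_⟩
      rw [hcol] at hc hd ⊢
      obtain ⟨i, hi⟩ := hc
      have hae := (h.2.2.2.ge i c hi).trans he.1
      -- descend from column `d` to column `e`
      obtain ⟨f, rfl⟩ := Nat.exists_eq_add_of_le he.2
      clear he
      induction f with
      | zero => exact hd
      | succ f ih => exact ih (h.2.2.2.conn (e + f) (by omega) hd)
    · intro i h1 h2 i' h3
      rw [mem_skewShape] at h1 h2 h3
      exact h.2.2.2.first i h1 h2 i' h3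
    · intro i c hc h1 h2 i' h3
      rw [mem_skewShape] at h1 h2 h3
      exact h.2.2.2.other i c hc h1 h2 i' h3
    · rintro c ⟨h1, h2, h3⟩
      simp only [mem_skewShape] at h1 h2 h3
      obtain ⟨i₁, i₂, h4, h5, h6⟩ := h.2.2.2.notNE c h1 h2
      have := h3 i₁ i₂ h4 h5
      omega

theorem IsStrip.least_unique {a a' : ℕ} {x y : ℕ → ℕ} (h : IsStrip a x y) (h' : IsStrip a' x y) :
    a = a' := by
  obtain ⟨i, hi⟩ := h.least
  obtain ⟨j, hj⟩ := h'.least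
  exact le_antisymm (h.ge j a' hj) (h'.ge i a hi)

/-- The power sums act on diagrams by the Murnaghan–Nakayama rule. -/
theorem boxRep_powerSum_single {m n : ℕ} (hn : 1 ≤ n) (α : Composition m) :
    boxRep (m + n) (powerSum n) (Finsupp.single α.blocks 1) =
      ∑ β ∈ stripSet α n, (-1 : ℚ) ^ height (skewShape α β) • Finsupp.single β.blocks (1 : ℚ) := by
  classical
  obtain ⟨k, rfl⟩ : ∃ k, n = k + 1 := ⟨n - 1, by omega⟩
  have hα : ∀ b ∈ α.blocks, 0 < b := fun b hb => α.blocks_pos hb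
  have hb : ∀ α β : Composition (m + (k + 1)), α.blocks = β.blocks ↔ α = β := fun α β =>
    ⟨Composition.ext, fun h => by rw [h]⟩
  ext β
  rw [boxRep_powerSum, LinearMap.sum_apply, Finsupp.finsetSum_apply, Finsupp.finsetSum_apply]
  simp only [leastLetterSum_apply_eq_skewCoeff _ hα (by rw [α.blocks_sum]), Finsupp.smul_apply,
    Finsupp.single_apply]
  by_cases hβ : (∀ b ∈ β, 0 < b) ∧ β.sum = m + (k + 1)
  · obtain ⟨β, rfl⟩ := exists_blocks_eq hβ.1 hβ.2
    simp only [hb, smul_eq_mul, mul_ite, mul_one, mul_zero, sum_ite_eq', mem_stripSet hn]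
    split_ifs with h
    · obtain ⟨a, ha⟩ := h
      have hlt : a < m + (k + 1) := by
        obtain ⟨i, hi⟩ := ha.2.2.2.least
        have := (mem_skewShape α β i a).2 hi
        simp only [skewShape, mem_filter, mem_product, mem_range] at this
        exact this.1.2
      rw [sum_eq_single a, skewCoeff, if_pos ha, height_skewShape]
      · intro c _ hc
        rw [skewCoeff, if_neg]
        exact fun h => hc (h.2.2.2.least_unique ha.2.2.2)
      · intro hno
        exact absurd (mem_range.2 hlt) hno
    · exact sum_eq_zero fun a _ => by rw [skewCoeff, if_neg fun h' => h ⟨a, h'⟩]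
  · rw [sum_eq_zero, sum_eq_zero]
    · intro γ _
      rw [if_neg, smul_zero]
      rintro rfl
      exact hβ ⟨fun b hb => γ.blocks_pos hb, γ.blocks_sum⟩
    · intro a _
      rw [skewCoeff, if_neg]
      rintro ⟨h1, h2, -⟩
      exact hβ ⟨h1, by rw [h2, α.blocks_sum]⟩

/-- The noncommutative Murnaghan–Nakayama rule. -/
theorem powerSum_mul_ncSchur {m n : ℕ} (hn : 1 ≤ n) (α : Composition m) :
    powerSum n * ncSchur α =
      ∑ β ∈ stripSet α n, (-1 : ℚ) ^ height (skewShape α β) • ncSchur β := by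
  refine eq_of_onEmpty_eq (le_refl (m + n)) ?_ ?_ ?_
  · rw [add_comm m n]
    exact powerSum_mul_mem_ribbonSpan n (ncSchur_mem_ribbonSpan α)
  · exact sum_mem fun β _ => Submodule.smul_mem _ _ (ncSchur_mem_ribbonSpan β)
  · rw [onEmpty_mul, onEmpty_ncSchur (Nat.le_add_right m n), boxRep_powerSum_single hn, map_sum]
    exact sum_congr rfl fun β _ => by rw [map_smul, onEmpty_ncSchur le_rfl]

end NCSchur

theorem theorem5 :
    (∀ (k : ℕ) (γ : Composition k),
      NCSchur.ribbon γ =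
        ∑ δ : Composition k, (NCSchur.numSRCT δ γ : ℚ) • NCSchur.ncSchur δ) ∧
    ∀ (m : ℕ) (α : Composition m) (n : ℕ), 1 ≤ n →
      NCSchur.powerSum n * NCSchur.ncSchur α =
        ∑ β ∈ NCSchur.stripSet α n,
          (-1 : ℚ) ^ NCSchur.height (NCSchur.skewShape α β) • NCSchur.ncSchur β :=
  ⟨fun _ γ => NCSchur.ribbon_eq_sum_ncSchur γ,
    fun _ α _ hn => NCSchur.powerSum_mul_ncSchur hn α⟩
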